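/- Let $\tau\in i\mathbb R_{>0}$, $p=e^{2\pi i\tau}$, $(p;p)_\infty=\prod_{j\ge 0}(1-p^{j+1})$, and $$\theta(x)=i\sum_{n=-\infty}^\infty(-1)^n e^{\pi i\tau(n-1/2)^2+\pi i(2n-1)x}.$$ Let $N\ge 0$ be an integer and let $\Theta_N$ be the space of entire functions $f$ with $$f(x+1)=f(x),\qquad f(x+\tau)=e^{-2\pi iN(2x+\tau)}f(x),\qquad f(-x)=f(x).$$ For integers $n\ge -1$ put $$\mathbb R_n=\{\eta\in\mathbb R:\ 2(n+1)|\eta|<1\},\qquad \mathbb I_n=\{\eta\in i\mathbb R:\ 2(n+1)|\eta|<\tau/i\}.$$ For $\eta\in\mathbb R_N\cup\mathbb I_N$ and $f,g\in\Theta_N$ let $$\langle f,g\rangle=\iint_{\mathbb C/(\mathbb Z+\tau\mathbb Z)}f(u)\,\overline{g(u)}\,M(u,\bar u)\,dx\,dy\quad(u=x+iy),$$ $$M(u,v)=\frac{\theta(2u)\,\theta(2v)}{e^{2\pi iu(N+2)}\prod_{k=0}^{N+1}\theta(u+v+c_k)\,\theta(u-v+c_k)},\qquad c_k=(2k-N-1)\eta+\tfrac12+\tfrac\tau2,$$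 and let $$C=\frac{2\eta\,p^{3/8}}{\theta(2(N+1)\eta)\,(p;p)_\infty^3}\quad(\eta\ne0),\qquad C=\frac{p^{1/4}}{2\pi(N+1)(p;p)_\infty^6}\quad(\eta=0).$$ Then $C^{-1}\langle f,g\rangle$ has an analytic continuation in $\eta$ from $\mathbb R_N\cup\mathbb I_N$ to $\mathbb R_{N-1}\cup\mathbb I_{N-1}$, and this continuation is positive definite for every $\eta\in\mathbb R_{N-1}\cup\mathbb I_{N-1}$. That is, there are a connected open set $U\subseteq\mathbb C$ containing $\mathbb R_{N-1}\cup\mathbb I_{N-1}$ and, for each $\eta\in\mathbb C$, a form $B_\eta$ on $\Theta_N$, linear in the first and conjugate linear in the second argument, such that for all $f,g\in\Theta_N$ the function $\eta\mapsto B_\eta(f,g)$ is holomorphic in $U$ and equals $C^{-1}\langle f,g\rangle$ for $\eta\in\mathbb R_N\cup\mathbb I_N$; and for every $\eta\in\mathbb R_{N-1}\cup\mathbb I_{N-1}$ the form $B_\eta$ is Hermitian and satisfies $B_\eta(f,f)>0$ for all $f\ne0$. -/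

import Mathlib

/-!
Conventions: `τ` is a purely imaginary number with positive imaginary part, `p = exp (2 π i τ)`,
so that `0 < p < 1`.
-/

noncomputable section

namespace Sklyanin

/-- The nome `p = exp (2 π i τ)`. -/
def nome (τ : ℂ) : ℂ := Complex.exp (2 * Real.pi * Complex.I * τ)

/-- The infinite product `(p; p)_∞ = ∏_{j ≥ 0} (1 - p * p ^ j)`. -/
def nomeProd (τ : ℂ) : ℂ := ∏' j : ℕ, (1 - nome τ * nome τ ^ j)

/-- Jacobi's theta function
`θ₁(x | τ) = i ∑_{n ∈ ℤ} (-1)^n exp (π i τ (n - 1/2)² + π i (2 n - 1) x)`. -/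
def theta (τ x : ℂ) : ℂ :=
  Complex.I * ∑' n : ℤ, (-1 : ℂ) ^ n *
    Complex.exp (Real.pi * Complex.I * τ * ((n : ℂ) - 1 / 2) ^ 2 +
      Real.pi * Complex.I * (2 * (n : ℂ) - 1) * x)

/-- The space `Θ_N` of even theta functions of order `2 N` with quasi-period `(1, τ)` and zero
characteristics, as a space of entire functions. -/
def thetaSpace (τ : ℂ) (N : ℕ) : Submodule ℂ (ℂ → ℂ) where
  carrier := {f | Differentiable ℂ f ∧ (∀ x, f (x + 1) = f x) ∧
    (∀ x, f (x + τ) = Complex.exp (-(2 * Real.pi * Complex.I * N * (2 * x + τ))) * f x) ∧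
    (∀ x, f (-x) = f x)}
  add_mem' := by
    rintro f g ⟨hf, hf1, hf2, hf3⟩ ⟨hg, hg1, hg2, hg3⟩
    refine ⟨hf.add hg, fun x => ?_, fun x => ?_, fun x => ?_⟩
    · simp [hf1, hg1]
    · simp [hf2, hg2, mul_add]
    · simp [hf3, hg3]
  zero_mem' := ⟨differentiable_const 0, by simp, by simp, by simp⟩
  smul_mem' := by
    rintro c f ⟨hf, hf1, hf2, hf3⟩
    refine ⟨hf.const_smul c, fun x => ?_, fun x => ?_, fun x => ?_⟩
    · simp [hf1]
    · simp [hf2, mul_left_comm]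
    · simp [hf3]

/-- The weight function
`M(u, v) = θ(2u) θ(2v) /
  (e^{2 π i u (N + 2)} ∏_{k=0}^{N+1} θ(u ± v + (2 k - N - 1) η + 1/2 + τ/2))`,
where a sign `±` stands for the product of the two factors. -/
def weight (τ : ℂ) (N : ℕ) (η u v : ℂ) : ℂ :=
  theta τ (2 * u) * theta τ (2 * v) /
    (Complex.exp (2 * Real.pi * Complex.I * u * ((N : ℂ) + 2)) *
      ∏ k ∈ Finset.range (N + 2),
        (theta τ (u + v + (2 * (k : ℂ) - N - 1) * η + 1 / 2 + τ / 2) *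
          theta τ (u - v + (2 * (k : ℂ) - N - 1) * η + 1 / 2 + τ / 2)))

/-- The rectangle `0 ≤ Re u < 1`, `0 ≤ Im u < Im τ`, a fundamental domain of the torus
`ℂ / (ℤ + τ ℤ)` (for `τ` purely imaginary). -/
def fundRect (τ : ℂ) : Set ℂ := {u | u.re ∈ Set.Ico (0 : ℝ) 1 ∧ u.im ∈ Set.Ico (0 : ℝ) τ.im}

/-- Sklyanin's metric `⟨f, g⟩ = ∬ f(u) conj(g(u)) M(u, conj u) dx dy`, the integral being over the
torus `ℂ / (ℤ + τ ℤ)`, `u = x + i y`. -/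
def metric (τ : ℂ) (N : ℕ) (η : ℂ) (f g : ℂ → ℂ) : ℂ :=
  ∫ u in fundRect τ, f u * (starRingEnd ℂ) (g u) * weight τ N η u ((starRingEnd ℂ) u)

open Classical in
/-- The constant `C = 2 η p^{3/8} / (θ(2 (N + 1) η) (p; p)_∞³)`; at the removable singularity
`η = 0` its value is the limit `p^{1/4} / (2 π (N + 1) (p; p)_∞⁶)`. -/
def normConst (τ : ℂ) (N : ℕ) (η : ℂ) : ℂ :=
  if η = 0 then nome τ ^ (1 / 4 : ℂ) / (2 * Real.pi * ((N : ℂ) + 1) * nomeProd τ ^ 6)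
  else 2 * η * nome τ ^ (3 / 8 : ℂ) / (theta τ (2 * ((N : ℂ) + 1) * η) * nomeProd τ ^ 3)

/-- `ℝ_n = {η ∈ ℝ : |η| < 1 / (2 (n + 1))}` as a subset of `ℂ`, for an integer `n ≥ -1`. The bound
is multiplied out, so that for `n = -1` the condition on `|η|` is void. -/
def realRange (n : ℤ) : Set ℂ := {η | η.im = 0 ∧ 2 * ((n : ℝ) + 1) * ‖η‖ < 1}

/-- `𝕀_n = {η ∈ i ℝ : |η| < (τ / i) / (2 (n + 1))}`, for an integer `n ≥ -1`; again the bound is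
multiplied out. -/
def imagRange (τ : ℂ) (n : ℤ) : Set ℂ := {η | η.re = 0 ∧ 2 * ((n : ℝ) + 1) * ‖η‖ < τ.im}

/-- A sesquilinear form (linear in the first, conjugate linear in the second argument) is positive
definite if it is Hermitian and its values on the diagonal are real and positive away from `0`. -/
def IsPosDefForm {V : Type*} [AddCommGroup V] [Module ℂ V]
    (B : V →ₗ[ℂ] V →ₗ⋆[ℂ] ℂ) : Prop :=
  (∀ f g, B g f = (starRingEnd ℂ) (B f g)) ∧
    ∀ f, f ≠ 0 → (B f f).im = 0 ∧ 0 < (B f f).re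

/-- `B` is an analytic continuation in `η` of the form `C⁻¹ ⟨f, g⟩` from `ℝ_N ∪ 𝕀_N`, where the
integral defines it, to the connected open set `U ⊆ ℂ`: for all fixed `f, g ∈ Θ_N` the function
`η ↦ B η f g` is holomorphic in `U`, and it equals `C⁻¹ ⟨f, g⟩` on `ℝ_N ∪ 𝕀_N`. -/
structure IsContinuation (τ : ℂ) (N : ℕ) (U : Set ℂ)
    (B : ℂ → thetaSpace τ N →ₗ[ℂ] thetaSpace τ N →ₗ⋆[ℂ] ℂ) : Prop where
  isOpen : IsOpen U
  isConnected : IsConnected U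
  subset : realRange N ∪ imagRange τ N ⊆ U
  holomorphic : ∀ f g, DifferentiableOn ℂ (fun η => B η f g) U
  eq_metric : ∀ η ∈ realRange N ∪ imagRange τ N, ∀ f g : thetaSpace τ N,
    B η f g = (normConst τ N η)⁻¹ * metric τ N η f g

end Sklyanin

end

noncomputable section

namespace Sklyanin

open Filter Topology Complex MeasureTheory

/-! The proof is an induction on `N`. Multiplication by `theta3Pair τ b` maps `Θ_N` to `Θ_{N+1}`
(`raising`), and a difference operator `lowering` goes back. The two are adjoint: up to an explicit
factor, lowering in one argument of the metric on `Θ_N` equals raising in the other argument of the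
metric on `Θ_{N+1}` (`metric_lowering`). This follows by writing the integral in the independent
variables `w = x`, `z = i y`, moving both contours by `-η/2`, and applying a Weierstrass addition
formula.

With the normalization by `C`, adjointness reads `θ(2(N+1)η) B_{N+1}(f, raising g) = const ·
B_N(lowering f, g)`. Where `2(N+1)|Re η| < 1` and `2(N+1)|Im η| < Im τ`, the theta factor vanishes
only at `η = 0`, simply, and `lowering` vanishes there as well. Dividing therefore continues
`B_{N+1}` to this region, because two raising operators already span `Θ_{N+1}`
(`exists_eq_raising`). For `N = 0` the space consists of constants and the normalized form does not
depend on `η` (`metric_zero`).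

Positivity is also inductive. At `η = 0` the weight is nonnegative, so the integral is positive
definite there. Along the segment from `0` to `η` the form is Hermitian by reflection symmetries. It
is nondegenerate too: a vector in its radical is killed by all lowering operators, since the form at
level `N` is definite, and such a vector is zero (`eq_zero_of_lowering_eq_zero`). A continuous path
of nondegenerate Hermitian forms that starts positive definite stays so (`isPosDefForm_of_path`).

The theta function theory behind this (zeros, derivative at `0`, addition formulas) is derived from
the Jacobi triple product and Liouville's theorem. -/

/-! ### The Jacobi triple product. -/

/-- The finite `q`-factorial `∏_{j < k} (1 - p ^ (j + 1))`. -/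
def qFactorial (p : ℂ) (k : ℕ) : ℂ := ∏ j ∈ Finset.range k, (1 - p ^ (j + 1))

/-- The reciprocal of the `q`-factorial, extended by zero to negative integers. -/
def qFactorialInv (p : ℂ) (k : ℤ) : ℂ := if 0 ≤ k then (qFactorial p k.toNat)⁻¹ else 0

lemma one_sub_pow_ne_zero {p : ℂ} (hp : ‖p‖ < 1) (j : ℕ) : 1 - p ^ (j + 1) ≠ 0 := by
  intro h
  have h1 : ‖p ^ (j + 1)‖ < 1 := by
    rw [norm_pow]; exact pow_lt_one₀ (norm_nonneg _) hp (by omega)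
  rw [sub_eq_zero] at h
  rw [← h] at h1
  simp at h1

lemma qFactorial_ne_zero {p : ℂ} (hp : ‖p‖ < 1) (k : ℕ) : qFactorial p k ≠ 0 :=
  Finset.prod_ne_zero_iff.mpr fun j _ => one_sub_pow_ne_zero hp j

/-- The extension by zero is what makes the recursion hold for every integer: at `k = 0` the factor
`1 - p ^ k` vanishes. -/
lemma qFactorialInv_sub_one {p : ℂ} (hp : ‖p‖ < 1) (k : ℤ) :
    qFactorialInv p (k - 1) = (1 - p ^ k) * qFactorialInv p k := by
  rcases lt_trichotomy k 0 with hk | hk | hk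
  · simp [qFactorialInv, show ¬ (0 ≤ k) by omega, show ¬ (1 ≤ k) by omega]
  · subst hk; simp [qFactorialInv]
  · obtain ⟨n, rfl⟩ : ∃ n : ℕ, k = n + 1 := ⟨(k - 1).toNat, by omega⟩
    have h2 : ((n : ℤ) + 1).toNat = n + 1 := by omega
    have h3 := one_sub_pow_ne_zero hp n
    have h4 := qFactorial_ne_zero hp n
    have h5 : p ^ ((n : ℤ) + 1) = p ^ (n + 1) := by norm_cast
    rw [qFactorialInv, qFactorialInv, if_pos (by omega), if_pos (by omega), h2, h5]
    simp only [add_sub_cancel_right, Int.toNat_natCast]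
    rw [qFactorial, qFactorial, Finset.prod_range_succ]
    rw [qFactorial] at h4
    field_simp

/-- A finite form of the triple product, given by the `q`-binomial theorem. Adding the next pair of
factors multiplies by `1 + q^(4m+2) + q^(2m+1)(x + x⁻¹)`, which combines three neighbouring
coefficients; the coefficients vanish for `|n| > m`. -/
lemma hasSum_finite_tripleProduct {q x : ℂ} (hq : ‖q‖ < 1) (hq0 : q ≠ 0) (hx : x ≠ 0) (m : ℕ) :
    HasSum (fun n : ℤ => qFactorial (q ^ 2) (2 * m) * (qFactorialInv (q ^ 2) (m + n) *
        qFactorialInv (q ^ 2) (m - n)) * (q ^ (n ^ 2) * x ^ n))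
      (∏ j ∈ Finset.range m, ((1 + q ^ (2 * j + 1) * x) * (1 + q ^ (2 * j + 1) * x⁻¹))) := by
  have hp : ‖q ^ 2‖ < 1 := by
    rw [norm_pow]; exact pow_lt_one₀ (norm_nonneg _) hq (by omega)
  induction m with
  | zero =>
    have := hasSum_single (f := fun n : ℤ => qFactorial (q ^ 2) (2 * 0) *
      (qFactorialInv (q ^ 2) ((0 : ℕ) + n) *
        qFactorialInv (q ^ 2) ((0 : ℕ) - n)) * (q ^ (n ^ 2) * x ^ n)) 0 (by
      intro n hn
      rcases lt_or_gt_of_ne hn with h | h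
      · simp [qFactorialInv, not_le.mpr h]
      · simp [qFactorialInv, not_le.mpr h])
    simpa [qFactorial, qFactorialInv] using this
  | succ m ih =>
    rw [Finset.prod_range_succ]
    set P := ∏ j ∈ Finset.range m, ((1 + q ^ (2 * j + 1) * x) * (1 + q ^ (2 * j + 1) * x⁻¹))
    have h1 := ih.mul_left (1 + q ^ (4 * m + 2))
    have h2 := (((Equiv.subRight (1 : ℤ)).hasSum_iff).mpr ih).mul_left (q ^ (2 * m + 1) * x)
    have h3 := (((Equiv.addRight (1 : ℤ)).hasSum_iff).mpr ih).mul_left (q ^ (2 * m + 1) * x⁻¹)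
    have hr : P * ((1 + q ^ (2 * m + 1) * x) * (1 + q ^ (2 * m + 1) * x⁻¹)) =
        (1 + q ^ (4 * m + 2)) * P + q ^ (2 * m + 1) * x * P + q ^ (2 * m + 1) * x⁻¹ * P := by
      field_simp
      ring
    rw [hr]
    refine ((h1.add h2).add h3).congr_fun fun n => ?_
    simp only [Function.comp, Equiv.subRight_apply, Equiv.coe_addRight]
    have e1 : (m : ℤ) + (n - 1) = (((m + 1 : ℕ) : ℤ) + n - 1) - 1 := by push_cast; ring
    have e2 : (m : ℤ) - (n - 1) = ((m + 1 : ℕ) : ℤ) - n := by push_cast; ring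
    have e3 : (m : ℤ) + (n + 1) = ((m + 1 : ℕ) : ℤ) + n := by push_cast; ring
    have e4 : (m : ℤ) - (n + 1) = (((m + 1 : ℕ) : ℤ) - n - 1) - 1 := by push_cast; ring
    have e5 : (m : ℤ) + n = (((m + 1 : ℕ) : ℤ) + n) - 1 := by push_cast; ring
    have e6 : (m : ℤ) - n = (((m + 1 : ℕ) : ℤ) - n) - 1 := by push_cast; ring
    rw [e1, e2, e3, e4, e5, e6]
    simp only [qFactorialInv_sub_one hp]
    have e7 : qFactorial (q ^ 2) (2 * (m + 1)) = qFactorial (q ^ 2) (2 * m) *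
        ((1 - (q ^ 2) ^ (2 * m + 1)) * (1 - (q ^ 2) ^ (2 * m + 2))) := by
      rw [qFactorial, qFactorial, show 2 * (m + 1) = 2 * m + 1 + 1 by ring,
        Finset.prod_range_succ, Finset.prod_range_succ, mul_assoc]
    rw [e7]
    generalize qFactorialInv (q ^ 2) (((m + 1 : ℕ) : ℤ) + n) = a
    generalize qFactorialInv (q ^ 2) (((m + 1 : ℕ) : ℤ) - n) = b
    generalize qFactorial (q ^ 2) (2 * m) = c
    have hq2 : q ^ 2 ≠ 0 := pow_ne_zero 2 hq0
    have f1 : q ^ ((n - 1) ^ 2) = q ^ (n ^ 2) * q * (q ^ n)⁻¹ * (q ^ n)⁻¹ := by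
      rw [← zpow_neg, ← zpow_add_one₀ hq0, ← zpow_add₀ hq0, ← zpow_add₀ hq0]
      congr 1; ring
    have f2 : q ^ ((n + 1) ^ 2) = q ^ (n ^ 2) * q * (q ^ n) * (q ^ n) := by
      rw [← zpow_add_one₀ hq0, ← zpow_add₀ hq0, ← zpow_add₀ hq0]
      congr 1; ring
    have f3 : x ^ (n - 1) = x ^ n * x⁻¹ := zpow_sub_one₀ hx n
    have f4 : x ^ (n + 1) = x ^ n * x := zpow_add_one₀ hx n
    have f5 : (q ^ 2) ^ (((m + 1 : ℕ) : ℤ) + n) = q ^ (2 * m + 2) * q ^ n * q ^ n := by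
      rw [zpow_add₀ hq2, zpow_natCast, ← pow_mul, mul_assoc, ← mul_zpow]; ring_nf
    have f6 : (q ^ 2) ^ (((m + 1 : ℕ) : ℤ) - n) = q ^ (2 * m + 2) * (q ^ n)⁻¹ * (q ^ n)⁻¹ := by
      rw [zpow_sub₀ hq2, zpow_natCast, ← pow_mul, mul_assoc, ← mul_inv, ← mul_zpow,
        div_eq_mul_inv]
      ring_nf
    have f7 : (q ^ 2) ^ (((m + 1 : ℕ) : ℤ) + n - 1) = q ^ (2 * m) * q ^ n * q ^ n := by
      rw [zpow_sub_one₀ hq2, f5]; field_simp; ring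
    have f8 : (q ^ 2) ^ (((m + 1 : ℕ) : ℤ) - n - 1) = q ^ (2 * m) * (q ^ n)⁻¹ * (q ^ n)⁻¹ := by
      rw [zpow_sub_one₀ hq2, f6]; field_simp; ring
    rw [f1, f2, f3, f4, f5, f6, f7, f8]
    -- With `q ^ n`, `q ^ (n ^ 2)`, `x ^ n` and `q ^ m` as independent symbols, the recursion of the
    -- coefficients is a rational identity.
    have hqn : q ^ n ≠ 0 := zpow_ne_zero n hq0
    generalize q ^ n = E at *
    generalize q ^ (n ^ 2) = F at *
    generalize x ^ n = X at *
    have g1 : q ^ (4 * m + 2) = (q ^ m) ^ 4 * q ^ 2 := by ring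
    have g2 : q ^ (2 * m + 1) = (q ^ m) ^ 2 * q := by ring
    have g3 : q ^ (2 * m) = (q ^ m) ^ 2 := by ring
    have g4 : q ^ (2 * m + 2) = (q ^ m) ^ 2 * q ^ 2 := by ring
    have g5 : (q ^ 2) ^ (2 * m + 1) = (q ^ m) ^ 4 * q ^ 2 := by ring
    have g6 : (q ^ 2) ^ (2 * m + 2) = (q ^ m) ^ 4 * q ^ 4 := by ring
    rw [g1, g2, g3, g4, g5, g6]
    generalize q ^ m = Q
    field_simp
    ring


lemma summable_norm_pow_succ {p : ℂ} (hp : ‖p‖ < 1) : Summable fun j : ℕ => ‖-p ^ (j + 1)‖ := by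
  simp only [norm_neg, norm_pow]
  exact (summable_nat_add_iff 1).mpr (summable_geometric_of_lt_one (norm_nonneg _) hp)

lemma tendsto_qFactorial {p : ℂ} (hp : ‖p‖ < 1) :
    Tendsto (qFactorial p) atTop (𝓝 (∏' j : ℕ, (1 - p ^ (j + 1)))) := by
  have := (multipliable_one_add_of_summable (summable_norm_pow_succ hp)).hasProd.tendsto_prod_nat
  simp only [← sub_eq_add_neg] at this
  exact this

lemma tprod_one_sub_pow_ne_zero {p : ℂ} (hp : ‖p‖ < 1) : ∏' j : ℕ, (1 - p ^ (j + 1)) ≠ 0 := by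
  have := tprod_one_add_ne_zero_of_summable (f := fun j : ℕ => -p ^ (j + 1))
    (fun j => by rw [← sub_eq_add_neg]; exact one_sub_pow_ne_zero hp j) (summable_norm_pow_succ hp)
  simpa [← sub_eq_add_neg] using this

lemma exists_bound_qFactorial {p : ℂ} (hp : ‖p‖ < 1) :
    ∃ K : ℝ, (∀ k, ‖qFactorial p k‖ ≤ K) ∧ ∀ k, ‖qFactorialInv p k‖ ≤ K := by
  obtain ⟨K₁, h₁⟩ := (Metric.isBounded_range_of_tendsto _ (tendsto_qFactorial hp)).exists_norm_le
  obtain ⟨K₂, h₂⟩ := (Metric.isBounded_range_of_tendsto _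
    ((tendsto_qFactorial hp).inv₀ (tprod_one_sub_pow_ne_zero hp))).exists_norm_le
  refine ⟨max K₁ K₂, fun k => (h₁ _ ⟨k, rfl⟩).trans (le_max_left _ _), fun k => ?_⟩
  unfold qFactorialInv
  split_ifs
  · exact (h₂ _ ⟨k.toNat, rfl⟩).trans (le_max_right _ _)
  · rw [norm_zero]
    exact (norm_nonneg _).trans ((h₂ _ ⟨0, rfl⟩).trans (le_max_right _ _))

lemma tendsto_qFactorialInv {p : ℂ} (hp : ‖p‖ < 1) (n : ℤ) :
    Tendsto (fun m : ℕ => qFactorialInv p (m + n)) atTop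
      (𝓝 (∏' j : ℕ, (1 - p ^ (j + 1)))⁻¹) := by
  have h1 : Tendsto (fun m : ℕ => ((m : ℤ) + n).toNat) atTop atTop := by
    refine tendsto_atTop.mpr fun b => ?_
    filter_upwards [eventually_ge_atTop (b + n.natAbs)] with m hm
    omega
  have h2 := ((tendsto_qFactorial hp).inv₀ (tprod_one_sub_pow_ne_zero hp)).comp h1
  refine h2.congr' ?_
  filter_upwards [eventually_ge_atTop n.natAbs] with m hm
  simp [qFactorialInv, show 0 ≤ (m : ℤ) + n by omega]

lemma summable_norm_pow_two_mul_add_one {q y : ℂ} (hq : ‖q‖ < 1) :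
    Summable fun j : ℕ => ‖q ^ (2 * j + 1) * y‖ := by
  simp only [norm_mul, norm_pow]
  refine Summable.mul_right _ ?_
  have h : ∀ j : ℕ, ‖q‖ ^ (2 * j + 1) = (‖q‖ ^ 2) ^ j * ‖q‖ := fun j => by ring
  simp only [h]
  exact (summable_geometric_of_lt_one (by positivity)
    (pow_lt_one₀ (norm_nonneg _) hq (by omega))).mul_right _

/-- **Jacobi's triple product identity**. -/
theorem tsum_tripleProduct {q x : ℂ} (hq : ‖q‖ < 1) (hq0 : q ≠ 0) (hx : x ≠ 0)
    (hs : Summable fun n : ℤ => ‖q ^ (n ^ 2) * x ^ n‖) :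
    ∑' n : ℤ, q ^ (n ^ 2) * x ^ n = (∏' j : ℕ, (1 - (q ^ 2) ^ (j + 1))) *
      ((∏' j : ℕ, (1 + q ^ (2 * j + 1) * x)) * ∏' j : ℕ, (1 + q ^ (2 * j + 1) * x⁻¹)) := by
  have hp : ‖q ^ 2‖ < 1 := by
    rw [norm_pow]; exact pow_lt_one₀ (norm_nonneg _) hq (by omega)
  set A := ∏' j : ℕ, (1 - (q ^ 2) ^ (j + 1)) with hA
  have hA0 : A ≠ 0 := tprod_one_sub_pow_ne_zero hp
  obtain ⟨K, hK1, hK2⟩ := exists_bound_qFactorial hp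
  have hK : 0 ≤ K := (norm_nonneg _).trans (hK1 0)
  -- Let `m → ∞` in the finite identity. The `q`-factorials and their inverses are uniformly
  -- bounded, which gives the dominating series, and each coefficient tends to `A * (A⁻¹ * A⁻¹) =
  -- A⁻¹`.
  have t1 : Tendsto (fun m : ℕ => ∑' n : ℤ, qFactorial (q ^ 2) (2 * m) *
      (qFactorialInv (q ^ 2) (m + n) * qFactorialInv (q ^ 2) (m - n)) * (q ^ (n ^ 2) * x ^ n))
      atTop (𝓝 (∑' n : ℤ, A * (A⁻¹ * A⁻¹) * (q ^ (n ^ 2) * x ^ n))) := by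
    refine tendsto_tsum_of_dominated_convergence (bound := fun n : ℤ =>
      K * (K * K) * ‖q ^ (n ^ 2) * x ^ n‖) (hs.mul_left _) (fun n => ?_)
      (Eventually.of_forall fun m n => ?_)
    · refine Tendsto.mul_const _ (Tendsto.mul ?_ (Tendsto.mul (tendsto_qFactorialInv hp n) ?_))
      · exact (tendsto_qFactorial hp).comp (tendsto_id.const_mul_atTop' (by norm_num : 0 < 2))
      · exact tendsto_qFactorialInv hp (-n)
    · rw [norm_mul, norm_mul, norm_mul (qFactorialInv _ _)]
      gcongr
      · exact hK1 _
      · exact hK2 _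
      · exact hK2 _
  have t2 : Tendsto (fun m : ℕ => ∏ j ∈ Finset.range m,
      ((1 + q ^ (2 * j + 1) * x) * (1 + q ^ (2 * j + 1) * x⁻¹))) atTop
      (𝓝 ((∏' j : ℕ, (1 + q ^ (2 * j + 1) * x)) * ∏' j : ℕ, (1 + q ^ (2 * j + 1) * x⁻¹))) := by
    simp only [Finset.prod_mul_distrib]
    exact (multipliable_one_add_of_summable
      (summable_norm_pow_two_mul_add_one
        hq)).hasProd.tendsto_prod_nat.mul
      (multipliable_one_add_of_summable (summable_norm_pow_two_mul_add_one
        hq)).hasProd.tendsto_prod_nat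
  have t3 := tendsto_nhds_unique (t1.congr fun m =>
    (hasSum_finite_tripleProduct hq hq0 hx m).tsum_eq) t2
  rw [← t3, ← tsum_mul_left]
  refine tsum_congr fun n => ?_
  field_simp

/-! ### Theta functions: quasi-periods, zeros, derivative at zero. -/

/-- The even theta function `∑ exp (2 π i n z + π i n² τ)`, with the modulus as first argument. -/
def theta3 (τ z : ℂ) : ℂ := jacobiTheta₂ z τ

lemma differentiable_theta3 {τ : ℂ} (hτ : 0 < τ.im) : Differentiable ℂ (theta3 τ) :=
  fun z => differentiableAt_jacobiTheta₂_fst z hτ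

lemma theta3_add_one (τ z : ℂ) : theta3 τ (z + 1) = theta3 τ z := jacobiTheta₂_add_left z τ

lemma theta3_add_tau (τ z : ℂ) :
    theta3 τ (z + τ) = exp (-(Real.pi * I * (τ + 2 * z))) * theta3 τ z := by
  have := jacobiTheta₂_add_left' z τ
  rw [theta3, this, theta3]; congr 2; ring

lemma theta3_neg (τ z : ℂ) : theta3 τ (-z) = theta3 τ z := jacobiTheta₂_neg_left z τ

lemma conj_theta3 {τ : ℂ} (hre : τ.re = 0) (z : ℂ) :
    (starRingEnd ℂ) (theta3 τ z) = theta3 τ ((starRingEnd ℂ) z) := by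
  have h : -(starRingEnd ℂ) τ = τ := by apply Complex.ext <;> simp [hre]
  rw [theta3, jacobiTheta₂_conj, h, theta3]

lemma exp_pi_mul_int (n : ℤ) : exp (Real.pi * I * n) = (-1 : ℂ) ^ n := by
  rw [← exp_pi_mul_I, ← exp_int_mul]; congr 1; ring

/-- Reindexing `n` to `n - 1` completes the square. Properties of `theta` are then inherited from
`jacobiTheta₂`. -/
lemma theta_eq (τ z : ℂ) :
    theta τ z = -I * exp (Real.pi * I * τ / 4 + Real.pi * I * z) *
      theta3 τ (z + 1 / 2 + τ / 2) := by
  rw [theta, theta3, jacobiTheta₂, ← tsum_mul_left, ← tsum_mul_left]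
  conv_rhs => rw [← (Equiv.subRight (1 : ℤ)).tsum_eq]
  refine tsum_congr fun n => ?_
  rw [jacobiTheta₂_term, Equiv.subRight_apply]
  have h1 : (2 * Real.pi * I * ((n - 1 : ℤ) : ℂ) * (z + 1 / 2 + τ / 2) +
      Real.pi * I * ((n - 1 : ℤ) : ℂ) ^ 2 * τ) = Real.pi * I * ((n - 1 : ℤ) : ℂ) +
      (Real.pi * I * τ * ((n : ℂ) - 1 / 2) ^ 2 + Real.pi * I * (2 * (n : ℂ) - 1) * z)
      - (Real.pi * I * τ / 4 + Real.pi * I * z) := by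
    push_cast; ring
  rw [h1, exp_sub, exp_add (Real.pi * I * ((n - 1 : ℤ) : ℂ)), exp_pi_mul_int,
    zpow_sub_one₀ (by norm_num)]
  have h2 := exp_ne_zero (Real.pi * I * τ / 4 + Real.pi * I * z)
  field_simp

lemma differentiable_theta {τ : ℂ} (hτ : 0 < τ.im) : Differentiable ℂ (theta τ) := by
  have h : theta τ = fun z => -I * exp (Real.pi * I * τ / 4 + Real.pi * I * z) *
      theta3 τ (z + 1 / 2 + τ / 2) := funext (theta_eq τ)
  rw [h]
  have := differentiable_theta3 hτ
  fun_prop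

lemma continuous_theta {τ : ℂ} (hτ : 0 < τ.im) : Continuous (theta τ) :=
  (differentiable_theta hτ).continuous

lemma continuous_theta3 {τ : ℂ} (hτ : 0 < τ.im) : Continuous (theta3 τ) :=
  (differentiable_theta3 hτ).continuous

lemma theta3_add_half (τ z : ℂ) : theta3 τ (z + 1 / 2 + τ / 2) =
    I * exp (-(Real.pi * I * τ / 4 + Real.pi * I * z)) * theta τ z := by
  rw [theta_eq, exp_neg]
  have h2 := exp_ne_zero (Real.pi * I * τ / 4 + Real.pi * I * z)
  field_simp
  simp

/-- The half-period shifts in the weight turn each `theta` in its denominator into a `theta3`, which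
has no zeros on the real and imaginary axes. -/
lemma theta_add_half (τ z : ℂ) : theta τ (z + 1 / 2 + τ / 2) =
    exp (-(Real.pi * I * τ / 4 + Real.pi * I * z)) * theta3 τ z := by
  rw [theta_eq, show z + 1 / 2 + τ / 2 + 1 / 2 + τ / 2 = z + τ + 1 by ring, theta3_add_one,
    theta3_add_tau]
  have h : -(Real.pi * I * τ / 4 + Real.pi * I * z) =
    (Real.pi * I * τ / 4 + Real.pi * I * (z + 1 / 2 + τ / 2)) +
    (-(Real.pi * I * (τ + 2 * z))) - Real.pi / 2 * I := by ring
  have e := congrArg exp h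
  rw [exp_sub, exp_pi_div_two_mul_I, exp_add (_ + _) (-(Real.pi * I * (τ + 2 * z))), div_I] at e
  rw [e]
  ring

lemma theta_add_one (τ z : ℂ) : theta τ (z + 1) = -theta τ z := by
  rw [theta_eq, theta_eq, show z + 1 + 1 / 2 + τ / 2 = z + 1 / 2 + τ / 2 + 1 by ring,
    theta3_add_one, mul_add, mul_one, ← add_assoc, exp_add, exp_pi_mul_I]
  ring

lemma theta_add_tau (τ z : ℂ) :
    theta τ (z + τ) = -exp (-(Real.pi * I * (τ + 2 * z))) * theta τ z := by
  rw [theta_eq, theta_eq, show z + τ + 1 / 2 + τ / 2 = z + 1 / 2 + τ / 2 + τ by ring,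
    theta3_add_tau, show Real.pi * I * τ / 4 + Real.pi * I * (z + τ) =
      (Real.pi * I * τ / 4 + Real.pi * I * z) + (-(Real.pi * I * (τ + 2 * z))) -
      (-(Real.pi * I * (τ + 2 * (z + 1 / 2 + τ / 2)))) - Real.pi * I by ring, exp_sub, exp_sub,
      exp_pi_mul_I, exp_add]
  have h2 := exp_ne_zero (-(Real.pi * I * (τ + 2 * (z + 1 / 2 + τ / 2))))
  field_simp

lemma theta_neg (τ z : ℂ) : theta τ (-z) = -theta τ z := by
  have h := theta3_add_half τ (-z)
  rw [show -z + 1 / 2 + τ / 2 = -(z + 1 / 2 + τ / 2) + τ + 1 by ring, theta3_add_one,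
    theta3_add_tau, theta3_neg, theta3_add_half] at h
  have e : -(Real.pi * I * (τ + 2 * -(z + 1 / 2 + τ / 2))) +
    -(Real.pi * I * τ / 4 + Real.pi * I * z) = -(Real.pi * I * τ / 4 + Real.pi * I * -z)
      + Real.pi * I := by ring
  have e' := congrArg exp e
  rw [exp_add, exp_add _ (Real.pi * I), exp_pi_mul_I] at e'
  have h2 := exp_ne_zero (-(Real.pi * I * τ / 4 + Real.pi * I * -z))
  refine mul_left_cancel₀ (mul_ne_zero I_ne_zero h2) ?_
  linear_combination -h + I * theta τ z * e'

lemma theta_zero (τ : ℂ) : theta τ 0 = 0 := by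
  have h := theta_neg τ 0
  rw [neg_zero] at h
  exact self_eq_neg.mp h

/-- Half of the nome, `exp (π i τ)`. -/
def halfNome (τ : ℂ) : ℂ := exp (Real.pi * I * τ)

lemma halfNome_sq (τ : ℂ) : halfNome τ ^ 2 = nome τ := by
  rw [halfNome, nome, ← exp_nat_mul]; congr 1; push_cast; ring

lemma norm_halfNome_lt_one {τ : ℂ} (hτ : 0 < τ.im) : ‖halfNome τ‖ < 1 := by
  rw [halfNome, norm_exp]
  have : (Real.pi * I * τ).re = -(Real.pi * τ.im) := by simp
  rw [this, Real.exp_lt_one_iff]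
  have := mul_pos Real.pi_pos hτ
  linarith

lemma norm_nome_lt_one {τ : ℂ} (hτ : 0 < τ.im) : ‖nome τ‖ < 1 := by
  rw [← halfNome_sq, norm_pow]
  exact pow_lt_one₀ (norm_nonneg _) (norm_halfNome_lt_one hτ) (by omega)

lemma nomeProd_eq (τ : ℂ) : nomeProd τ = ∏' j : ℕ, (1 - nome τ ^ (j + 1)) := by
  rw [nomeProd]; congr 1; funext j; rw [pow_succ']

lemma nomeProd_ne_zero {τ : ℂ} (hτ : 0 < τ.im) : nomeProd τ ≠ 0 := by
  rw [nomeProd_eq]; exact tprod_one_sub_pow_ne_zero (norm_nome_lt_one hτ)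

lemma theta3_eq_prod {τ : ℂ} (hτ : 0 < τ.im) (z : ℂ) : theta3 τ z = nomeProd τ *
    ((∏' j : ℕ, (1 + halfNome τ ^ (2 * j + 1) * exp (2 * Real.pi * I * z))) *
      ∏' j : ℕ, (1 + halfNome τ ^ (2 * j + 1) * (exp (2 * Real.pi * I * z))⁻¹)) := by
  have h : ∀ n : ℤ, halfNome τ ^ (n ^ 2) * exp (2 * Real.pi * I * z) ^ n =
      jacobiTheta₂_term n z τ := by
    intro n
    rw [halfNome, ← exp_int_mul, ← exp_int_mul, ← exp_add, jacobiTheta₂_term]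
    congr 1; push_cast; ring
  have h2 := tsum_tripleProduct (q := halfNome τ) (x := exp (2 * Real.pi * I * z))
    (norm_halfNome_lt_one hτ) (exp_ne_zero _) (exp_ne_zero _) (by
      simp only [h]
      exact ((summable_jacobiTheta₂_term_iff z τ).mpr hτ).norm)
  simp only [h] at h2
  rw [theta3, jacobiTheta₂, h2, halfNome_sq, nomeProd_eq]

/-- An absolutely convergent product vanishes only if one of its factors does, so the zeros can be
read off the triple product; the second product is the first one at `-z`. -/
lemma exists_of_theta3_eq_zero {τ : ℂ} (hτ : 0 < τ.im) {z : ℂ} (hz : theta3 τ z = 0) :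
    ∃ m n : ℤ, z = 1 / 2 + τ / 2 + m + n * τ := by
  have key : ∀ w : ℂ, ∀ j : ℕ,
      1 + halfNome τ ^ (2 * j + 1) * exp (2 * Real.pi * I * w) = 0 →
      ∃ m : ℤ, w = 1 / 2 - τ / 2 + m - j * τ := by
    intro w j h
    have h1 : exp ((2 * j + 1 : ℕ) * (Real.pi * I * τ) + 2 * Real.pi * I * w) =
        exp (Real.pi * I) := by
      rw [exp_add, exp_nat_mul, exp_pi_mul_I]; exact eq_neg_of_add_eq_zero_right h
    obtain ⟨m, hm⟩ := exp_eq_exp_iff_exists_int.mp h1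
    refine ⟨m, ?_⟩
    have : (2 * Real.pi * I : ℂ) ≠ 0 := two_pi_I_ne_zero
    apply mul_left_cancel₀ this
    push_cast at hm
    linear_combination hm
  rw [theta3_eq_prod hτ] at hz
  rcases mul_eq_zero.mp hz with h | h
  · exact absurd h (nomeProd_ne_zero hτ)
  rcases mul_eq_zero.mp h with h | h
  · by_contra hcon
    refine tprod_one_add_ne_zero_of_summable (fun j hj => hcon ?_)
      (summable_norm_pow_two_mul_add_one (norm_halfNome_lt_one hτ)) h
    obtain ⟨m, hm⟩ := key z j hj
    exact ⟨m, -j - 1, by rw [hm]; push_cast; ring⟩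
  · by_contra hcon
    refine tprod_one_add_ne_zero_of_summable (fun j hj => hcon ?_)
      (summable_norm_pow_two_mul_add_one (norm_halfNome_lt_one hτ)) h
    rw [← exp_neg, ← mul_neg] at hj
    obtain ⟨m, hm⟩ := key (-z) j hj
    exact ⟨-m - 1, j, by rw [← neg_neg z, hm]; push_cast; ring⟩

lemma exists_of_theta_eq_zero {τ : ℂ} (hτ : 0 < τ.im) {z : ℂ} (hz : theta τ z = 0) :
    ∃ m n : ℤ, z = m + n * τ := by
  have h : theta3 τ (z + 1 / 2 + τ / 2) = 0 := by rw [theta3_add_half, hz, mul_zero]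
  obtain ⟨m, n, h⟩ := exists_of_theta3_eq_zero hτ h
  exact ⟨m, n, by linear_combination h⟩

/-- The one factor of the product that vanishes at `0` is split off. The cofactor need only be
continuous at `0`, since the slope of the product is the slope of that factor times the cofactor. -/
lemma hasDerivAt_theta_zero {τ : ℂ} (hτ : 0 < τ.im) :
    HasDerivAt (theta τ) (2 * Real.pi * exp (Real.pi * I * τ / 4) * nomeProd τ ^ 3) 0 := by
  have hp := norm_nome_lt_one hτ
  set p := nome τ with hpdef
  let P : ℂ → ℂ := fun x => ∏' j : ℕ, (1 + -p ^ (j + 1) * x)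
  have hPcont : ContinuousAt P 1 := by
    have h1 : HasProdLocallyUniformlyOn (fun (j : ℕ) (x : ℂ) => 1 + -p ^ (j + 1) * x) P
        (Metric.ball 0 2) := by
      refine Summable.hasProdLocallyUniformlyOn_nat_one_add
        (u := fun j => ‖-p ^ (j + 1)‖ * 2) Metric.isOpen_ball
        ((summable_norm_pow_succ hp).mul_right 2) (Eventually.of_forall fun j x hx => ?_)
        (fun j => by fun_prop)
      rw [norm_mul]
      have : ‖x‖ < 2 := by simpa using hx
      gcongr
    have h2 : ContinuousOn P (Metric.ball 0 2) := by
      refine TendstoLocallyUniformlyOn.continuousOn h1.tendstoLocallyUniformlyOn_finsetRange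
        (Eventually.of_forall fun n => ?_).frequently
      fun_prop
    exact h2.continuousAt (Metric.isOpen_ball.mem_nhds (by simp))
  have hP1 : P 1 = nomeProd τ := by
    simp [P, nomeProd_eq, sub_eq_add_neg, hpdef]
  have hfac : ∀ z, theta3 τ (z + 1 / 2 + τ / 2) = (1 - exp (-(2 * Real.pi * I * z))) *
      (nomeProd τ * (P (exp (2 * Real.pi * I * z)) * P (exp (-(2 * Real.pi * I * z))))) := by
    intro z
    rw [theta3_eq_prod hτ]
    have e1 : exp (2 * Real.pi * I * (z + 1 / 2 + τ / 2)) =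
        -(halfNome τ * exp (2 * Real.pi * I * z)) := by
      rw [show 2 * Real.pi * I * (z + 1 / 2 + τ / 2) = Real.pi * I * τ + 2 * Real.pi * I * z +
        Real.pi * I by ring, exp_add, exp_add, exp_pi_mul_I, halfNome]; ring
    have hq0 : halfNome τ ≠ 0 := exp_ne_zero _
    have hx0 := exp_ne_zero (2 * Real.pi * I * z)
    have f1 : ∏' j : ℕ, (1 + halfNome τ ^ (2 * j + 1) *
        exp (2 * Real.pi * I * (z + 1 / 2 + τ / 2))) = P (exp (2 * Real.pi * I * z)) := by
      refine tprod_congr fun j => ?_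
      rw [e1, hpdef, ← halfNome_sq]; ring
    -- After the half-period shift this product runs over `p ^ j`, starting at `j = 0`; its first
    -- factor `1 - exp (-2πiz)` carries the zero.
    have f2 : ∏' j : ℕ, (1 + halfNome τ ^ (2 * j + 1) *
        (exp (2 * Real.pi * I * (z + 1 / 2 + τ / 2)))⁻¹) =
        (1 - exp (-(2 * Real.pi * I * z))) * P (exp (-(2 * Real.pi * I * z))) := by
      have g : ∀ j : ℕ, 1 + halfNome τ ^ (2 * j + 1) *
        (exp (2 * Real.pi * I * (z + 1 / 2 + τ / 2)))⁻¹ =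
          1 + -p ^ j * exp (-(2 * Real.pi * I * z)) := by
        intro j
        rw [e1, hpdef, ← halfNome_sq, exp_neg]; field_simp; ring
      simp only [g]
      rw [tprod_eq_zero_mul']
      · simp [P, sub_eq_add_neg]
      · refine multipliable_one_add_of_summable ?_
        simp only [norm_mul]
        exact (summable_norm_pow_succ hp).mul_right _
    rw [f1, f2]; ring
  let G : ℂ → ℂ := fun z => nomeProd τ * (P (exp (2 * Real.pi * I * z)) *
    P (exp (-(2 * Real.pi * I * z))))
  have hG : ContinuousAt G 0 := by
    have c1 : ContinuousAt (fun z : ℂ => P (exp (2 * Real.pi * I * z))) 0 := by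
      refine ContinuousAt.comp (g := P) (by simpa using hPcont) (by fun_prop)
    have c2 : ContinuousAt (fun z : ℂ => P (exp (-(2 * Real.pi * I * z)))) 0 := by
      refine ContinuousAt.comp (g := P) (by simpa using hPcont) (by fun_prop)
    exact continuousAt_const.mul (c1.mul c2)
  have hG0 : G 0 = nomeProd τ ^ 3 := by
    simp only [G, mul_zero, exp_zero, neg_zero, hP1]; ring
  let A : ℂ → ℂ := fun z => -I * exp (Real.pi * I * τ / 4 + Real.pi * I * z)
  let E : ℂ → ℂ := fun z => 1 - exp (-(2 * Real.pi * I * z))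
  have hE : HasDerivAt E (2 * Real.pi * I) 0 := by
    have h1 : HasDerivAt (fun z : ℂ => -(2 * Real.pi * I * z)) (-(2 * Real.pi * I * 1)) 0 :=
      ((hasDerivAt_id (0 : ℂ)).const_mul _).neg
    have h2 := (h1.cexp).const_sub 1
    simpa using h2
  have hth : theta τ = fun z => E z * (A z * G z) := by
    funext z
    rw [theta_eq, hfac]; simp only [A, E, G]; ring
  have hE0 : E 0 = 0 := by simp [E]
  have hAG : ContinuousAt (fun z => A z * G z) 0 := by
    refine ContinuousAt.mul ?_ hG
    fun_prop
  rw [hth, hasDerivAt_iff_tendsto_slope]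
  have hs := (hasDerivAt_iff_tendsto_slope.mp hE).mul (hAG.tendsto.mono_left nhdsWithin_le_nhds)
  have hval : 2 * Real.pi * I * (A 0 * G 0) =
      2 * Real.pi * exp (Real.pi * I * τ / 4) * nomeProd τ ^ 3 := by
    rw [hG0]; simp only [A, mul_zero, add_zero]
    linear_combination (-2 * Real.pi * exp (Real.pi * I * τ / 4) * nomeProd τ ^ 3) * I_mul_I
  rw [hval] at hs
  refine hs.congr fun z => ?_
  simp only [slope_def_field, hE0, zero_mul, sub_zero]
  ring

/-! ### Removable singularities, Liouville's theorem and lattice translations. -/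

/-- The quotient of two holomorphic functions, with removable singularities filled in at simple
zeros of the denominator. -/
def entireQuot (f g : ℂ → ℂ) (z : ℂ) : ℂ :=
  open Classical in if g z = 0 then deriv f z / deriv g z else f z / g z

lemma entireQuot_of_ne_zero {f g : ℂ → ℂ} {z : ℂ} (h : g z ≠ 0) :
    entireQuot f g z = f z / g z := if_neg h

/-- At a simple zero `z` of `g` the quotient agrees nearby with `dslope f z / dslope g z`, whose
denominator is nonzero at `z`. -/
lemma differentiableOn_entireQuot {f g : ℂ → ℂ} {U : Set ℂ} (hU : IsOpen U)
    (hf : DifferentiableOn ℂ f U) (hg : DifferentiableOn ℂ g U)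
    (h : ∀ z ∈ U, g z = 0 → f z = 0 ∧ deriv g z ≠ 0) :
    DifferentiableOn ℂ (entireQuot f g) U := by
  intro z hz
  refine DifferentiableAt.differentiableWithinAt ?_
  have hUz := hU.mem_nhds hz
  by_cases hgz : g z = 0
  · obtain ⟨hfz, hg'⟩ := h z hz hgz
    have hF : DifferentiableAt ℂ (dslope f z) z :=
      ((differentiableOn_dslope hUz).mpr hf).differentiableAt hUz
    have hG : DifferentiableAt ℂ (dslope g z) z :=
      ((differentiableOn_dslope hUz).mpr hg).differentiableAt hUz
    have hG0 : dslope g z z ≠ 0 := by rwa [dslope_same]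
    refine (hF.div hG hG0).congr_of_eventuallyEq ?_
    filter_upwards [hG.continuousAt.eventually_ne hG0] with w hw
    rcases eq_or_ne w z with rfl | hwz
    · simp [entireQuot, hgz, dslope_same]
    · have e1 : dslope f z w = f w / (w - z) := by
        rw [dslope_of_ne _ hwz, slope_def_field, hfz, sub_zero]
      have e2 : dslope g z w = g w / (w - z) := by
        rw [dslope_of_ne _ hwz, slope_def_field, hgz, sub_zero]
      have hgw : g w ≠ 0 := by
        intro h0; rw [e2, h0, zero_div] at hw; exact hw rfl
      have : w - z ≠ 0 := sub_ne_zero.mpr hwz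
      rw [entireQuot_of_ne_zero hgw, Pi.div_apply, e1, e2]
      field_simp
  · have hg1 := (hg.differentiableAt hUz)
    refine ((hf.differentiableAt hUz).div hg1 hgz).congr_of_eventuallyEq ?_
    filter_upwards [hg1.continuousAt.eventually_ne hgz] with w hw
    exact entireQuot_of_ne_zero hw

lemma differentiable_entireQuot {f g : ℂ → ℂ} (hf : Differentiable ℂ f) (hg : Differentiable ℂ g)
    (h : ∀ z, g z = 0 → f z = 0 ∧ deriv g z ≠ 0) : Differentiable ℂ (entireQuot f g) :=
  differentiableOn_univ.mp (differentiableOn_entireQuot isOpen_univ hf.differentiableOn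
    hg.differentiableOn fun z _ => h z)

lemma entireQuot_mul {f g : ℂ → ℂ} {z : ℂ} (h : g z = 0 → f z = 0) :
    entireQuot f g z * g z = f z := by
  by_cases hg : g z = 0
  · rw [hg, h hg, mul_zero]
  · rw [entireQuot_of_ne_zero hg, div_mul_cancel₀ _ hg]

/-- An entire doubly periodic function is constant. -/
lemma eq_of_doubly_periodic {τ : ℂ} (hτ : 0 < τ.im) {h : ℂ → ℂ} (hd : Differentiable ℂ h)
    (h1 : ∀ z, h (z + 1) = h z) (h2 : ∀ z, h (z + τ) = h z) (z w : ℂ) : h z = h w := by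
  refine hd.apply_eq_apply_of_bounded ?_ z w
  -- All values are attained on the closed period parallelogram, so the function is bounded.
  have hK : IsCompact ((fun x : ℝ × ℝ => h (x.1 + x.2 * τ)) ''
      (Set.Icc (0 : ℝ) 1 ×ˢ Set.Icc (0 : ℝ) 1)) := by
    refine (isCompact_Icc.prod isCompact_Icc).image ?_
    have := hd.continuous
    fun_prop
  refine hK.isBounded.subset ?_
  rintro _ ⟨z, rfl⟩
  set y := z.im / τ.im with hy
  set x := (z - y * τ).re with hx
  have hz : z = x + y * τ := by
    have e : (z - y * τ).im = 0 := by
      rw [hy]; simp [hτ.ne']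
    have : z - y * τ = x := by apply Complex.ext <;> simp [hx] ; simpa using e
    linear_combination this
  refine ⟨(Int.fract x, Int.fract y), ⟨⟨Int.fract_nonneg _, (Int.fract_lt_one _).le⟩,
    ⟨Int.fract_nonneg _, (Int.fract_lt_one _).le⟩⟩, ?_⟩
  have p1 : Function.Periodic h 1 := h1
  have p2 : Function.Periodic h τ := h2
  have e : z =
      ((Int.fract x : ℝ) : ℂ) + ((Int.fract y : ℝ) : ℂ) * τ + (⌊x⌋ : ℂ) * 1 + (⌊y⌋ : ℂ) * τ := by
    rw [hz]
    have ex : (x : ℂ) = (Int.fract x : ℝ) + (⌊x⌋ : ℂ) := by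
      exact_mod_cast (Int.fract_add_floor x).symm
    have ey : (y : ℂ) = (Int.fract y : ℝ) + (⌊y⌋ : ℂ) := by
      exact_mod_cast (Int.fract_add_floor y).symm
    linear_combination ex + τ * ey
  simp only
  rw [e, p2.int_mul, p1.int_mul]

/-- Here `τ` is an arbitrary complex number, so that the period `1` with its sign is covered too (`τ
= 1`, `a = 0`). -/
lemma quasiperiodic_int {τ a c : ℂ} {f : ℂ → ℂ}
    (hf : ∀ z, f (z + τ) = exp (-(a * (2 * z + τ) + c)) * f z) (n : ℤ) (z : ℂ) :
    f (z + n * τ) = exp (-(a * (2 * n * z + n ^ 2 * τ) + c * n)) * f z := by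
  induction n using Int.induction_on with
  | zero => simp
  | succ n ih =>
    rw [show z + ((n : ℤ) + 1 : ℤ) * τ = (z + (n : ℤ) * τ) + τ by push_cast; ring, hf, ih,
      ← mul_assoc, ← exp_add]
    congr 2; push_cast; ring
  | pred n ih =>
    have h := hf (z + ((-n : ℤ) - 1 : ℤ) * τ)
    rw [show z + ((-n : ℤ) - 1 : ℤ) * τ + τ = z + (-n : ℤ) * τ by push_cast; ring, ih] at h
    refine mul_left_cancel₀ (exp_ne_zero _) (h.symm.trans ?_)
    rw [← mul_assoc, ← exp_add]
    congr 2; push_cast; ring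

lemma theta_add_int (τ z : ℂ) (m : ℤ) : theta τ (z + m) = exp (Real.pi * I * m) * theta τ z := by
  have := quasiperiodic_int (τ := 1) (a := 0) (c := -(Real.pi * I)) (f := theta τ) (fun z => by
    rw [theta_add_one]; simp) m z
  simpa using this

lemma theta_add_int_mul_tau (τ z : ℂ) (n : ℤ) : theta τ (z + n * τ) =
    exp (-(Real.pi * I * (2 * n * z + n ^ 2 * τ) + -(Real.pi * I) * n)) * theta τ z := by
  refine quasiperiodic_int (f := theta τ) (fun z => ?_) n z
  rw [theta_add_tau, neg_add, neg_neg, exp_add, exp_pi_mul_I]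
  ring_nf

/-- Every zero is a lattice point, and near it `theta` is a nonvanishing exponential times its
translate to the origin, where the derivative is known. -/
lemma deriv_theta_ne_zero {τ : ℂ} (hτ : 0 < τ.im) {z : ℂ} (hz : theta τ z = 0) :
    deriv (theta τ) z ≠ 0 := by
  obtain ⟨m, n, rfl⟩ := exists_of_theta_eq_zero hτ hz
  set z₀ : ℂ := m + n * τ with hz0
  let E : ℂ → ℂ := fun w => exp (-(Real.pi * I * (2 * n * (w - z₀ + m) + n ^ 2 * τ) +
    -(Real.pi * I) * n)) * exp (Real.pi * I * m)
  have hE : ∀ w, theta τ w = E w * theta τ (w - z₀) := by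
    intro w
    conv_lhs => rw [show w = (w - z₀ + m) + n * τ by rw [hz0]; ring, theta_add_int_mul_tau,
      theta_add_int, ← mul_assoc]
  have hEd : DifferentiableAt ℂ E z₀ := by fun_prop
  have h0 : HasDerivAt (fun w => theta τ (w - z₀))
      (2 * Real.pi * exp (Real.pi * I * τ / 4) * nomeProd τ ^ 3) z₀ := by
    have := hasDerivAt_theta_zero hτ
    rw [← sub_self z₀] at this
    exact HasDerivAt.comp_sub_const z₀ z₀ this
  have h1 := hEd.hasDerivAt.mul h0
  rw [show theta τ = fun w => E w * theta τ (w - z₀) from funext hE]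
  have h2 := h1.deriv
  simp only [sub_self, theta_zero, mul_zero, zero_add] at h2
  change deriv (fun w => E w * theta τ (w - z₀)) z₀ = _ at h2
  rw [h2]
  have := nomeProd_ne_zero hτ
  have := exp_ne_zero (Real.pi * I * τ / 4)
  have hpi : (Real.pi : ℂ) ≠ 0 := by exact_mod_cast Real.pi_ne_zero
  refine mul_ne_zero (mul_ne_zero (exp_ne_zero _) (exp_ne_zero _)) ?_
  exact mul_ne_zero (mul_ne_zero (mul_ne_zero two_ne_zero hpi) this) (pow_ne_zero 3 ‹_›)

lemma deriv_theta_comp_mul {τ : ℂ} (hτ : 0 < τ.im) {a : ℂ} (ha : a ≠ 0) {z : ℂ}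
    (hz : theta τ (a * z) = 0) : deriv (fun u => theta τ (a * u)) z ≠ 0 := by
  have h1 : HasDerivAt (fun u => a * u) (a * 1) z := (hasDerivAt_id z).const_mul a
  have h2 : HasDerivAt (fun u => theta τ (a * u)) (deriv (theta τ) (a * z) * (a * 1)) z :=
    ((differentiable_theta hτ) _).hasDerivAt.comp z h1
  rw [h2.deriv, mul_one]
  exact mul_ne_zero (deriv_theta_ne_zero hτ hz) ha

/-- The zeros are countable. By continuity, identities need only be checked away from them, where
one may divide. -/
lemma dense_theta_ne_zero {τ : ℂ} (hτ : 0 < τ.im) {a : ℂ} (ha : a ≠ 0) (c : ℂ) :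
    Dense {z | theta τ (a * z + c) ≠ 0} := by
  have h : ({z | theta τ (a * z + c) = 0} : Set ℂ).Countable := by
    refine (Set.countable_range fun x : ℤ × ℤ => ((x.1 : ℂ) + x.2 * τ - c) / a).mono ?_
    intro z hz
    obtain ⟨m, n, h⟩ := exists_of_theta_eq_zero hτ hz
    refine ⟨(m, n), ?_⟩
    simp only
    rw [← h]; field_simp; ring
  exact h.dense_compl ℂ

/-! ### Odd theta functions and the addition formulas. -/

/-- The space of odd theta functions of order `2 K`, the numerators of `thetaSpace`. -/
structure IsOddTheta (τ : ℂ) (K : ℕ) (g : ℂ → ℂ) : Prop where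
  diff : Differentiable ℂ g
  add_one : ∀ u, g (u + 1) = g u
  add_tau : ∀ u, g (u + τ) = exp (-(2 * Real.pi * I * K * (2 * u + τ))) * g u
  neg : ∀ u, g (-u) = -g u

lemma theta_two_mul_add_one (τ u : ℂ) : theta τ (2 * (u + 1)) = theta τ (2 * u) := by
  rw [show 2 * (u + 1) = 2 * u + 1 + 1 by ring, theta_add_one, theta_add_one, neg_neg]

lemma theta_two_mul_add_tau (τ u : ℂ) : theta τ (2 * (u + τ)) =
    exp (-(2 * Real.pi * I * 2 * (2 * u + τ))) * theta τ (2 * u) := by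
  rw [show 2 * (u + τ) = 2 * u + τ + τ by ring, theta_add_tau, theta_add_tau, ← mul_assoc,
    neg_mul_neg, ← exp_add]
  congr 2; ring

lemma theta_two_mul_neg (τ u : ℂ) : theta τ (2 * (-u)) = -theta τ (2 * u) := by
  rw [mul_neg, theta_neg]

/-- If `2u = m + nτ` then `-u + nτ = u - m`. The quasi-periodicity factor relating the values there
is `1`, so oddness gives `g u = -g u`. -/
lemma IsOddTheta.eq_zero {τ : ℂ} (hτ : 0 < τ.im) {K : ℕ} {g : ℂ → ℂ} (hg : IsOddTheta τ K g)
    {u : ℂ} (hu : theta τ (2 * u) = 0) : g u = 0 := by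
  obtain ⟨m, n, h⟩ := exists_of_theta_eq_zero hτ hu
  have h1 := quasiperiodic_int (f := g) (τ := τ) (a := 2 * Real.pi * I * K) (c := 0)
    (fun z => by rw [hg.add_tau, add_zero]) n (-u)
  have h2 : g (u - m) = g u := by
    have p : Function.Periodic g 1 := hg.add_one
    simpa using p.sub_int_mul_eq m (x := u)
  rw [show -u + n * τ = u - m by linear_combination -h, h2, hg.neg] at h1
  have e : exp (-(2 * Real.pi * I * K * (2 * n * -u + n ^ 2 * τ) + 0 * n)) = 1 := by
    rw [exp_eq_one_iff]
    refine ⟨K * n * m, ?_⟩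
    push_cast
    linear_combination 2 * Real.pi * I * K * n * h
  rw [e, one_mul] at h1
  exact self_eq_neg.mp h1

/-- Oddness forces a zero at every zero of `θ(2u)`, all of which are simple, so the quotient is
entire. As `θ(2u)` is itself odd with `K = 2`, division removes two from `K + 2`. -/
lemma IsOddTheta.quot_mem {τ : ℂ} (hτ : 0 < τ.im) {K : ℕ} {g : ℂ → ℂ}
    (hg : IsOddTheta τ (K + 2) g) :
    entireQuot g (fun u => theta τ (2 * u)) ∈ thetaSpace τ K := by
  have hth := differentiable_theta hτ
  have hθ : Differentiable ℂ (fun u => theta τ (2 * u)) := by fun_prop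
  have hz : ∀ z, theta τ (2 * z) = 0 → g z = 0 := fun z hz => hg.eq_zero hτ hz
  have hd : Differentiable ℂ (entireQuot g (fun u => theta τ (2 * u))) :=
    differentiable_entireQuot hg.diff hθ fun z h =>
      ⟨hz z h, deriv_theta_comp_mul hτ two_ne_zero h⟩
  have key : ∀ z, entireQuot g (fun u => theta τ (2 * u)) z * theta τ (2 * z) = g z :=
    fun z => entireQuot_mul (hz z)
  have hdense : Dense {z | theta τ (2 * z) ≠ 0} := by
    simpa using dense_theta_ne_zero hτ two_ne_zero 0
  have ext : ∀ a b : ℂ → ℂ, Continuous a → Continuous b →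
      (∀ z, theta τ (2 * z) ≠ 0 → a z = b z) → ∀ z, a z = b z := by
    intro a b ha hb h z
    exact congrFun (Continuous.ext_on hdense ha hb h) z
  have hc := hd.continuous
  refine ⟨hd, ?_, ?_, ?_⟩
  · refine ext _ _ (by fun_prop) (by fun_prop) fun z h => mul_right_cancel₀ h ?_
    rw [key, ← theta_two_mul_add_one, key, hg.add_one]
  · refine ext _ _ (by fun_prop) (by fun_prop) fun z h => ?_
    refine mul_right_cancel₀ (mul_ne_zero (exp_ne_zero (-(2 * Real.pi * I * 2 * (2 * z + τ)))) h) ?_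
    rw [← theta_two_mul_add_tau, key, hg.add_tau, theta_two_mul_add_tau, ← key z]
    rw [mul_mul_mul_comm, ← exp_add]
    congr 2; push_cast; ring
  · refine ext _ _ (by fun_prop) (by fun_prop) fun z h => mul_right_cancel₀ (neg_ne_zero.mpr h) ?_
    rw [← theta_two_mul_neg, key, hg.neg, theta_two_mul_neg, mul_neg, key]

lemma thetaSpace_zero_const {τ : ℂ} (hτ : 0 < τ.im) {f : ℂ → ℂ} (hf : f ∈ thetaSpace τ 0)
    (z w : ℂ) : f z = f w := by
  obtain ⟨h1, h2, h3, -⟩ := hf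
  exact eq_of_doubly_periodic hτ h1 h2 (fun z => by simpa using h3 z) z w

/-- For `K = 0` the quotient is doubly periodic, hence constant. This one-dimensionality is the
source of the addition formulas. -/
lemma IsOddTheta.exists_eq_mul {τ : ℂ} (hτ : 0 < τ.im) {g : ℂ → ℂ} (hg : IsOddTheta τ 2 g) :
    ∃ c, ∀ u, g u = c * theta τ (2 * u) := by
  have hm := IsOddTheta.quot_mem (K := 0) hτ hg
  refine ⟨entireQuot g (fun u => theta τ (2 * u)) 0, fun u => ?_⟩
  rw [thetaSpace_zero_const hτ hm 0 u]
  exact (entireQuot_mul (g := fun u => theta τ (2 * u)) fun h => hg.eq_zero hτ h).symm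

lemma thetaQuad_add_one (τ u x y z w : ℂ) :
    theta τ (u + 1 + x) * theta τ (u + 1 + y) * theta3 τ (u + 1 + z) * theta3 τ (u + 1 + w) =
    theta τ (u + x) * theta τ (u + y) * theta3 τ (u + z) * theta3 τ (u + w) := by
  simp only [add_right_comm u 1, theta_add_one, theta3_add_one]; ring

lemma thetaQuad_add_tau {τ u x y z w : ℂ} (h : x + y + z + w = 0) :
    theta τ (u + τ + x) * theta τ (u + τ + y) * theta3 τ (u + τ + z) * theta3 τ (u + τ + w) =
    exp (-(2 * Real.pi * I * (2 : ℕ) * (2 * u + τ))) *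
      (theta τ (u + x) * theta τ (u + y) * theta3 τ (u + z) * theta3 τ (u + w)) := by
  simp only [add_right_comm u τ, theta_add_tau, theta3_add_tau]
  have e : exp (-(2 * Real.pi * I * (2 : ℕ) * (2 * u + τ))) =
      exp (-(Real.pi * I * (τ + 2 * (u + x)))) * exp (-(Real.pi * I * (τ + 2 * (u + y)))) *
      exp (-(Real.pi * I * (τ + 2 * (u + z)))) * exp (-(Real.pi * I * (τ + 2 * (u + w)))) := by
    rw [← exp_add, ← exp_add, ← exp_add]
    congr 1
    push_cast
    linear_combination 2 * Real.pi * I * h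
  rw [e]; ring

/-- A form of Weierstrass' four-term addition formula. -/
lemma theta_addition {τ : ℂ} (hτ : 0 < τ.im) (u κ b v : ℂ) :
    theta τ (u - κ + b) * theta τ (u - κ - b) * theta3 τ (u + κ + v) * theta3 τ (u + κ - v) -
    theta τ (u + κ + b) * theta τ (u + κ - b) * theta3 τ (u - κ + v) * theta3 τ (u - κ - v) =
    -(theta τ (2 * κ) * theta3 τ (b + v) * theta3 τ (b - v)) * theta τ (2 * u) := by
  have d1 := differentiable_theta hτ
  have d3 := differentiable_theta3 hτ
  have c1 := continuous_theta hτ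
  have c3 := continuous_theta3 hτ
  revert b
  -- The constant found below is divided by `θ(2κ - 2b)`, so `b` is first restricted to the dense
  -- set where this is nonzero.
  refine fun b => congrFun (Continuous.ext_on (dense_theta_ne_zero hτ (a := -2) (by norm_num)
    (2 * κ)) (f := fun b => theta τ (u - κ + b) * theta τ (u - κ - b) * theta3 τ (u + κ + v) *
      theta3 τ (u + κ - v) - theta τ (u + κ + b) * theta τ (u + κ - b) * theta3 τ (u - κ + v) *
      theta3 τ (u - κ - v)) (g := fun b => -(theta τ (2 * κ) * theta3 τ (b + v) *
      theta3 τ (b - v)) * theta τ (2 * u)) (by fun_prop) (by fun_prop) fun b hb => ?_) b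
  have hodd : IsOddTheta τ 2 (fun u => theta τ (u - κ + b) * theta τ (u - κ - b) *
      theta3 τ (u + κ + v) * theta3 τ (u + κ - v) - theta τ (u + κ + b) * theta τ (u + κ - b) *
      theta3 τ (u - κ + v) * theta3 τ (u - κ - v)) := by
    refine ⟨by fun_prop, fun u => ?_, fun u => ?_, fun u => ?_⟩
    · have e1 := thetaQuad_add_one τ u (-κ + b) (-κ - b) (κ + v) (κ - v)
      have e2 := thetaQuad_add_one τ u (κ + b) (κ - b) (-κ + v) (-κ - v)
      simp only [← add_assoc, ← add_sub_assoc, ← sub_eq_add_neg] at e1 e2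
      rw [e1, e2]
    · have e1 := thetaQuad_add_tau (τ := τ) (u := u) (x := -κ + b) (y := -κ - b) (z := κ + v)
        (w := κ - v) (by ring)
      have e2 := thetaQuad_add_tau (τ := τ) (u := u) (x := κ + b) (y := κ - b) (z := -κ + v)
        (w := -κ - v) (by ring)
      simp only [← add_assoc, ← add_sub_assoc, ← sub_eq_add_neg] at e1 e2
      rw [e1, e2, mul_sub]
    · rw [show -u - κ + b = -(u + κ - b) by ring, show -u - κ - b = -(u + κ + b) by ring,
        show -u + κ + b = -(u - κ - b) by ring, show -u + κ - b = -(u - κ + b) by ring,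
        show -u - κ + v = -(u + κ - v) by ring, show -u - κ - v = -(u + κ + v) by ring,
        show -u + κ + v = -(u - κ - v) by ring, show -u + κ - v = -(u - κ + v) by ring]
      simp only [theta_neg, theta3_neg]
      ring
  obtain ⟨c, hc⟩ := hodd.exists_eq_mul hτ
  -- At `u = κ - b` the first product contains `θ(0) = 0`, and the second one determines the
  -- constant.
  have h1 := hc (κ - b)
  simp only at h1 ⊢
  rw [show κ - b - κ + b = 0 by ring, theta_zero, show κ - b + κ + b = 2 * κ by ring,
    show κ - b + κ - b = -2 * b + 2 * κ by ring, show κ - b - κ + v = -(b - v) by ring,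
    show κ - b - κ - v = -(b + v) by ring, show 2 * (κ - b) = -2 * b + 2 * κ by ring,
    theta3_neg, theta3_neg] at h1
  have h2 : c = -(theta τ (2 * κ) * theta3 τ (b + v) * theta3 τ (b - v)) := by
    refine mul_right_cancel₀ (show theta τ (-2 * b + 2 * κ) ≠ 0 from hb) ?_
    linear_combination -h1
  rw [hc u, h2]

/-- This is `theta_addition` with `b` moved by a half period. Both sides vanish at `c = η`, so
differentiating there gives the infinitesimal version. -/
lemma theta3_addition {τ : ℂ} (hτ : 0 < τ.im) (s t c η : ℂ) :
    theta3 τ (s + c) * theta3 τ (s - c) * (theta3 τ (t + η) * theta3 τ (t - η)) -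
    theta3 τ (t + c) * theta3 τ (t - c) * (theta3 τ (s + η) * theta3 τ (s - η)) =
    theta τ (s - t) * theta τ (s + t) * (theta τ (c + η) * theta τ (c - η)) := by
  have h := theta_addition hτ ((s + t) / 2) ((s - t) / 2) (c + (1 / 2 + τ / 2)) η
  have e1 : ∀ x, theta τ (x + (c + (1 / 2 + τ / 2))) * theta τ (x - (c + (1 / 2 + τ / 2))) =
      -exp (-(Real.pi * I * τ / 2 + 2 * Real.pi * I * c)) *
        (theta3 τ (x + c) * theta3 τ (x - c)) := by
    intro x
    rw [show x + (c + (1 / 2 + τ / 2)) = x + c + 1 / 2 + τ / 2 by ring,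
      show x - (c + (1 / 2 + τ / 2)) = -(-(x - c) + 1 / 2 + τ / 2) by ring, theta_neg,
      theta_add_half, theta_add_half, theta3_neg,
      show -(Real.pi * I * τ / 2 + 2 * Real.pi * I * c) =
        -(Real.pi * I * τ / 4 + Real.pi * I * (x + c)) +
        -(Real.pi * I * τ / 4 + Real.pi * I * -(x - c)) by ring, exp_add]
    ring
  have e2 : theta3 τ (c + (1 / 2 + τ / 2) + η) * theta3 τ (c + (1 / 2 + τ / 2) - η) =
      -exp (-(Real.pi * I * τ / 2 + 2 * Real.pi * I * c)) *
        (theta τ (c + η) * theta τ (c - η)) := by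
    rw [show c + (1 / 2 + τ / 2) + η = c + η + 1 / 2 + τ / 2 by ring,
      show c + (1 / 2 + τ / 2) - η = c - η + 1 / 2 + τ / 2 by ring,
      theta3_add_half, theta3_add_half,
      show -(Real.pi * I * τ / 2 + 2 * Real.pi * I * c) =
        -(Real.pi * I * τ / 4 + Real.pi * I * (c + η)) +
        -(Real.pi * I * τ / 4 + Real.pi * I * (c - η)) by ring, exp_add]
    linear_combination (exp (-(Real.pi * I * τ / 4 + Real.pi * I * (c + η))) *
      exp (-(Real.pi * I * τ / 4 + Real.pi * I * (c - η))) * theta τ (c + η) *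
      theta τ (c - η)) * I_mul_I
  rw [show (s + t) / 2 - (s - t) / 2 = t by ring, show (s + t) / 2 + (s - t) / 2 = s by ring,
    e1, e1, show 2 * ((s - t) / 2) = s - t by ring, show 2 * ((s + t) / 2) = s + t by ring] at h
  refine mul_left_cancel₀ (exp_ne_zero (-(Real.pi * I * τ / 2 + 2 * Real.pi * I * c))) ?_
  linear_combination h - theta τ (s - t) * theta τ (s + t) * e2

/-- The infinitesimal case of `theta3_addition`, in terms of the logarithmic derivative. -/
lemma logDeriv_theta3_addition {τ : ℂ} (hτ : 0 < τ.im) {s t η : ℂ}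
    (h1 : theta3 τ (s + η) ≠ 0) (h2 : theta3 τ (s - η) ≠ 0) (h3 : theta3 τ (t + η) ≠ 0)
    (h4 : theta3 τ (t - η) ≠ 0) :
    (logDeriv (theta3 τ) (s + η) - logDeriv (theta3 τ) (s - η)) -
      (logDeriv (theta3 τ) (t + η) - logDeriv (theta3 τ) (t - η)) =
    deriv (theta τ) 0 * theta τ (2 * η) * (theta τ (s + t) * theta τ (s - t) /
      (theta3 τ (s + η) * theta3 τ (t + η) * (theta3 τ (s - η) * theta3 τ (t - η)))) := by
  have d3 := differentiable_theta3 hτ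
  have p : ∀ x, HasDerivAt (fun c => theta3 τ (x + c)) (deriv (theta3 τ) (x + η)) η :=
    fun x => HasDerivAt.comp_const_add x η (d3 _).hasDerivAt
  have m : ∀ x, HasDerivAt (fun c => theta3 τ (x - c)) (-deriv (theta3 τ) (x - η)) η :=
    fun x => HasDerivAt.comp_const_sub x η (d3 _).hasDerivAt
  -- The factor `θ(c - η)` vanishes at `c = η`, so only its derivative `θ'(0)` survives.
  have q : HasDerivAt (fun c => theta τ (c + η) * theta τ (c - η))
      (deriv (theta τ) 0 * theta τ (2 * η)) η := by
    have q1 : HasDerivAt (fun c => theta τ (c + η)) (deriv (theta τ) (η + η)) η :=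
      HasDerivAt.comp_add_const η η ((differentiable_theta hτ) _).hasDerivAt
    have q2 : HasDerivAt (fun c => theta τ (c - η)) (deriv (theta τ) (η - η)) η :=
      HasDerivAt.comp_sub_const η η ((differentiable_theta hτ) _).hasDerivAt
    convert! q1.mul q2 using 1
    rw [sub_self, theta_zero, two_mul]; ring
  have l := ((((p s).mul (m s)).mul_const (theta3 τ (t + η) * theta3 τ (t - η))).sub
    (((p t).mul (m t)).mul_const (theta3 τ (s + η) * theta3 τ (s - η))))
  have r := q.const_mul (theta τ (s - t) * theta τ (s + t))
  have h := l.unique (r.congr_of_eventuallyEq (Eventually.of_forall fun c =>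
    theta3_addition hτ s t c η))
  simp only [logDeriv_apply]
  generalize theta τ (2 * η) = X at *
  field_simp
  linear_combination h

/-! ### Raising operators and the structure of `Θ_N`. -/

lemma mul_mem_thetaSpace {τ : ℂ} {M N : ℕ} {f g : ℂ → ℂ} (hf : f ∈ thetaSpace τ M)
    (hg : g ∈ thetaSpace τ N) : (fun v => f v * g v) ∈ thetaSpace τ (M + N) := by
  obtain ⟨hf, hf1, hf2, hf3⟩ := hf
  obtain ⟨hg, hg1, hg2, hg3⟩ := hg
  refine ⟨hf.mul hg, fun x => by simp only [hf1, hg1], fun x => ?_,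
    fun x => by simp only [hf3, hg3]⟩
  simp only [hf2, hg2]
  rw [mul_mul_mul_comm, ← exp_add]
  congr 2; push_cast; ring

/-- The basic even theta function `ϑ₃(v + b) ϑ₃(v - b)` of order two. -/
def theta3Pair (τ b v : ℂ) : ℂ := theta3 τ (v + b) * theta3 τ (v - b)

lemma theta3Pair_mem {τ : ℂ} (hτ : 0 < τ.im) (b : ℂ) : theta3Pair τ b ∈ thetaSpace τ 1 := by
  have d := differentiable_theta3 hτ
  refine ⟨?_, fun x => ?_, fun x => ?_, fun x => ?_⟩
  · unfold theta3Pair; fun_prop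
  · simp only [theta3Pair]
    rw [add_right_comm, theta3_add_one, add_sub_right_comm, theta3_add_one]
  · simp only [theta3Pair]
    rw [add_right_comm, theta3_add_tau, add_sub_right_comm, theta3_add_tau, mul_mul_mul_comm,
      ← exp_add]
    congr 2; push_cast; ring
  · simp only [theta3Pair]
    rw [show -x + b = -(x - b) by ring, show -x - b = -(x + b) by ring, theta3_neg, theta3_neg,
      mul_comm]

/-- Multiplication by `theta3Pair τ b`, as a linear map `Θ_N → Θ_{N+1}`. -/
def raising {τ : ℂ} (hτ : 0 < τ.im) (N : ℕ) (b : ℂ) :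
    thetaSpace τ N →ₗ[ℂ] thetaSpace τ (N + 1) where
  toFun g := ⟨fun v => g.1 v * theta3Pair τ b v, mul_mem_thetaSpace g.2 (theta3Pair_mem hτ b)⟩
  map_add' f g := by ext v; simp [add_mul]
  map_smul' c f := by ext v; simp [mul_assoc]

lemma raising_apply {τ : ℂ} (hτ : 0 < τ.im) (N : ℕ) (b : ℂ) (g : thetaSpace τ N) (v : ℂ) :
    (raising hτ N b g).1 v = g.1 v * theta3Pair τ b v := rfl

lemma mem_thetaSpace_apply_add {τ : ℂ} {N : ℕ} {f : ℂ → ℂ} (hf : f ∈ thetaSpace τ N) {v : ℂ}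
    (hv : f v = 0) (m n : ℤ) : f (v + m + n * τ) = 0 := by
  obtain ⟨-, h1, h2, -⟩ := hf
  have p : Function.Periodic f 1 := h1
  rw [quasiperiodic_int (f := f) (τ := τ) (a := 2 * Real.pi * I * N) (c := 0)
    (fun z => by rw [h2, add_zero]), show f (v + m) = f v by simpa using p.int_mul m v, hv,
    mul_zero]

/-- Two lattice points cannot differ by `1/2`. Hence the zeros of `θ(v + 1/4) θ(v - 1/4)` are
simple. -/
lemma theta_half_ne_zero {τ : ℂ} (hτ : 0 < τ.im) {z : ℂ} (hz : theta τ z = 0) {w : ℂ}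
    (hw : w = z + 1 / 2 ∨ w = z - 1 / 2) : theta τ w ≠ 0 := by
  intro h
  obtain ⟨m, n, h1⟩ := exists_of_theta_eq_zero hτ hz
  obtain ⟨m', n', h2⟩ := exists_of_theta_eq_zero hτ h
  have h3 : ((2 * (w - z) : ℂ)) = (2 * (m' - m) : ℤ) + (2 * (n' - n) : ℤ) * τ := by
    rw [h1, h2]; push_cast; ring
  have h4 : ∃ k : ℤ, (2 * (w - z) : ℂ) = k ∧ k % 2 ≠ 0 := by
    rcases hw with rfl | rfl
    · exact ⟨1, by push_cast; ring, by norm_num⟩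
    · exact ⟨-1, by push_cast; ring, by norm_num⟩
  obtain ⟨k, hk, hk2⟩ := h4
  rw [hk] at h3
  have him := congrArg Complex.im h3
  simp only [intCast_im, add_im, mul_im, intCast_re, zero_mul, add_zero, zero_add] at him
  have hn : (2 * (n' - n) : ℤ) = 0 := by
    have : ((2 * (n' - n) : ℤ) : ℝ) = 0 := by
      rcases mul_eq_zero.mp him.symm with h | h
      · exact h
      · exact absurd h hτ.ne'
    exact_mod_cast this
  rw [hn, Int.cast_zero, zero_mul, add_zero] at h3
  have : k = 2 * (m' - m) := by exact_mod_cast h3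
  omega

lemma theta_pair_eq (τ a v : ℂ) : theta τ (v + a) * theta τ (v - a) =
    -exp (-(Real.pi * I * τ / 2 + 2 * Real.pi * I * (a - (1 / 2 + τ / 2)))) *
      theta3Pair τ (a - (1 / 2 + τ / 2)) v := by
  set c := a - (1 / 2 + τ / 2) with hc
  rw [show v + a = v + c + 1 / 2 + τ / 2 by rw [hc]; ring,
    show v - a = -(-(v - c) + 1 / 2 + τ / 2) by rw [hc]; ring, theta_neg,
    theta_add_half, theta_add_half, theta3_neg,
    show -(Real.pi * I * τ / 2 + 2 * Real.pi * I * c) =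
      -(Real.pi * I * τ / 4 + Real.pi * I * (v + c)) +
      -(Real.pi * I * τ / 4 + Real.pi * I * -(v - c)) by ring, exp_add, theta3Pair]
  ring

lemma theta3Pair_zero_quarter_ne_zero {τ : ℂ} (hτ : 0 < τ.im) : theta3Pair τ 0 (1 / 4) ≠ 0 := by
  intro h
  simp only [theta3Pair, add_zero, sub_zero, mul_self_eq_zero] at h
  obtain ⟨m, n, h⟩ := exists_of_theta3_eq_zero hτ h
  have him := congrArg Complex.im h
  have e : ((1 / 2 + n : ℝ)) * τ.im = 0 := by
    simp at him
    linarith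
  rcases mul_eq_zero.mp e with h | h
  · have : (1 + 2 * n : ℤ) = 0 := by
      have : (1 + 2 * n : ℝ) = 0 := by linarith
      exact_mod_cast this
    omega
  · exact hτ.ne' h

/-- `theta3Pair τ 0` is nonzero at `1/4`, so subtracting a multiple of a raised function makes `f`
vanish at `1/4`, and by evenness at `-1/4`. What remains is divisible by `θ(v + 1/4) θ(v - 1/4)`,
which is proportional to the second `theta3Pair`. -/
lemma exists_eq_raising {τ : ℂ} (hτ : 0 < τ.im) (N : ℕ) (f : thetaSpace τ (N + 1)) :
    ∃ g₁ g₂ : thetaSpace τ N, f = raising hτ N 0 g₁ +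
      raising hτ N (1 / 4 - (1 / 2 + τ / 2)) g₂ := by
  set b : ℂ := 1 / 4 - (1 / 2 + τ / 2) with hb
  have hth := differentiable_theta hτ
  obtain ⟨g₀, hg₀⟩ : ∃ g₀ : thetaSpace τ N, g₀.1 (1 / 4) ≠ 0 := by
    have hN : ∀ M : ℕ, (fun v => theta3Pair τ 0 v ^ M) ∈ thetaSpace τ M := by
      intro M
      induction M with
      | zero => exact ⟨by simp, by simp, by simp, by simp⟩
      | succ M ih =>
        simp only [pow_succ]
        exact mul_mem_thetaSpace ih (theta3Pair_mem hτ 0)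
    exact ⟨⟨_, hN N⟩, pow_ne_zero N (theta3Pair_zero_quarter_ne_zero hτ)⟩
  have h4 : (raising hτ N 0 g₀).1 (1 / 4) ≠ 0 := by
    rw [raising_apply]
    exact mul_ne_zero hg₀ (theta3Pair_zero_quarter_ne_zero hτ)
  set c := f.1 (1 / 4) / (raising hτ N 0 g₀).1 (1 / 4) with hc
  set F : thetaSpace τ (N + 1) := f - c • raising hτ N 0 g₀ with hF
  have hF0 : F.1 (1 / 4) = 0 := by
    have : F.1 (1 / 4) = f.1 (1 / 4) - c * (raising hτ N 0 g₀).1 (1 / 4) := rfl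
    rw [this, hc, div_mul_cancel₀ _ h4, sub_self]
  let d : ℂ → ℂ := fun v => theta τ (v + 1 / 4) * theta τ (v - 1 / 4)
  have hd : ∀ v, d v = -exp (-(Real.pi * I * τ / 2 + 2 * Real.pi * I * b)) * theta3Pair τ b v :=
    fun v => theta_pair_eq τ (1 / 4) v
  set k := -exp (-(Real.pi * I * τ / 2 + 2 * Real.pi * I * b)) with hk
  have hk0 : k ≠ 0 := neg_ne_zero.mpr (exp_ne_zero _)
  have hdmem : d ∈ thetaSpace τ 1 := by
    have : d = k • theta3Pair τ b := by funext v; rw [hd]; rfl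
    rw [this]; exact (thetaSpace τ 1).smul_mem _ (theta3Pair_mem hτ b)
  have hFd : ∀ v, d v = 0 → F.1 v = 0 := by
    intro v hv
    rcases mul_eq_zero.mp hv with h | h
    · obtain ⟨m, n, h⟩ := exists_of_theta_eq_zero hτ h
      rw [show v = -(1 / 4 : ℂ) + m + n * τ by linear_combination h]
      exact mem_thetaSpace_apply_add F.2 ((F.2.2.2.2 _).trans hF0) m n
    · obtain ⟨m, n, h⟩ := exists_of_theta_eq_zero hτ h
      rw [show v = (1 / 4 : ℂ) + m + n * τ by linear_combination h]
      exact mem_thetaSpace_apply_add F.2 hF0 m n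
  have hd' : ∀ v, d v = 0 → deriv d v ≠ 0 := by
    intro v hv
    have q1 : HasDerivAt (fun c => theta τ (c + 1 / 4)) (deriv (theta τ) (v + 1 / 4)) v :=
      HasDerivAt.comp_add_const v _ (hth _).hasDerivAt
    have q2 : HasDerivAt (fun c => theta τ (c - 1 / 4)) (deriv (theta τ) (v - 1 / 4)) v :=
      HasDerivAt.comp_sub_const v _ (hth _).hasDerivAt
    have q : deriv d v = _ := (q1.mul q2).deriv
    rw [q]
    rcases mul_eq_zero.mp hv with h | h
    · rw [h, zero_mul, add_zero]
      exact mul_ne_zero (deriv_theta_ne_zero hτ h)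
        (theta_half_ne_zero hτ h (Or.inr (by ring)))
    · rw [h, mul_zero, zero_add]
      exact mul_ne_zero (theta_half_ne_zero hτ h (Or.inl (by ring)))
        (deriv_theta_ne_zero hτ h)
  have hQd : Differentiable ℂ (entireQuot F.1 d) :=
    differentiable_entireQuot F.2.1 hdmem.1 fun v hv => ⟨hFd v hv, hd' v hv⟩
  have key : ∀ v, entireQuot F.1 d v * d v = F.1 v := fun v => entireQuot_mul (hFd v)
  have hdense : Dense {v | d v ≠ 0} := by
    have h1 : ({v | d v = 0} : Set ℂ).Countable := by
      have h2 := fun a : ℂ => (Set.countable_range fun x : ℤ × ℤ => ((x.1 : ℂ) + x.2 * τ + a))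
      refine ((h2 (1 / 4)).union (h2 (-(1 / 4)))).mono fun v hv => ?_
      rcases mul_eq_zero.mp hv with h | h
      · obtain ⟨m, n, h⟩ := exists_of_theta_eq_zero hτ h
        exact Or.inr ⟨(m, n), by simp only; linear_combination -h⟩
      · obtain ⟨m, n, h⟩ := exists_of_theta_eq_zero hτ h
        exact Or.inl ⟨(m, n), by simp only; linear_combination -h⟩
    exact h1.dense_compl ℂ
  have ext : ∀ a b : ℂ → ℂ, Continuous a → Continuous b →
      (∀ z, d z ≠ 0 → a z = b z) → ∀ z, a z = b z := by
    intro a b ha hb h z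
    exact congrFun (Continuous.ext_on hdense ha hb h) z
  have hcont := hQd.continuous
  have hQ : entireQuot F.1 d ∈ thetaSpace τ N := by
    refine ⟨hQd, ?_, ?_, ?_⟩
    · refine ext _ _ (by fun_prop) (by fun_prop) fun z h => mul_right_cancel₀ h ?_
      rw [key, ← hdmem.2.1, key, F.2.2.1]
    · refine ext _ _ (by fun_prop) (by fun_prop) fun z h => ?_
      refine mul_right_cancel₀ (mul_ne_zero
        (exp_ne_zero (-(2 * Real.pi * I * (1 : ℕ) * (2 * z + τ)))) h) ?_
      rw [← hdmem.2.2.1, key, F.2.2.2.1, hdmem.2.2.1, ← key z]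
      rw [mul_mul_mul_comm, ← exp_add]
      congr 2; push_cast; ring
    · refine ext _ _ (by fun_prop) (by fun_prop) fun z h => mul_right_cancel₀ h ?_
      rw [key, ← hdmem.2.2.2, key, F.2.2.2.2]
  refine ⟨c • g₀, k • ⟨entireQuot F.1 d, hQ⟩, ?_⟩
  have hFr : raising hτ N b (k • ⟨entireQuot F.1 d, hQ⟩) = F := by
    ext v
    rw [map_smul, Submodule.coe_smul, Pi.smul_apply, raising_apply, smul_eq_mul, ← key v, hd]
    ring
  rw [hFr, map_smul, hF]; abel

/-- Evaluation at a point, as a linear form on `Θ_N`. -/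
def thetaEval (τ : ℂ) (N : ℕ) (u : ℂ) : thetaSpace τ N →ₗ[ℂ] ℂ where
  toFun f := f.1 u
  map_add' _ _ := rfl
  map_smul' _ _ := rfl

instance thetaSpace_finite {τ : ℂ} [hτ : Fact (0 < τ.im)] (N : ℕ) :
    Module.Finite ℂ (thetaSpace τ N) := by
  induction N with
  | zero =>
    refine Module.Finite.of_injective (thetaEval τ 0 0) fun f g h => ?_
    ext z
    rw [thetaSpace_zero_const hτ.out f.2 z 0, thetaSpace_zero_const hτ.out g.2 z 0]
    exact h
  | succ N ih =>
    refine Module.Finite.of_surjective ((raising hτ.out N 0).coprod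
      (raising hτ.out N (1 / 4 - (1 / 2 + τ / 2)))) fun f => ?_
    obtain ⟨g₁, g₂, h⟩ := exists_eq_raising hτ.out N f
    exact ⟨(g₁, g₂), by rw [h]; rfl⟩

/-! ### The lowering operator. -/

/-- The numerator of `lowering`. -/
def loweringNum (τ : ℂ) (N : ℕ) (b η : ℂ) (f : ℂ → ℂ) (u : ℂ) : ℂ :=
  theta τ (u - (N + 1) * η + b) * theta τ (u - (N + 1) * η - b) * f (u + η) -
    theta τ (u + (N + 1) * η + b) * theta τ (u + (N + 1) * η - b) * f (u - η)

/-- The shift `(N + 1) η` is chosen so that under `u ↦ u + τ` the `η`-dependence of the two theta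
multipliers cancels that of `f (u ± η)`. The map `u ↦ -u` exchanges the two terms, whence oddness.
-/
lemma isOddTheta_loweringNum {τ : ℂ} (hτ : 0 < τ.im) (N : ℕ) (b η : ℂ) {f : ℂ → ℂ}
    (hf : f ∈ thetaSpace τ (N + 1)) : IsOddTheta τ (N + 2) (loweringNum τ N b η f) := by
  obtain ⟨hf, h1, h2, h3⟩ := hf
  have hth := differentiable_theta hτ
  refine ⟨?_, fun u => ?_, fun u => ?_, fun u => ?_⟩
  · unfold loweringNum; fun_prop
  · simp only [loweringNum]
    generalize ((N : ℂ) + 1) * η = κ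
    rw [show u + 1 - κ + b = u - κ + b + 1 by ring, show u + 1 - κ - b = u - κ - b + 1 by ring,
      show u + 1 + κ + b = u + κ + b + 1 by ring, show u + 1 + κ - b = u + κ - b + 1 by ring,
      show u + 1 + η = u + η + 1 by ring, show u + 1 - η = u - η + 1 by ring]
    simp only [theta_add_one, h1]
    ring
  · have e1 : ∀ κ e : ℂ, κ = (N + 1) * e →
        theta τ (u + τ - κ + b) * theta τ (u + τ - κ - b) * f (u + τ + e) =
        exp (-(2 * Real.pi * I * (N + 2 : ℕ) * (2 * u + τ))) *
          (theta τ (u - κ + b) * theta τ (u - κ - b) * f (u + e)) := by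
      intro κ e hκ
      rw [show u + τ - κ + b = u - κ + b + τ by ring, show u + τ - κ - b = u - κ - b + τ by ring,
        show u + τ + e = u + e + τ by ring, theta_add_tau, theta_add_tau, h2,
        show -(2 * Real.pi * I * (N + 2 : ℕ) * (2 * u + τ)) =
          -(Real.pi * I * (τ + 2 * (u - κ + b))) + -(Real.pi * I * (τ + 2 * (u - κ - b))) +
          -(2 * Real.pi * I * (N + 1 : ℕ) * (2 * (u + e) + τ)) by
            rw [hκ]; push_cast; ring, exp_add, exp_add]
      ring
    have h4 := e1 _ η rfl
    -- The second term is the first with `η` replaced by `-η`.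
    have h5 := e1 (-((N + 1) * η)) (-η) (by ring)
    simp only [sub_neg_eq_add, ← sub_eq_add_neg] at h5
    rw [loweringNum, loweringNum, h4, h5, mul_sub]
  · simp only [loweringNum]
    generalize ((N : ℂ) + 1) * η = κ
    rw [show -u - κ + b = -(u + κ - b) by ring, show -u - κ - b = -(u + κ + b) by ring,
        show -u + κ + b = -(u - κ - b) by ring, show -u + κ - b = -(u - κ + b) by ring,
        show -u + η = -(u - η) by ring, show -u - η = -(u + η) by ring]
    simp only [theta_neg, h3]
    ring

/-- The lowering difference operator `Θ_{N+1} → Θ_N`, adjoint to `raising`. -/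
def lowering {τ : ℂ} (hτ : 0 < τ.im) (N : ℕ) (b η : ℂ) (f : thetaSpace τ (N + 1)) :
    thetaSpace τ N :=
  ⟨entireQuot (loweringNum τ N b η f.1) (fun u => theta τ (2 * u)),
    (isOddTheta_loweringNum hτ N b η f.2).quot_mem hτ⟩

lemma lowering_mul {τ : ℂ} (hτ : 0 < τ.im) (N : ℕ) (b η : ℂ) (f : thetaSpace τ (N + 1)) (u : ℂ) :
    (lowering hτ N b η f).1 u * theta τ (2 * u) = loweringNum τ N b η f.1 u :=
  entireQuot_mul (g := fun u => theta τ (2 * u))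
    fun h => (isOddTheta_loweringNum hτ N b η f.2).eq_zero hτ h

/-- Finitely many generic points at which values determine an element of `Θ_N`. -/
lemma exists_interpolation {τ : ℂ} (hτ : 0 < τ.im) (N : ℕ) :
    ∃ (T : Finset {u : ℂ // theta τ (2 * u) ≠ 0}) (e : T → thetaSpace τ N),
      ∀ f : thetaSpace τ N, f = ∑ t : T, f.1 t.1.1 • e t := by
  classical
  have : Fact (0 < τ.im) := ⟨hτ⟩
  let ev : {u : ℂ // theta τ (2 * u) ≠ 0} → thetaSpace τ N →ₗ[ℂ] ℂ := fun u => thetaEval τ N u.1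
  -- In finite dimension the intersection of all these kernels is already that of finitely many. It
  -- is zero because the evaluation points are dense.
  obtain ⟨T, hT⟩ := Finset.exists_inf_le (fun u => LinearMap.ker (ev u))
  let E : thetaSpace τ N →ₗ[ℂ] (T → ℂ) := LinearMap.pi fun t => ev t.1
  have hE : LinearMap.ker E = ⊥ := by
    rw [LinearMap.ker_eq_bot']
    intro f hf
    have h1 : f ∈ T.inf (fun u => LinearMap.ker (ev u)) := by
      rw [Submodule.mem_finsetInf]
      intro i hi
      exact congrFun hf ⟨i, hi⟩
    have h2 : ∀ z, theta τ (2 * z) ≠ 0 → f.1 z = (0 : ℂ → ℂ) z := fun z hz => hT ⟨z, hz⟩ h1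
    have hdense : Dense {z | theta τ (2 * z) ≠ 0} := by
      simpa using dense_theta_ne_zero hτ two_ne_zero 0
    ext z
    exact congrFun (Continuous.ext_on hdense f.2.1.continuous continuous_const h2) z
  obtain ⟨L, hL⟩ := E.exists_leftInverse_of_injective hE
  refine ⟨T, fun t => L (Pi.single t 1), fun f => ?_⟩
  have h1 : L (E f) = f := LinearMap.congr_fun hL f
  conv_lhs => rw [← h1, ← LinearMap.sum_single_apply (fun _ => ℂ) (E f), map_sum]
  refine Finset.sum_congr rfl fun t _ => ?_
  rw [← map_smul]
  congr 1
  rw [← Pi.single_smul, smul_eq_mul, mul_one]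
  rfl

/-! ### Integrals over the period rectangle and contour translation. -/

lemma intervalIntegral_swap_of_continuousOn {F : ℝ → ℝ → ℂ} {a b c d : ℝ}
    (h : ContinuousOn F.uncurry (Set.uIcc a b ×ˢ Set.uIcc c d)) :
    ∫ x in a..b, ∫ y in c..d, F x y = ∫ y in c..d, ∫ x in a..b, F x y := by
  refine intervalIntegral_intervalIntegral_swap ?_
  refine (h.integrableOn_compact (isCompact_uIcc.prod isCompact_uIcc)).mono_set ?_
  exact Set.prod_mono Set.uIoc_subset_uIcc Set.uIoc_subset_uIcc

lemma intervalIntegral_swap_of_continuous {F : ℝ → ℝ → ℂ} {a b c d : ℝ}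
    (h : Continuous F.uncurry) :
    ∫ x in a..b, ∫ y in c..d, F x y = ∫ y in c..d, ∫ x in a..b, F x y :=
  intervalIntegral_swap_of_continuousOn h.continuousOn

/-- Dependence of a segment integral of a holomorphic function with additive quasi-period `T e` on
a translation of the segment. -/
lemma integral_translate {Z : ℂ → ℂ} {S : Set ℂ} (hS : IsOpen S) (hZ : DifferentiableOn ℂ Z S)
    {z₀ e δ c : ℂ} {T : ℝ}
    (hmem : ∀ y q : ℝ, q ∈ Set.Icc (0 : ℝ) 1 → z₀ + y * e + q * δ ∈ S)
    (hper : ∀ q : ℝ, q ∈ Set.Icc (0 : ℝ) 1 → Z (z₀ + T * e + q * δ) = Z (z₀ + q * δ) + c) :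
    e * ((∫ y in (0 : ℝ)..T, Z (z₀ + y * e + δ)) - ∫ y in (0 : ℝ)..T, Z (z₀ + y * e)) = c * δ := by
  have hd : ContinuousOn (deriv Z) S := (hZ.deriv hS).continuousOn
  have hZc := hZ.continuousOn
  have u01 : Set.uIcc (0 : ℝ) 1 = Set.Icc 0 1 := Set.uIcc_of_le zero_le_one
  have hcont : ContinuousOn (fun p : ℝ × ℝ => deriv Z (z₀ + p.1 * e + p.2 * δ))
      (Set.uIcc 0 T ×ˢ Set.uIcc (0 : ℝ) 1) := by
    refine hd.comp (by fun_prop) fun p hp => hmem p.1 p.2 (u01 ▸ hp.2)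
  have hderq : ∀ y q : ℝ, q ∈ Set.Icc (0 : ℝ) 1 →
      HasDerivAt (fun q : ℝ => Z (z₀ + y * e + q * δ)) (deriv Z (z₀ + y * e + q * δ) * δ) q := by
    intro y q hq
    have h1 := (hZ.differentiableAt (hS.mem_nhds (hmem y q hq))).hasDerivAt
    have h2 : HasDerivAt (fun q : ℝ => z₀ + y * e + q * δ) δ q := by
      simpa using ((hasDerivAt_id q).ofReal_comp.mul_const δ).const_add (z₀ + y * e)
    exact h1.comp q h2
  have hdery : ∀ y q : ℝ, q ∈ Set.Icc (0 : ℝ) 1 →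
      HasDerivAt (fun y : ℝ => Z (z₀ + y * e + q * δ)) (deriv Z (z₀ + y * e + q * δ) * e) y := by
    intro y q hq
    have h1 := (hZ.differentiableAt (hS.mem_nhds (hmem y q hq))).hasDerivAt
    have h2 : HasDerivAt (fun y : ℝ => z₀ + y * e + q * δ) e y := by
      simpa using (((hasDerivAt_id y).ofReal_comp.mul_const e).const_add z₀).add_const (q * δ)
    exact h1.comp y h2
  have hq : ∀ y ∈ Set.uIcc 0 T, ∫ q in (0 : ℝ)..1, deriv Z (z₀ + y * e + q * δ) * δ =
      Z (z₀ + y * e + δ) - Z (z₀ + y * e) := by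
    intro y hy
    rw [intervalIntegral.integral_eq_sub_of_hasDerivAt
      (f := fun q : ℝ => Z (z₀ + y * e + q * δ)) (fun q hq => hderq y q (u01 ▸ hq))]
    · simp
    · refine ContinuousOn.intervalIntegrable (ContinuousOn.mul ?_ continuousOn_const)
      exact hcont.comp (f := fun q : ℝ => (y, q)) (by fun_prop) fun q hq => ⟨hy, hq⟩
  have hy : ∀ q ∈ Set.uIcc (0 : ℝ) 1, ∫ y in (0 : ℝ)..T, deriv Z (z₀ + y * e + q * δ) * e = c := by
    intro q hq
    rw [intervalIntegral.integral_eq_sub_of_hasDerivAt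
      (f := fun y : ℝ => Z (z₀ + y * e + q * δ)) (fun y _ => hdery y q (u01 ▸ hq))]
    · simp [hper q (u01 ▸ hq)]
    · refine ContinuousOn.intervalIntegrable (ContinuousOn.mul ?_ continuousOn_const)
      exact hcont.comp (f := fun y : ℝ => (y, q)) (by fun_prop) fun y hy => ⟨hy, hq⟩
  -- The difference is an integral of `deriv Z` over the swept parallelogram. In the other order the
  -- inner integral is the increment `c` over a period.
  have hsub : (∫ y in (0 : ℝ)..T, Z (z₀ + y * e + δ)) - ∫ y in (0 : ℝ)..T, Z (z₀ + y * e) =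
      ∫ y in (0 : ℝ)..T, ∫ q in (0 : ℝ)..1, deriv Z (z₀ + y * e + q * δ) * δ := by
    rw [intervalIntegral.integral_congr (fun y hy => hq y hy), intervalIntegral.integral_sub]
    · refine (Continuous.intervalIntegrable ?_ _ _)
      refine hZc.comp_continuous (by fun_prop) fun y => ?_
      simpa using hmem y 1 (by simp)
    · refine (Continuous.intervalIntegrable ?_ _ _)
      refine hZc.comp_continuous (by fun_prop) fun y => ?_
      simpa using hmem y 0 (by simp)
  rw [hsub, intervalIntegral_swap_of_continuousOn (F := fun y q => _) (by
    exact hcont.mul continuousOn_const)]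
  have h2 : ∀ q ∈ Set.uIcc (0 : ℝ) 1, e * ∫ y in (0 : ℝ)..T, deriv Z (z₀ + y * e + q * δ) * δ =
      c * δ := by
    intro q hq'
    rw [← hy q hq', intervalIntegral.integral_mul_const, intervalIntegral.integral_mul_const]
    ring
  rw [← intervalIntegral.integral_const_mul, intervalIntegral.integral_congr h2]
  simp

/-- The integral of `Q` over the rectangle `[0, 1] × [0, T]`. -/
def rectIntegral (T : ℝ) (Q : ℝ → ℝ → ℂ) : ℂ := ∫ x in (0 : ℝ)..1, ∫ y in (0 : ℝ)..T, Q x y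

lemma rectIntegral_congr {T : ℝ} {Q Q' : ℝ → ℝ → ℂ} (h : ∀ x y, Q x y = Q' x y) :
    rectIntegral T Q = rectIntegral T Q' := by
  rw [show Q = Q' from funext fun x => funext (h x)]

lemma rectIntegral_const_mul (T : ℝ) (c : ℂ) (Q : ℝ → ℝ → ℂ) :
    rectIntegral T (fun x y => c * Q x y) = c * rectIntegral T Q := by
  simp only [rectIntegral, intervalIntegral.integral_const_mul]

lemma rectIntegral_add (T : ℝ) {Q Q' : ℝ → ℝ → ℂ} (h : Continuous Q.uncurry)
    (h' : Continuous Q'.uncurry) : rectIntegral T (fun x y => Q x y + Q' x y) =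
      rectIntegral T Q + rectIntegral T Q' := by
  unfold rectIntegral
  rw [← intervalIntegral.integral_add]
  · refine intervalIntegral.integral_congr fun x _ => ?_
    simp only
    rw [intervalIntegral.integral_add]
    · exact Continuous.intervalIntegrable (by fun_prop) _ _
    · exact Continuous.intervalIntegrable (by fun_prop) _ _
  · exact (intervalIntegral.continuous_parametric_intervalIntegral_of_continuous' h 0
      T).intervalIntegrable _ _
  · exact (intervalIntegral.continuous_parametric_intervalIntegral_of_continuous' h' 0
      T).intervalIntegrable _ _

lemma integral_reflect {T : ℝ} {f : ℝ → ℂ} (hf : Function.Periodic f T) :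
    ∫ y in (0 : ℝ)..T, f (-y) = ∫ y in (0 : ℝ)..T, f y := by
  rw [intervalIntegral.integral_comp_neg, neg_zero]
  have := hf.intervalIntegral_add_eq (-T) 0
  simpa using this

lemma rectIntegral_reflect {T : ℝ} {Q : ℝ → ℝ → ℂ} (h1 : ∀ x y, Q (x + 1) y = Q x y)
    (h2 : ∀ x y, Q x (y + T) = Q x y) :
    rectIntegral T (fun x y => Q (-x) (-y)) = rectIntegral T Q := by
  unfold rectIntegral
  simp only [integral_reflect (h2 _)]
  exact integral_reflect (f := fun x => ∫ y in (0 : ℝ)..T, Q x y) fun x => by simp only [h1]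

lemma integral_fundRect {τ : ℂ} (hτ : 0 < τ.im) {F : ℂ → ℂ} (hF : Continuous F) :
    ∫ u in fundRect τ, F u = rectIntegral τ.im (fun x y => F (x + y * I)) := by
  have h1 : fundRect τ = measurableEquivRealProd ⁻¹'
      (Set.Ico (0 : ℝ) 1 ×ˢ Set.Ico (0 : ℝ) τ.im) := by
    ext u; simp [fundRect]
  have h2 := volume_preserving_equiv_real_prod.setIntegral_preimage_emb
    measurableEquivRealProd.measurableEmbedding (fun p : ℝ × ℝ => F (p.1 + p.2 * I))
    (Set.Ico (0 : ℝ) 1 ×ˢ Set.Ico (0 : ℝ) τ.im)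
  rw [← h1] at h2
  simp only [measurableEquivRealProd_apply, re_add_im] at h2
  have hc : Continuous (fun p : ℝ × ℝ => F (p.1 + p.2 * I)) := by fun_prop
  rw [h2, Measure.volume_eq_prod, setIntegral_prod, rectIntegral,
    intervalIntegral.integral_of_le zero_le_one, integral_Ico_eq_integral_Ioc]
  · simp only [integral_Ico_eq_integral_Ioc, intervalIntegral.integral_of_le hτ.le]
  · rw [← Measure.volume_eq_prod]
    refine (hc.continuousOn.integrableOn_compact (isCompact_Icc.prod isCompact_Icc)).mono_set
      (Set.prod_mono Set.Ico_subset_Icc_self Set.Ico_subset_Icc_self)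

/-- Translation of both contours in a double integral of a function with denominator
`D (2 w) * D (2 z)`. -/
lemma rectIntegral_translate {T : ℝ} {τ δ : ℂ} (hT : τ = T * I) {P : ℂ → ℂ → ℂ} {D : ℂ → ℂ}
    (hP : Differentiable ℂ P.uncurry) (hD : Differentiable ℂ D)
    (hx : ∀ x q : ℝ, q ∈ Set.Icc (0 : ℝ) 1 → D (2 * (x + q * δ)) ≠ 0)
    (hy : ∀ y q : ℝ, q ∈ Set.Icc (0 : ℝ) 1 → D (2 * (y * I + q * δ)) ≠ 0)
    (h1 : ∀ w z, P (w + 1) z / (D (2 * (w + 1)) * D (2 * z)) = P w z / (D (2 * w) * D (2 * z)))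
    (h2 : ∀ w z, P w (z + τ) / (D (2 * w) * D (2 * (z + τ))) = P w z / (D (2 * w) * D (2 * z))) :
    rectIntegral T (fun x y => P (x + δ) (y * I + δ) / (D (2 * (x + δ)) * D (2 * (y * I + δ)))) =
    rectIntegral T (fun x y => P x (y * I) / (D (2 * x) * D (2 * (y * I)))) := by
  have hPc := hP.continuous
  have hDc := hD.continuous
  have hS : IsOpen {w | D (2 * w) ≠ 0} :=
    isOpen_ne_fun (by fun_prop) continuous_const
  have hx0 : ∀ x : ℝ, D (2 * x) ≠ 0 := fun x => by simpa using hx x 0 (by simp)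
  have hy1 : ∀ y : ℝ, D (2 * (y * I + δ)) ≠ 0 := fun y => by simpa using hy y 1 (by simp)
  have hx1 : ∀ x : ℝ, D (2 * (x + δ)) ≠ 0 := fun y => by simpa using hx y 1 (by simp)
  have hPx : ∀ z, Differentiable ℂ (fun w => P w z) := fun z =>
    hP.comp (f := fun w => (w, z)) (by fun_prop)
  have hPz : ∀ w, Differentiable ℂ (fun z => P w z) := fun w =>
    hP.comp (f := fun z => (w, z)) (by fun_prop)
  -- The contours for `z = i y` and `w = x` are moved one at a time: the integrand is holomorphic in
  -- each variable separately on the swept region, and periodicity makes the increment `c` zero.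
  have step1 : ∀ x : ℝ, ∫ y in (0 : ℝ)..T, P x (y * I) / (D (2 * x) * D (2 * (y * I))) =
      ∫ y in (0 : ℝ)..T, P x (y * I + δ) / (D (2 * x) * D (2 * (y * I + δ))) := by
    intro x
    have h := integral_translate (Z := fun z => P x z / (D (2 * x) * D (2 * z))) hS (by
      intro z hz
      have hz : D (2 * (x : ℂ)) * D (2 * z) ≠ 0 := mul_ne_zero (hx0 x) hz
      exact ((hPz x z).div (by fun_prop : DifferentiableAt ℂ (fun z => D (2 * x) * D (2 * z)) z)
        hz).differentiableWithinAt)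
      (z₀ := 0) (e := I) (δ := δ) (c := 0) (T := T) (fun y q hq => by
        rw [zero_add]; exact hy y q hq) (fun q hq => by
        rw [add_zero, show (0 : ℂ) + T * I + q * δ = q * δ + τ by rw [hT]; ring, zero_add]
        exact h2 x (q * δ))
    simp only [zero_mul, mul_eq_zero, I_ne_zero, false_or, zero_add] at h
    exact (sub_eq_zero.mp h).symm
  have step2 : ∀ y : ℝ, ∫ x in (0 : ℝ)..1, P x (y * I + δ) / (D (2 * x) * D (2 * (y * I + δ))) =
      ∫ x in (0 : ℝ)..1, P (x + δ) (y * I + δ) / (D (2 * (x + δ)) * D (2 * (y * I + δ))) := by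
    intro y
    have h := integral_translate
      (Z := fun w => P w (y * I + δ) / (D (2 * w) * D (2 * (y * I + δ)))) hS (by
      intro w hw
      exact ((hPx _ w).div (by fun_prop : DifferentiableAt ℂ
        (fun w => D (2 * w) * D (2 * (y * I + δ))) w)
        (mul_ne_zero hw (hy1 y))).differentiableWithinAt)
      (z₀ := 0) (e := 1) (δ := δ) (c := 0) (T := 1) (fun x q hq => by
        rw [zero_add, mul_one]; exact hx x q hq) (fun q hq => by
        rw [add_zero, show (0 : ℂ) + (1 : ℝ) * 1 + q * δ = q * δ + 1 by push_cast; ring, zero_add]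
        exact h1 (q * δ) (y * I + δ))
    simp only [zero_mul, one_mul, mul_one, zero_add] at h
    exact (sub_eq_zero.mp h).symm
  unfold rectIntegral
  simp only [step1]
  rw [intervalIntegral_swap_of_continuous (F := fun (x y : ℝ) =>
    P x (y * I + δ) / (D (2 * x) * D (2 * (y * I + δ))))]
  · simp only [step2]
    rw [intervalIntegral_swap_of_continuous (F := fun (x y : ℝ) =>
      P (x + δ) (y * I + δ) / (D (2 * (x + δ)) * D (2 * (y * I + δ))))]
    refine Continuous.div ?_ ?_ fun p => mul_ne_zero (hx1 _) (hy1 _)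
    · exact hPc.comp (by fun_prop : Continuous fun p : ℝ × ℝ => ((p.1 : ℂ) + δ, (p.2 : ℂ) * I + δ))
    · fun_prop
  · refine Continuous.div ?_ ?_ fun p => mul_ne_zero (hx0 _) (hy1 _)
    · exact hPc.comp (by fun_prop : Continuous fun p : ℝ × ℝ => ((p.1 : ℂ), (p.2 : ℂ) * I + δ))
    · fun_prop

/-! ### The denominator of the weight and its zeros. -/

/-- The product `∏_{k=0}^{N+1} ϑ₃(z + (2 k - N - 1) η)`. -/
def thetaDen (τ : ℂ) (N : ℕ) (η z : ℂ) : ℂ :=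
  ∏ k ∈ Finset.range (N + 2), theta3 τ (z + (2 * (k : ℂ) - N - 1) * η)

lemma sum_range_coeff (N : ℕ) : ∑ k ∈ Finset.range (N + 2), (2 * (k : ℂ) - N - 1) = 0 := by
  have h : ∀ M : ℕ, ∑ k ∈ Finset.range M, (2 * (k : ℂ)) = M * (M - 1) := by
    intro M
    induction M with
    | zero => simp
    | succ M ih => rw [Finset.sum_range_succ, ih]; push_cast; ring
  rw [Finset.sum_sub_distrib, Finset.sum_sub_distrib, h]
  simp only [Finset.sum_const, Finset.card_range, nsmul_eq_mul]
  push_cast; ring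

/-- The half-period shifts produce exponentials. Since the coefficients `2k - N - 1` sum to zero,
these cancel `exp (2πiu(N+2))` up to a constant. -/
lemma weight_eq (τ : ℂ) (N : ℕ) (η u v : ℂ) : weight τ N η u v =
    exp (Real.pi * I * τ / 2 * (N + 2)) * (theta τ (2 * u) * theta τ (2 * v) /
      (thetaDen τ N η (u + v) * thetaDen τ N η (u - v))) := by
  have h1 : ∏ k ∈ Finset.range (N + 2),
        (theta τ (u + v + (2 * (k : ℂ) - N - 1) * η + 1 / 2 + τ / 2) *
          theta τ (u - v + (2 * (k : ℂ) - N - 1) * η + 1 / 2 + τ / 2)) =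
      exp (-((N + 2) * (Real.pi * I * τ / 2 + 2 * Real.pi * I * u))) *
        (thetaDen τ N η (u + v) * thetaDen τ N η (u - v)) := by
    have h2 : ∀ k ∈ Finset.range (N + 2),
        (theta τ (u + v + (2 * (k : ℂ) - N - 1) * η + 1 / 2 + τ / 2) *
          theta τ (u - v + (2 * (k : ℂ) - N - 1) * η + 1 / 2 + τ / 2)) =
        exp (-(Real.pi * I * τ / 2 + 2 * Real.pi * I * u) -
          2 * Real.pi * I * η * (2 * (k : ℂ) - N - 1)) *
        (theta3 τ (u + v + (2 * (k : ℂ) - N - 1) * η) *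
          theta3 τ (u - v + (2 * (k : ℂ) - N - 1) * η)) := by
      intro k _
      rw [theta_add_half, theta_add_half, mul_mul_mul_comm, ← exp_add]
      congr 2; ring
    rw [Finset.prod_congr rfl h2, Finset.prod_mul_distrib, Finset.prod_mul_distrib, ← exp_sum,
      Finset.sum_sub_distrib, ← Finset.mul_sum, sum_range_coeff, thetaDen, thetaDen]
    congr 2
    simp only [Finset.sum_const, Finset.card_range, nsmul_eq_mul]
    push_cast; ring
  rw [weight, h1, ← mul_assoc, ← exp_add]
  rw [show 2 * Real.pi * I * u * ((N : ℂ) + 2) +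
    -((N + 2) * (Real.pi * I * τ / 2 + 2 * Real.pi * I * u)) =
    -(Real.pi * I * τ / 2 * (N + 2)) by ring, exp_neg]
  have := exp_ne_zero (Real.pi * I * τ / 2 * (N + 2))
  rw [div_mul_eq_div_div, div_inv_eq_mul]
  ring

lemma differentiable_thetaDen {τ : ℂ} (hτ : 0 < τ.im) (N : ℕ) (η : ℂ) :
    Differentiable ℂ (thetaDen τ N η) := by
  have d := differentiable_theta3 hτ
  unfold thetaDen
  fun_prop

lemma thetaDen_neg_eta (τ : ℂ) (N : ℕ) (η z : ℂ) : thetaDen τ N (-η) z = thetaDen τ N η z := by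
  unfold thetaDen
  rw [← Finset.prod_range_reflect]
  refine Finset.prod_congr rfl fun k hk => ?_
  have hk' : k ≤ N + 1 := by have := Finset.mem_range.mp hk; omega
  rw [show N + 2 - 1 - k = N + 1 - k by omega, Nat.cast_sub hk']
  congr 1; push_cast; ring

lemma thetaDen_neg (τ : ℂ) (N : ℕ) (η z : ℂ) : thetaDen τ N η (-z) = thetaDen τ N η z := by
  rw [← thetaDen_neg_eta]
  unfold thetaDen
  refine Finset.prod_congr rfl fun k _ => ?_
  rw [← theta3_neg]; congr 1; ring

/-- The shifts at level `N + 1` are those at level `N` moved down by `η` together with a new top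
one, or, in `thetaDen_succ'`, moved up by `η` with a new bottom one. This gives the common
denominator in `metric_lowering`. -/
lemma thetaDen_succ (τ : ℂ) (N : ℕ) (η z : ℂ) :
    thetaDen τ (N + 1) η z = thetaDen τ N η (z - η) * theta3 τ (z + (N + 2) * η) := by
  unfold thetaDen
  rw [Finset.prod_range_succ]
  congr 1
  · refine Finset.prod_congr rfl fun k _ => ?_
    congr 1; push_cast; ring
  · congr 1; push_cast; ring

lemma thetaDen_succ' (τ : ℂ) (N : ℕ) (η z : ℂ) :
    thetaDen τ (N + 1) η z = thetaDen τ N η (z + η) * theta3 τ (z - (N + 2) * η) := by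
  unfold thetaDen
  rw [Finset.prod_range_succ']
  congr 1
  · refine Finset.prod_congr rfl fun k _ => ?_
    congr 1; push_cast; ring
  · congr 1; push_cast; ring

lemma thetaDen_add_one (τ : ℂ) (N : ℕ) (η z : ℂ) :
    thetaDen τ N η (z + 1) = thetaDen τ N η z := by
  unfold thetaDen
  refine Finset.prod_congr rfl fun k _ => ?_
  rw [add_right_comm, theta3_add_one]

lemma thetaDen_add_tau (τ : ℂ) (N : ℕ) (η z : ℂ) : thetaDen τ N η (z + τ) =
    exp (-(Real.pi * I * (N + 2) * (τ + 2 * z))) * thetaDen τ N η z := by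
  unfold thetaDen
  have h2 : ∀ k ∈ Finset.range (N + 2), theta3 τ (z + τ + (2 * (k : ℂ) - N - 1) * η) =
      exp (-(Real.pi * I * (τ + 2 * z)) - 2 * Real.pi * I * η * (2 * (k : ℂ) - N - 1)) *
        theta3 τ (z + (2 * (k : ℂ) - N - 1) * η) := by
    intro k _
    rw [add_right_comm, theta3_add_tau]
    congr 2; ring
  rw [Finset.prod_congr rfl h2, Finset.prod_mul_distrib, ← exp_sum,
      Finset.sum_sub_distrib, ← Finset.mul_sum, sum_range_coeff]
  congr 2
  simp only [Finset.sum_const, Finset.card_range, nsmul_eq_mul]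
  push_cast; ring

/-- Each zero has `|Re z| ≥ 1/2` and also `|Im z| ≥ Im τ / 2`, so excluding either one suffices. -/
lemma theta3_ne_zero {τ : ℂ} (hre : τ.re = 0) (hτ : 0 < τ.im) {z : ℂ}
    (h : |z.re| < 1 / 2 ∨ |z.im| < τ.im / 2) : theta3 τ z ≠ 0 := by
  intro h0
  obtain ⟨m, n, h1⟩ := exists_of_theta3_eq_zero hτ h0
  have key : ∀ k : ℤ, 1 / 2 ≤ |(1 / 2 + k : ℝ)| := by
    intro k
    rcases le_or_gt 0 k with hk | hk
    · have : (0 : ℝ) ≤ k := by exact_mod_cast hk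
      rw [abs_of_nonneg (by linarith)]; linarith
    · have : (k : ℝ) ≤ -1 := by exact_mod_cast (by omega : k ≤ -1)
      rw [abs_of_neg (by linarith)]; linarith
  rcases h with h | h
  · have hr : z.re = 1 / 2 + m := by rw [h1]; simp [hre]
    rw [hr] at h
    exact absurd h (not_lt.mpr (key m))
  · have hr : z.im = (1 / 2 + n) * τ.im := by rw [h1]; simp; ring
    rw [hr, abs_mul, abs_of_pos hτ] at h
    have := mul_le_mul_of_nonneg_right (key n) hτ.le
    linarith

/-- The domain on which `metric` is defined by a nonsingular integral. -/
def integralRange (τ : ℂ) (N : ℕ) : Set ℂ := realRange N ∪ imagRange τ N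

/-- For real `η` the first point is real and the second has real part of absolute value below `1/2`.
For imaginary `η` the roles of the axes are exchanged. -/
lemma theta3_ne_zero_of_mem {τ : ℂ} (hre : τ.re = 0) (hτ : 0 < τ.im) {N : ℕ} {η : ℂ}
    (hη : η ∈ integralRange τ N) {r : ℝ} (hr : |r| ≤ N + 1) (x : ℝ) :
    theta3 τ (2 * x + r * η) ≠ 0 ∧ theta3 τ (2 * (x * I) + r * η) ≠ 0 := by
  have hN : |r| * ‖η‖ ≤ (N + 1) * ‖η‖ := mul_le_mul_of_nonneg_right hr (norm_nonneg _)
  rcases hη with ⟨h1, h2⟩ | ⟨h1, h2⟩ <;> simp only [Int.cast_natCast] at h2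
  · constructor
    · refine theta3_ne_zero hre hτ (Or.inr ?_)
      simp [h1, hτ]
    · refine theta3_ne_zero hre hτ (Or.inl ?_)
      simp [abs_mul]
      have := abs_re_le_norm η
      have := mul_le_mul_of_nonneg_left this (abs_nonneg r)
      linarith
  · constructor
    · refine theta3_ne_zero hre hτ (Or.inr ?_)
      simp [abs_mul]
      have := abs_im_le_norm η
      have := mul_le_mul_of_nonneg_left this (abs_nonneg r)
      linarith
    · refine theta3_ne_zero hre hτ (Or.inl ?_)
      simp [h1]

lemma integralRange_succ_subset (τ : ℂ) (N : ℕ) :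
    integralRange τ (N + 1) ⊆ integralRange τ N := by
  rintro η (⟨h1, h2⟩ | ⟨h1, h2⟩)
  · refine Or.inl ⟨h1, ?_⟩
    push_cast at h2 ⊢
    nlinarith [norm_nonneg η]
  · refine Or.inr ⟨h1, ?_⟩
    push_cast at h2 ⊢
    nlinarith [norm_nonneg η]

lemma abs_coeff_le {N k : ℕ} (hk : k ∈ Finset.range (N + 2)) : |(2 * (k : ℝ) - N - 1)| ≤ N + 1 := by
  have hk' : (k : ℝ) ≤ N + 1 := by
    have := Finset.mem_range.mp hk
    exact_mod_cast (by omega : k ≤ N + 1)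
  have : (0 : ℝ) ≤ k := Nat.cast_nonneg k
  rw [abs_le]; constructor <;> linarith

lemma thetaDen_ne_zero {τ : ℂ} (hre : τ.re = 0) (hτ : 0 < τ.im) {N : ℕ} {η : ℂ}
    (hη : η ∈ integralRange τ N) (x : ℝ) :
    thetaDen τ N η (2 * x) ≠ 0 ∧ thetaDen τ N η (2 * (x * I)) ≠ 0 := by
  constructor <;> refine Finset.prod_ne_zero_iff.mpr fun k hk => ?_
  · simpa using (theta3_ne_zero_of_mem hre hτ hη (abs_coeff_le hk) x).1
  · simpa using (theta3_ne_zero_of_mem hre hτ hη (abs_coeff_le hk) x).2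

/-- The condition at level `N + 1` leaves room for one extra shift by up to `η`: no pole is crossed
while the contours move. -/
lemma thetaDen_translate_ne_zero {τ : ℂ} (hre : τ.re = 0) (hτ : 0 < τ.im) {N : ℕ} {η : ℂ}
    (hη : η ∈ integralRange τ (N + 1)) (x : ℝ) {r : ℝ} (hr : |r| ≤ 1) :
    thetaDen τ N η (2 * x + r * η) ≠ 0 ∧ thetaDen τ N η (2 * (x * I) + r * η) ≠ 0 := by
  constructor <;> refine Finset.prod_ne_zero_iff.mpr fun k hk => ?_
  · have := (theta3_ne_zero_of_mem hre hτ hη (r := r + (2 * (k : ℝ) - N - 1)) (by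
      push_cast; linarith [abs_add_le r (2 * (k : ℝ) - N - 1), abs_coeff_le hk]) x).1
    push_cast at this
    rwa [add_mul, ← add_assoc] at this
  · have := (theta3_ne_zero_of_mem hre hτ hη (r := r + (2 * (k : ℝ) - N - 1)) (by
      push_cast; linarith [abs_add_le r (2 * (k : ℝ) - N - 1), abs_coeff_le hk]) x).2
    push_cast at this
    rwa [add_mul, ← add_assoc] at this

/-! ### Adjointness of raising and lowering. -/

/-- The conjugate function `v ↦ conj (g (conj v))`. -/
def conjFun (g : ℂ → ℂ) (v : ℂ) : ℂ := (starRingEnd ℂ) (g ((starRingEnd ℂ) v))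

lemma conjFun_mem {τ : ℂ} (hre : τ.re = 0) {N : ℕ} {g : ℂ → ℂ} (hg : g ∈ thetaSpace τ N) :
    conjFun g ∈ thetaSpace τ N := by
  obtain ⟨h, h1, h2, h3⟩ := hg
  have hc : (starRingEnd ℂ) τ = -τ := by apply Complex.ext <;> simp [hre]
  refine ⟨fun v => ?_, fun v => ?_, fun v => ?_, fun v => ?_⟩
  · exact differentiableAt_conj_conj_iff.mpr (h _)
  · simp only [conjFun, map_add, map_one, h1]
  · have e := h2 ((starRingEnd ℂ) v - τ)
    rw [sub_add_cancel] at e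
    simp only [conjFun, map_add, hc, ← sub_eq_add_neg]
    rw [e, map_mul, ← exp_conj, ← mul_assoc, ← exp_add]
    simp only [map_neg, map_mul, map_add, map_sub, conj_I, hc, conj_conj, map_ofNat, conj_ofReal,
      map_natCast]
    rw [show -(2 * Real.pi * I * N * (2 * v + τ)) +
      -(2 * Real.pi * -I * N * (2 * (v - -τ) + -τ)) = 0 by ring]
    simp
  · simp only [conjFun, map_neg, h3]

lemma continuous_weight {τ : ℂ} (hre : τ.re = 0) (hτ : 0 < τ.im) {N : ℕ} {η : ℂ}
    (hη : η ∈ integralRange τ N) :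
    Continuous fun u => weight τ N η u ((starRingEnd ℂ) u) := by
  have hth := continuous_theta hτ
  have hD := (differentiable_thetaDen hτ N η).continuous
  have hcc := continuous_conj
  simp only [weight_eq, add_conj, sub_conj]
  have e2 : ∀ u : ℂ, ((2 * u.im : ℝ) : ℂ) * I = 2 * (u.im * I) := fun u => by push_cast; ring
  have e1 : ∀ u : ℂ, ((2 * u.re : ℝ) : ℂ) = 2 * (u.re : ℂ) := fun u => by push_cast; ring
  refine continuous_const.mul (Continuous.div (by fun_prop) (by fun_prop) fun u => ?_)
  rw [e1, e2]
  exact mul_ne_zero (thetaDen_ne_zero hre hτ hη _).1 (thetaDen_ne_zero hre hτ hη _).2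

/-- In terms of `w = x` and `z = i y` one has `u = w + z` and `conj u = w - z`. The integrand
becomes meromorphic in two independent variables, with a denominator that separates. -/
lemma metric_eq {τ : ℂ} (hre : τ.re = 0) (hτ : 0 < τ.im) {N : ℕ} {η : ℂ}
    (hη : η ∈ integralRange τ N) {f g : ℂ → ℂ} (hf : Continuous f) (hg : Continuous g) :
    metric τ N η f g = exp (Real.pi * I * τ / 2 * (N + 2)) * rectIntegral τ.im (fun x y =>
      f (x + y * I) * conjFun g (x - y * I) * (theta τ (2 * (x + y * I)) *
        theta τ (2 * (x - y * I))) / (thetaDen τ N η (2 * x) * thetaDen τ N η (2 * (y * I)))) := by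
  have e1 : ∀ u : ℂ, u + (starRingEnd ℂ) u = 2 * (u.re : ℂ) := fun u => by
    rw [add_conj]; push_cast; ring
  have e2 : ∀ u : ℂ, u - (starRingEnd ℂ) u = 2 * ((u.im : ℂ) * I) := fun u => by
    rw [sub_conj]; push_cast; ring
  rw [metric, integral_fundRect hτ, ← rectIntegral_const_mul]
  · refine rectIntegral_congr fun x y => ?_
    have hc : (starRingEnd ℂ) ((x : ℂ) + y * I) = x - y * I := by simp [sub_eq_add_neg]
    have hc' : (starRingEnd ℂ) ((x : ℂ) - y * I) = x + y * I := by simp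
    rw [weight_eq, e1, e2, hc, conjFun, hc']
    simp only [add_re, ofReal_re, mul_re, I_re, mul_zero, ofReal_im, I_im, mul_one, sub_self,
      add_zero, add_im, mul_im, zero_add]
    ring
  · exact (hf.mul (continuous_conj.comp hg)).mul (continuous_weight hre hτ hη)

lemma quotient_translate_eq {X₁ X₂ Y W a₁ a₂ b₁ b₂ c₁ c₂ d₁ d₂ E₁ E₂ : ℂ}
    (h₁ : E₁ = a₁ * c₁) (h₁' : E₁ = b₁ * d₁) (h₂ : E₂ = a₂ * c₂) (h₂' : E₂ = b₂ * d₂)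
    (hE₁ : E₁ ≠ 0) (hE₂ : E₂ ≠ 0)
    (h : X₁ * c₁ * c₂ - X₂ * d₁ * d₂ = Y) :
    X₁ * W / (a₁ * a₂) - X₂ * W / (b₁ * b₂) = Y * W / (E₁ * E₂) := by
  have ha₁ : a₁ ≠ 0 := fun h0 => hE₁ (by rw [h₁, h0, zero_mul])
  have ha₂ : a₂ ≠ 0 := fun h0 => hE₂ (by rw [h₂, h0, zero_mul])
  have hb₁ : b₁ ≠ 0 := fun h0 => hE₁ (by rw [h₁', h0, zero_mul])
  have hb₂ : b₂ ≠ 0 := fun h0 => hE₂ (by rw [h₂', h0, zero_mul])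
  have e₁ : X₁ * W / (a₁ * a₂) = X₁ * W * (c₁ * c₂) / (E₁ * E₂) := by
    rw [div_eq_div_iff (mul_ne_zero ha₁ ha₂) (mul_ne_zero hE₁ hE₂), h₁, h₂]; ring
  have e₂ : X₂ * W / (b₁ * b₂) = X₂ * W * (d₁ * d₂) / (E₁ * E₂) := by
    rw [div_eq_div_iff (mul_ne_zero hb₁ hb₂) (mul_ne_zero hE₁ hE₂), h₁', h₂']; ring
  rw [e₁, e₂, ← sub_div, ← h]; ring

/-- The function whose integral, after symmetrization, gives the pairing with a lowered function;
here `u = w + z` and `v = w - z`. -/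
def loweringIntegrand (τ : ℂ) (N : ℕ) (b η : ℂ) (f G : ℂ → ℂ) (w z : ℂ) : ℂ :=
  theta τ (w + z - (N + 1) * η + b) * theta τ (w + z - (N + 1) * η - b) * f (w + z + η) *
    (G (w - z) * theta τ (2 * (w - z)))

lemma loweringIntegrand_add_one {τ : ℂ} {N : ℕ} (b η : ℂ) {f G : ℂ → ℂ}
    (hf : f ∈ thetaSpace τ (N + 1)) (hG : G ∈ thetaSpace τ N) (w z : ℂ) :
    loweringIntegrand τ N b η f G (w + 1) z = loweringIntegrand τ N b η f G w z := by
  simp only [loweringIntegrand]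
  generalize ((N : ℂ) + 1) * η = κ
  rw [show w + 1 + z - κ + b = w + z - κ + b + 1 by ring,
    show w + 1 + z - κ - b = w + z - κ - b + 1 by ring,
    show w + 1 + z + η = w + z + η + 1 by ring, show w + 1 - z = w - z + 1 by ring,
    theta_two_mul_add_one, theta_add_one, theta_add_one, hf.2.1, hG.2.1, neg_mul_neg]

lemma loweringIntegrand_add_tau {τ : ℂ} {N : ℕ} (b η : ℂ) {f G : ℂ → ℂ}
    (hf : f ∈ thetaSpace τ (N + 1)) (hG : G ∈ thetaSpace τ N) (w z : ℂ) :
    loweringIntegrand τ N b η f G w (z + τ) =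
      exp (-(Real.pi * I * (N + 2) * (4 * τ + 8 * z))) * loweringIntegrand τ N b η f G w z := by
  have h1 : G (w - z) * theta τ (2 * (w - z)) =
      exp (-(2 * Real.pi * I * N * (2 * (w - (z + τ)) + τ)) +
        -(2 * Real.pi * I * 2 * (2 * (w - (z + τ)) + τ))) *
      (G (w - (z + τ)) * theta τ (2 * (w - (z + τ)))) := by
    rw [show w - z = w - (z + τ) + τ by ring, hG.2.2.1, theta_two_mul_add_tau, exp_add]
    ring
  have h2 : G (w - (z + τ)) * theta τ (2 * (w - (z + τ))) =
      exp (-(-(2 * Real.pi * I * N * (2 * (w - (z + τ)) + τ)) +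
        -(2 * Real.pi * I * 2 * (2 * (w - (z + τ)) + τ)))) *
      (G (w - z) * theta τ (2 * (w - z))) := by
    rw [h1, ← mul_assoc, ← exp_add, neg_add_cancel, exp_zero, one_mul]
  simp only [loweringIntegrand]
  rw [h2, show w + (z + τ) - (N + 1) * η + b = w + z - (N + 1) * η + b + τ by ring,
    show w + (z + τ) - (N + 1) * η - b = w + z - (N + 1) * η - b + τ by ring,
    show w + (z + τ) + η = w + z + η + τ by ring, theta_add_tau, theta_add_tau, hf.2.2.1]
  rw [show -(Real.pi * I * (N + 2) * (4 * τ + 8 * z)) =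
    -(Real.pi * I * (τ + 2 * (w + z - (N + 1) * η + b))) +
    -(Real.pi * I * (τ + 2 * (w + z - (N + 1) * η - b))) +
    -(2 * Real.pi * I * (N + 1 : ℕ) * (2 * (w + z + η) + τ)) +
    -(-(2 * Real.pi * I * N * (2 * (w - (z + τ)) + τ)) +
        -(2 * Real.pi * I * 2 * (2 * (w - (z + τ)) + τ))) by push_cast; ring, exp_add, exp_add,
        exp_add]
  ring

lemma conjFun_raising {τ : ℂ} (hre : τ.re = 0) (hτ : 0 < τ.im) (N : ℕ) (b : ℂ)
    (g : thetaSpace τ N) (v : ℂ) : conjFun (raising hτ N ((starRingEnd ℂ) b) g).1 v =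
      conjFun g.1 v * (theta3 τ (b + v) * theta3 τ (b - v)) := by
  simp only [conjFun, raising_apply, theta3Pair, map_mul, conj_theta3 hre, map_add, map_sub,
    conj_conj]
  rw [add_comm v b, ← theta3_neg τ (v - b), neg_sub]

lemma thetaDen_two_mul_add_one (τ : ℂ) (N : ℕ) (η w : ℂ) :
    thetaDen τ N η (2 * (w + 1)) = thetaDen τ N η (2 * w) := by
  rw [show 2 * (w + 1) = 2 * w + 1 + 1 by ring, thetaDen_add_one, thetaDen_add_one]

lemma thetaDen_two_mul_add_tau (τ : ℂ) (N : ℕ) (η z : ℂ) : thetaDen τ N η (2 * (z + τ)) =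
    exp (-(Real.pi * I * (N + 2) * (4 * τ + 8 * z))) * thetaDen τ N η (2 * z) := by
  rw [show 2 * (z + τ) = 2 * z + τ + τ by ring, thetaDen_add_tau, thetaDen_add_tau, ← mul_assoc,
    ← exp_add]
  congr 2; ring

/-- By periodicity the reflection `(x, y) ↦ (-x, -y)` preserves the integral. It acts on the real
parameters, so after a shift the reflected point is `-x + δ`, not `-(x + δ)`. -/
lemma rectIntegral_symmetrize {T : ℝ} {τ : ℂ} (hT : τ = T * I) {Q : ℂ → ℂ → ℂ}
    (h1 : ∀ w z, Q (w + 1) z = Q w z) (h2 : ∀ w z, Q w (z + τ) = Q w z) (δ : ℂ)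
    (hc : Continuous (fun p : ℝ × ℝ => Q (p.1 + δ) (p.2 * I + δ))) :
    rectIntegral T (fun x y => Q (x + δ) (y * I + δ) + Q (-x + δ) (-(y * I) + δ)) =
      2 * rectIntegral T (fun x y => Q (x + δ) (y * I + δ)) := by
  have h := rectIntegral_reflect (T := T) (Q := fun x y => Q (x + δ) (y * I + δ))
    (fun x y => by
      push_cast; rw [add_right_comm, h1])
    (fun x y => by
      push_cast; rw [add_mul, ← hT, add_right_comm, h2])
  rw [two_mul]
  nth_rewrite 2 [← h]
  rw [← rectIntegral_add]
  · refine rectIntegral_congr fun x y => ?_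
    push_cast; ring_nf
  · exact hc
  · exact hc.comp (by fun_prop : Continuous fun p : ℝ × ℝ => (-p.1, -p.2))

/-- The symmetrized form of `rectIntegral_translate`. -/
lemma rectIntegral_translate_symm {T : ℝ} {τ δ : ℂ} (hT : τ = T * I) {P : ℂ → ℂ → ℂ} {D : ℂ → ℂ}
    (hP : Differentiable ℂ P.uncurry) (hD : Differentiable ℂ D)
    (hx : ∀ x q : ℝ, q ∈ Set.Icc (0 : ℝ) 1 → D (2 * (x + q * δ)) ≠ 0)
    (hy : ∀ y q : ℝ, q ∈ Set.Icc (0 : ℝ) 1 → D (2 * (y * I + q * δ)) ≠ 0)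
    (h1 : ∀ w z, P (w + 1) z / (D (2 * (w + 1)) * D (2 * z)) = P w z / (D (2 * w) * D (2 * z)))
    (h2 : ∀ w z, P w (z + τ) / (D (2 * w) * D (2 * (z + τ))) = P w z / (D (2 * w) * D (2 * z))) :
    rectIntegral T (fun x y => P x (y * I) / (D (2 * x) * D (2 * (y * I))) +
      P (-x) (-(y * I)) / (D (2 * (-x)) * D (2 * (-(y * I))))) =
    rectIntegral T (fun x y => P (x + δ) (y * I + δ) / (D (2 * (x + δ)) * D (2 * (y * I + δ))) +
      P (-x + δ) (-(y * I) + δ) / (D (2 * (-x + δ)) * D (2 * (-(y * I) + δ)))) := by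
  have hPc := hP.continuous
  have hDc := hD.continuous
  have c : ∀ d : ℂ, (∀ x : ℝ, D (2 * (x + d)) ≠ 0) → (∀ y : ℝ, D (2 * (y * I + d)) ≠ 0) →
      Continuous (fun p : ℝ × ℝ => P (p.1 + d) (p.2 * I + d) /
        (D (2 * (p.1 + d)) * D (2 * (p.2 * I + d)))) := by
    intro d h h'
    refine Continuous.div ?_ (by fun_prop) fun p => mul_ne_zero (h _) (h' _)
    exact hPc.comp (by fun_prop : Continuous fun p : ℝ × ℝ => ((p.1 : ℂ) + d, (p.2 : ℂ) * I + d))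
  have e0 := rectIntegral_symmetrize hT (Q := fun w z => P w z / (D (2 * w) * D (2 * z))) h1 h2 0
    (c 0 (fun x => by simpa using hx x 0 (by simp)) fun y => by simpa using hy y 0 (by simp))
  have e1 := rectIntegral_symmetrize hT (Q := fun w z => P w z / (D (2 * w) * D (2 * z))) h1 h2 δ
    (c δ (fun x => by simpa using hx x 1 (by simp)) fun y => by simpa using hy y 1 (by simp))
  simp only [add_zero] at e0
  rw [e0, e1, rectIntegral_translate hT hP hD hx hy h1 h2]

lemma loweringIntegrand_div_add_one {τ : ℂ} {N : ℕ} (b η : ℂ) {f G : ℂ → ℂ}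
    (hf : f ∈ thetaSpace τ (N + 1)) (hG : G ∈ thetaSpace τ N) (w z : ℂ) :
    loweringIntegrand τ N b η f G (w + 1) z /
      (thetaDen τ N η (2 * (w + 1)) * thetaDen τ N η (2 * z)) =
    loweringIntegrand τ N b η f G w z / (thetaDen τ N η (2 * w) * thetaDen τ N η (2 * z)) := by
  rw [loweringIntegrand_add_one b η hf hG, thetaDen_two_mul_add_one]

lemma loweringIntegrand_div_add_tau {τ : ℂ} {N : ℕ} (b η : ℂ) {f G : ℂ → ℂ}
    (hf : f ∈ thetaSpace τ (N + 1)) (hG : G ∈ thetaSpace τ N) (w z : ℂ) :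
    loweringIntegrand τ N b η f G w (z + τ) /
      (thetaDen τ N η (2 * w) * thetaDen τ N η (2 * (z + τ))) =
    loweringIntegrand τ N b η f G w z / (thetaDen τ N η (2 * w) * thetaDen τ N η (2 * z)) := by
  rw [loweringIntegrand_add_tau b η hf hG, thetaDen_two_mul_add_tau,
    mul_left_comm (thetaDen τ N η (2 * w)), mul_div_mul_left _ _ (exp_ne_zero _)]

/-- The lowering operator is adjoint to the raising operator. -/
theorem metric_lowering {τ : ℂ} (hre : τ.re = 0) (hτ : 0 < τ.im) {N : ℕ} {η : ℂ}
    (hη : η ∈ integralRange τ (N + 1)) (b : ℂ) (f : thetaSpace τ (N + 1)) (g : thetaSpace τ N) :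
    metric τ N η (lowering hτ N b η f).1 g.1 =
      -exp (-(Real.pi * I * τ / 2)) * theta τ (2 * ((N + 2) * η)) *
        metric τ (N + 1) η f.1 (raising hτ N ((starRingEnd ℂ) b) g).1 := by
  have hη' := integralRange_succ_subset τ N hη
  have hG := conjFun_mem hre g.2
  have hGd := hG.1
  have hfd := f.2.1
  have hth := differentiable_theta hτ
  have hTI : τ = τ.im * I := by apply Complex.ext <;> simp [hre]
  have hP : Differentiable ℂ (loweringIntegrand τ N b η f.1 (conjFun g.1)).uncurry := by
    unfold loweringIntegrand Function.uncurry; fun_prop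
  have hxq : ∀ x q : ℝ, q ∈ Set.Icc (0 : ℝ) 1 →
      thetaDen τ N η (2 * (x + q * (-η / 2))) ≠ 0 := fun x q hq => by
    have := (thetaDen_translate_ne_zero hre hτ hη x (r := -q) (by
      rw [abs_neg, abs_of_nonneg hq.1]; exact hq.2)).1
    push_cast at this
    rwa [show 2 * ((x : ℂ) + q * (-η / 2)) = 2 * x + -q * η by ring]
  have hyq : ∀ y q : ℝ, q ∈ Set.Icc (0 : ℝ) 1 →
      thetaDen τ N η (2 * (y * I + q * (-η / 2))) ≠ 0 := fun y q hq => by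
    have := (thetaDen_translate_ne_zero hre hτ hη y (r := -q) (by
      rw [abs_neg, abs_of_nonneg hq.1]; exact hq.2)).2
    push_cast at this
    rwa [show 2 * ((y : ℂ) * I + q * (-η / 2)) = 2 * (y * I) + -q * η by ring]
  -- Moving both `w` and `z` by `-η/2` replaces `u` by `u - η` and fixes `v`, so `f (u + η)` becomes
  -- `f u`.
  have mid := rectIntegral_translate_symm hTI hP (differentiable_thetaDen hτ N η) hxq hyq
    (loweringIntegrand_div_add_one b η f.2 hG) (loweringIntegrand_div_add_tau b η f.2 hG)
  have hf3 := f.2.2.2.2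
  have hG3 := hG.2.2.2
  rw [metric_eq hre hτ hη' (lowering hτ N b η f).2.1.continuous g.2.1.continuous,
    metric_eq hre hτ hη hfd.continuous (raising hτ N _ g).2.1.continuous]
  -- The weight contains `θ(2u)`, which clears the denominator of `lowering`. The two terms of its
  -- numerator then correspond under `(u, v) ↦ (-u, -v)`.
  have left : rectIntegral τ.im (fun x y => (lowering hτ N b η f).1 (x + y * I) *
      conjFun g.1 (x - y * I) * (theta τ (2 * (x + y * I)) * theta τ (2 * (x - y * I))) /
      (thetaDen τ N η (2 * x) * thetaDen τ N η (2 * (y * I)))) =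
      rectIntegral τ.im (fun x y =>
        loweringIntegrand τ N b η f.1 (conjFun g.1) x (y * I) /
          (thetaDen τ N η (2 * x) * thetaDen τ N η (2 * (y * I))) +
        loweringIntegrand τ N b η f.1 (conjFun g.1) (-x) (-(y * I)) /
          (thetaDen τ N η (2 * (-x)) * thetaDen τ N η (2 * (-(y * I))))) := by
    refine rectIntegral_congr fun x y => ?_
    have h1 := lowering_mul hτ N b η f (x + y * I)
    rw [mul_neg, mul_neg, thetaDen_neg, thetaDen_neg, ← add_div]
    congr 1
    rw [mul_mul_mul_comm, h1, loweringNum]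
    simp only [loweringIntegrand]
    generalize ((N : ℂ) + 1) * η = κ
    rw [show -(x : ℂ) + -(y * I) - κ + b = -(x + y * I + κ - b) by ring,
      show -(x : ℂ) + -(y * I) - κ - b = -(x + y * I + κ + b) by ring,
      show -(x : ℂ) + -(y * I) + η = -(x + y * I - η) by ring,
      show -(x : ℂ) - -(y * I) = -(x - y * I) by ring, theta_two_mul_neg, theta_neg, theta_neg,
      hf3, hG3]
    ring
  have right : rectIntegral τ.im (fun x y =>
        loweringIntegrand τ N b η f.1 (conjFun g.1) (x + -η / 2) (y * I + -η / 2) /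
          (thetaDen τ N η (2 * (x + -η / 2)) * thetaDen τ N η (2 * (y * I + -η / 2))) +
        loweringIntegrand τ N b η f.1 (conjFun g.1) (-x + -η / 2) (-(y * I) + -η / 2) /
          (thetaDen τ N η (2 * (-x + -η / 2)) * thetaDen τ N η (2 * (-(y * I) + -η / 2)))) =
      -theta τ (2 * ((N + 2) * η)) *
      rectIntegral τ.im (fun x y => f.1 (x + y * I) *
        conjFun (raising hτ N ((starRingEnd ℂ) b) g).1 (x - y * I) *
        (theta τ (2 * (x + y * I)) * theta τ (2 * (x - y * I))) /
        (thetaDen τ (N + 1) η (2 * x) * thetaDen τ (N + 1) η (2 * (y * I)))) := by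
    rw [← rectIntegral_const_mul]
    refine rectIntegral_congr fun x y => ?_
    obtain ⟨hE1, -⟩ := thetaDen_ne_zero hre hτ hη x
    obtain ⟨-, hE2⟩ := thetaDen_ne_zero hre hτ hη y
    rw [conjFun_raising hre]
    -- Over the denominator of level `N + 1` the two shifted terms combine by the addition formula:
    -- it yields `θ(2u)`, the factor `θ(2(N+2)η)` and the pair `ϑ₃(b ± v)` that multiplies the
    -- conjugate of `g`.
    have hadd := theta_addition hτ (x + y * I) ((N + 2) * η) b (x - y * I)
    rw [show (x : ℂ) + y * I + (N + 2) * η + (x - y * I) = 2 * x + (N + 2) * η by ring,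
      show (x : ℂ) + y * I + (N + 2) * η - (x - y * I) = 2 * (y * I) + (N + 2) * η by ring,
      show (x : ℂ) + y * I - (N + 2) * η + (x - y * I) = 2 * x - (N + 2) * η by ring,
      show (x : ℂ) + y * I - (N + 2) * η - (x - y * I) = 2 * (y * I) - (N + 2) * η by ring] at hadd
    have hquot := quotient_translate_eq (W := f.1 (x + y * I) * (conjFun g.1 (x - y * I) *
        theta τ (2 * (x - y * I)))) (thetaDen_succ τ N η (2 * x)) (thetaDen_succ' τ N η (2 * x))
      (thetaDen_succ τ N η (2 * (y * I))) (thetaDen_succ' τ N η (2 * (y * I))) hE1 hE2 hadd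
    simp only [loweringIntegrand]
    rw [show 2 * ((x : ℂ) + -η / 2) = 2 * x - η by ring,
      show 2 * ((y : ℂ) * I + -η / 2) = 2 * (y * I) - η by ring,
      show 2 * (-(x : ℂ) + -η / 2) = -(2 * x + η) by ring,
      show 2 * (-((y : ℂ) * I) + -η / 2) = -(2 * (y * I) + η) by ring, thetaDen_neg,
      thetaDen_neg,
      show (x : ℂ) + -η / 2 - (y * I + -η / 2) = x - y * I by ring,
      show (x : ℂ) + -η / 2 + (y * I + -η / 2) - (N + 1) * η = x + y * I - (N + 2) * η by ring,
      show (x : ℂ) + -η / 2 + (y * I + -η / 2) + η = x + y * I by ring,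
      show -(x : ℂ) + -η / 2 - (-(y * I) + -η / 2) = -(x - y * I) by ring,
      show -(x : ℂ) + -η / 2 + (-(y * I) + -η / 2) - (N + 1) * η + b =
        -(x + y * I + (N + 2) * η - b) by ring,
      show -(x : ℂ) + -η / 2 + (-(y * I) + -η / 2) - (N + 1) * η - b =
        -(x + y * I + (N + 2) * η + b) by ring,
      show -(x : ℂ) + -η / 2 + (-(y * I) + -η / 2) + η = -(x + y * I) by ring,
      theta_two_mul_neg, theta_neg, theta_neg, hf3, hG3]
    refine Eq.trans ?_ (hquot.trans ?_)
    · ring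
    · ring
  rw [left, mid, right, show Real.pi * I * τ / 2 * (((N + 1 : ℕ) : ℂ) + 2) =
    Real.pi * I * τ / 2 * (N + 2) + Real.pi * I * τ / 2 by push_cast; ring, exp_add, exp_neg]
  have := exp_ne_zero (Real.pi * I * τ / 2)
  field_simp

/-! ### The case `N = 0`. -/

lemma logDeriv_theta3_add_one (τ z : ℂ) :
    logDeriv (theta3 τ) (z + 1) = logDeriv (theta3 τ) z := by
  have h : (fun w => theta3 τ (w + 1)) = theta3 τ := funext (theta3_add_one τ)
  rw [logDeriv_apply, logDeriv_apply, theta3_add_one, ← deriv_comp_add_const, h]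

lemma logDeriv_theta3_add_tau {τ z : ℂ} (hτ : 0 < τ.im) (hz : theta3 τ z ≠ 0) :
    logDeriv (theta3 τ) (z + τ) = logDeriv (theta3 τ) z - 2 * Real.pi * I := by
  have h : (fun w => theta3 τ (w + τ)) =
    fun w => exp (-(Real.pi * I * (τ + 2 * w))) * theta3 τ w := funext (theta3_add_tau τ)
  have hE : HasDerivAt (fun w => exp (-(Real.pi * I * (τ + 2 * w))))
      (exp (-(Real.pi * I * (τ + 2 * z))) * -(Real.pi * I * (2 * 1))) z :=
    (((((hasDerivAt_id z).const_mul 2).const_add τ).const_mul (Real.pi * I)).neg).cexp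
  have hd := (hE.mul (differentiable_theta3 hτ z).hasDerivAt).deriv
  have hd' : deriv (fun w => exp (-(Real.pi * I * (τ + 2 * w))) * theta3 τ w) z = _ := hd
  have := exp_ne_zero (-(Real.pi * I * (τ + 2 * z)))
  rw [logDeriv_apply, logDeriv_apply, ← deriv_comp_add_const, h, hd', theta3_add_tau]
  field_simp
  ring

/-- Evaluation of the metric on the one-dimensional space `Θ_0`. -/
theorem metric_zero {τ : ℂ} (hre : τ.re = 0) (hτ : 0 < τ.im) {η : ℂ}
    (hη : η ∈ integralRange τ 0) (f g : thetaSpace τ 0) :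
    deriv (theta τ) 0 * theta τ (2 * η) * metric τ 0 η f.1 g.1 =
      exp (Real.pi * I * τ) * (4 * Real.pi * η) * (f.1 0 * (starRingEnd ℂ) (g.1 0)) := by
  have d3 := differentiable_theta3 hτ
  have c3 := continuous_theta3 hτ
  have hTI : τ = τ.im * I := by apply Complex.ext <;> simp [hre]
  set Z : ℂ → ℂ := fun w => logDeriv (theta3 τ) (2 * w) with hZ
  have hne : ∀ x q : ℝ, q ∈ Set.Icc (0 : ℝ) 1 → theta3 τ (2 * (-η / 2 + x + q * η)) ≠ 0 ∧
      theta3 τ (2 * (-η / 2 + x * I + q * η)) ≠ 0 := by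
    intro x q hq
    have h := theta3_ne_zero_of_mem hre hτ hη (r := 2 * q - 1) (by
      rw [abs_le]; constructor <;> push_cast <;> linarith [hq.1, hq.2]) x
    push_cast at h
    constructor
    · rw [show 2 * (-η / 2 + x + q * η) = 2 * x + (2 * q - 1) * η by ring]; exact h.1
    · rw [show 2 * (-η / 2 + x * I + q * η) = 2 * (x * I) + (2 * q - 1) * η by ring]; exact h.2
  have hS : IsOpen {w | theta3 τ (2 * w) ≠ 0} := isOpen_ne_fun (by fun_prop) continuous_const
  have hZd : DifferentiableOn ℂ Z {w | theta3 τ (2 * w) ≠ 0} := by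
    intro w hw
    have h1 : DifferentiableAt ℂ (logDeriv (theta3 τ)) (2 * w) := by
      unfold logDeriv
      exact (d3.deriv _).div (d3 _) hw
    exact (h1.comp w (by fun_prop : DifferentiableAt ℂ (fun w => 2 * w) w)).differentiableWithinAt
  -- `Z` is periodic along the real axis but changes by `-4πi` under `w ↦ w + τ`, since its argument
  -- `2w` moves by two periods. Only the vertical integral contributes.
  have hx := integral_translate hS hZd (z₀ := -η / 2) (e := 1) (δ := η) (c := 0) (T := 1)
    (fun x q hq => by rw [mul_one]; exact (hne x q hq).1) (fun q hq => by
      simp only [hZ]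
      rw [show 2 * (-η / 2 + (1 : ℝ) * 1 + q * η) = 2 * (-η / 2 + q * η) + 1 + 1 by
        push_cast; ring, logDeriv_theta3_add_one, logDeriv_theta3_add_one, add_zero])
  have hy := integral_translate hS hZd (z₀ := -η / 2) (e := I) (δ := η)
    (c := -(4 * Real.pi * I)) (T := τ.im)
    (fun x q hq => (hne x q hq).2) (fun q hq => by
      simp only [hZ]
      have h0 := (hne 0 q hq).1
      rw [ofReal_zero, add_zero] at h0
      rw [← hTI, show 2 * (-η / 2 + τ + q * η) = 2 * (-η / 2 + q * η) + τ + τ by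
        ring, logDeriv_theta3_add_tau hτ, logDeriv_theta3_add_tau hτ h0]
      · ring
      · rw [theta3_add_tau]; exact mul_ne_zero (exp_ne_zero _) h0)
  simp only [one_mul, zero_mul, mul_one] at hx
  have hy' : (∫ y in (0 : ℝ)..τ.im, Z (-η / 2 + y * I + η)) -
      ∫ y in (0 : ℝ)..τ.im, Z (-η / 2 + y * I) = -(4 * Real.pi * η) :=
    mul_left_cancel₀ I_ne_zero (by rw [hy]; ring)
  have hcont : ∀ (q : ℝ), q ∈ Set.Icc (0 : ℝ) 1 →
      Continuous (fun x : ℝ => Z (-η / 2 + x + q * η)) ∧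
      Continuous (fun x : ℝ => Z (-η / 2 + x * I + q * η)) := fun q hq =>
    ⟨hZd.continuousOn.comp_continuous (by fun_prop) fun x => (hne x q hq).1,
      hZd.continuousOn.comp_continuous (by fun_prop) fun x => (hne x q hq).2⟩
  have cx0 := (hcont 0 (by simp)).1
  have cx1 := (hcont 1 (by simp)).1
  have cy0 := (hcont 0 (by simp)).2
  have cy1 := (hcont 1 (by simp)).2
  simp only [ofReal_zero, zero_mul, add_zero, ofReal_one, one_mul] at cx0 cx1 cy0 cy1
  have hD : ∀ z, thetaDen τ 0 η z = theta3 τ (z - η) * theta3 τ (z + η) := by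
    intro z
    simp [thetaDen, Finset.prod_range_succ, sub_eq_add_neg]
    norm_num
  have key : rectIntegral τ.im (fun x y => deriv (theta τ) 0 * theta τ (2 * η) *
      (theta τ (2 * (x + y * I)) * theta τ (2 * (x - y * I)) /
        (thetaDen τ 0 η (2 * x) * thetaDen τ 0 η (2 * (y * I))))) = 4 * Real.pi * η := by
    -- The infinitesimal addition formula splits the integrand into a function of `x` minus a
    -- function of `y`.
    have e1 : ∀ x y : ℝ, deriv (theta τ) 0 * theta τ (2 * η) *
      (theta τ (2 * (x + y * I)) * theta τ (2 * (x - y * I)) /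
        (thetaDen τ 0 η (2 * x) * thetaDen τ 0 η (2 * (y * I)))) =
        (Z (-η / 2 + x + η) - Z (-η / 2 + x)) -
          (Z (-η / 2 + y * I + η) - Z (-η / 2 + y * I)) := by
      intro x y
      have a1 := (hne x 0 (by simp)).1
      have a2 := (hne x 1 (by simp)).1
      have a3 := (hne y 0 (by simp)).2
      have a4 := (hne y 1 (by simp)).2
      simp only [ofReal_zero, zero_mul, add_zero, ofReal_one, one_mul] at a1 a2 a3 a4
      simp only [hZ]
      rw [show 2 * (-η / 2 + x) = 2 * x - η by ring] at a1 ⊢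
      rw [show 2 * (-η / 2 + x + η) = 2 * x + η by ring] at a2 ⊢
      rw [show 2 * (-η / 2 + y * I) = 2 * (y * I) - η by ring] at a3 ⊢
      rw [show 2 * (-η / 2 + y * I + η) = 2 * (y * I) + η by ring] at a4 ⊢
      rw [logDeriv_theta3_addition hτ a2 a1 a4 a3, hD, hD, mul_add, mul_sub]
      congr 2
      ring
    rw [rectIntegral_congr e1, rectIntegral]
    have e2 : ∀ x : ℝ, ∫ y in (0 : ℝ)..τ.im, ((Z (-η / 2 + x + η) - Z (-η / 2 + x)) -
          (Z (-η / 2 + y * I + η) - Z (-η / 2 + y * I))) =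
          τ.im * (Z (-η / 2 + x + η) - Z (-η / 2 + x)) + 4 * Real.pi * η := by
      intro x
      have iy : IntervalIntegrable (fun y : ℝ => Z (-η / 2 + y * I + η) - Z (-η / 2 + y * I))
        volume 0 τ.im := (cy1.sub cy0).intervalIntegrable _ _
      rw [intervalIntegral.integral_sub (continuous_const.intervalIntegrable _ _)
        iy, intervalIntegral.integral_sub
        (cy1.intervalIntegrable _ _) (cy0.intervalIntegrable _ _), hy',
        intervalIntegral.integral_const]
      simp
    simp only [e2]
    have ix : IntervalIntegrable (fun x : ℝ => Z (-η / 2 + x + η) - Z (-η / 2 + x))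
      volume 0 1 := (cx1.sub cx0).intervalIntegrable _ _
    rw [intervalIntegral.integral_add (ix.const_mul _)
      (continuous_const.intervalIntegrable _ _), intervalIntegral.integral_const_mul,
      intervalIntegral.integral_sub (cx1.intervalIntegrable _ _) (cx0.intervalIntegrable _ _), hx]
    simp
  rw [rectIntegral_const_mul] at key
  have e3 : ∀ x y : ℝ, f.1 (x + y * I) * conjFun g.1 (x - y * I) * (theta τ (2 * (x + y * I)) *
      theta τ (2 * (x - y * I))) / (thetaDen τ 0 η (2 * x) * thetaDen τ 0 η (2 * (y * I))) =
      f.1 0 * (starRingEnd ℂ) (g.1 0) * (theta τ (2 * (x + y * I)) * theta τ (2 * (x - y * I)) /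
        (thetaDen τ 0 η (2 * x) * thetaDen τ 0 η (2 * (y * I)))) := by
    intro x y
    rw [thetaSpace_zero_const hτ f.2 (x + y * I) 0,
      thetaSpace_zero_const hτ (conjFun_mem hre g.2) (x - y * I) 0]
    simp only [conjFun, map_zero]
    ring
  rw [metric_eq hre hτ hη f.2.1.continuous g.2.1.continuous, rectIntegral_congr e3,
    rectIntegral_const_mul, ← key,
    show Real.pi * I * τ / 2 * ((0 : ℕ) + 2) = Real.pi * I * τ by push_cast; ring]
  ring

/-! ### The region of continuation. -/

/-- A connected neighbourhood of `ℝ_{N-1} ∪ 𝕀_{N-1}`. -/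
def contRegion (τ : ℂ) (N : ℕ) : Set ℂ :=
  {η | 2 * (N : ℝ) * |η.re| < 1 ∧ 2 * (N : ℝ) * |η.im| < τ.im}

/-- The set `ℝ_{N-1} ∪ 𝕀_{N-1}`. -/
def contRange (τ : ℂ) (N : ℕ) : Set ℂ := realRange ((N : ℤ) - 1) ∪ imagRange τ ((N : ℤ) - 1)

lemma mem_contRange {τ η : ℂ} {N : ℕ} : η ∈ contRange τ N ↔
    (η.im = 0 ∧ 2 * (N : ℝ) * ‖η‖ < 1) ∨ (η.re = 0 ∧ 2 * (N : ℝ) * ‖η‖ < τ.im) := by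
  simp [contRange, realRange, imagRange]

lemma integralRange_eq_contRange (τ : ℂ) (N : ℕ) : integralRange τ N = contRange τ (N + 1) := by
  simp [integralRange, contRange]

lemma contRange_succ_subset (τ : ℂ) (N : ℕ) : contRange τ (N + 1) ⊆ contRange τ N := by
  intro η h
  rw [mem_contRange] at h ⊢
  push_cast at h
  rcases h with ⟨h1, h2⟩ | ⟨h1, h2⟩
  · exact Or.inl ⟨h1, by nlinarith [norm_nonneg η]⟩
  · exact Or.inr ⟨h1, by nlinarith [norm_nonneg η]⟩

lemma contRange_subset_contRegion {τ : ℂ} (hτ : 0 < τ.im) (N : ℕ) :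
    contRange τ N ⊆ contRegion τ N := by
  intro η h
  rw [mem_contRange] at h
  have hN : 0 ≤ 2 * (N : ℝ) := by positivity
  rcases h with ⟨h1, h2⟩ | ⟨h1, h2⟩
  · exact ⟨(mul_le_mul_of_nonneg_left (abs_re_le_norm η) hN).trans_lt h2, by simp [h1, hτ]⟩
  · exact ⟨by simp [h1], (mul_le_mul_of_nonneg_left (abs_im_le_norm η) hN).trans_lt h2⟩

lemma integralRange_subset_contRegion {τ : ℂ} (hτ : 0 < τ.im) (N : ℕ) :
    integralRange τ N ⊆ contRegion τ N := by
  rw [integralRange_eq_contRange]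
  exact (contRange_succ_subset τ N).trans (contRange_subset_contRegion hτ N)

lemma contRegion_succ_subset (τ : ℂ) (N : ℕ) : contRegion τ (N + 1) ⊆ contRegion τ N := by
  rintro η ⟨h1, h2⟩
  push_cast at h1 h2
  exact ⟨by nlinarith [abs_nonneg η.re], by nlinarith [abs_nonneg η.im]⟩

lemma isOpen_contRegion (τ : ℂ) (N : ℕ) : IsOpen (contRegion τ N) := by
  exact (isOpen_lt (continuous_const.mul continuous_re.abs) continuous_const).inter
    (isOpen_lt (continuous_const.mul continuous_im.abs) continuous_const)

lemma zero_mem_contRegion {τ : ℂ} (hτ : 0 < τ.im) (N : ℕ) : (0 : ℂ) ∈ contRegion τ N :=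
  ⟨by simp, by simpa using hτ⟩

lemma isConnected_contRegion {τ : ℂ} (hτ : 0 < τ.im) (N : ℕ) : IsConnected (contRegion τ N) := by
  refine ⟨⟨0, zero_mem_contRegion hτ N⟩, Convex.isPreconnected ?_⟩
  have hc : ∀ r : ℝ, Convex ℝ {x : ℝ | 2 * (N : ℝ) * |x| < r} := by
    intro r
    have := (convex_Ioo (-r) r).smul_preimage (𝕜 := ℝ) (2 * (N : ℝ))
    have e : (fun z : ℝ => (2 * (N : ℝ)) • z) ⁻¹' Set.Ioo (-r) r =
        {x : ℝ | 2 * (N : ℝ) * |x| < r} := by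
      ext x
      change -r < 2 * (N : ℝ) * x ∧ 2 * (N : ℝ) * x < r ↔ 2 * (N : ℝ) * |x| < r
      rw [← abs_lt, abs_mul, abs_of_nonneg (by positivity : (0 : ℝ) ≤ 2 * N)]
    rwa [e] at this
  exact ((hc 1).linear_preimage reLm).inter ((hc τ.im).linear_preimage imLm)

lemma zero_mem_integralRange {τ : ℂ} (N : ℕ) : (0 : ℂ) ∈ integralRange τ N :=
  Or.inl ⟨by simp, by simp⟩

lemma frequently_mem_integralRange (τ : ℂ) (N : ℕ) :
    ∃ᶠ η in 𝓝[≠] (0 : ℂ), η ∈ integralRange τ N := by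
  have ht : Tendsto (fun t : ℝ => (t : ℂ)) (𝓝[≠] 0) (𝓝[≠] 0) := by
    refine tendsto_nhdsWithin_iff.mpr ⟨?_, ?_⟩
    · exact (continuous_ofReal.tendsto' 0 0 (by simp)).mono_left nhdsWithin_le_nhds
    · filter_upwards [self_mem_nhdsWithin] with t h
      simpa using h
  refine ht.frequently (Eventually.frequently ?_)
  have h : Tendsto (fun t : ℝ => 2 * ((N : ℝ) + 1) * ‖(t : ℂ)‖) (𝓝 0) (𝓝 0) :=
    Continuous.tendsto' (by fun_prop) _ _ (by simp)
  filter_upwards [nhdsWithin_le_nhds (h.eventually_lt_const zero_lt_one)] with t h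
  exact Or.inl ⟨by simp, by simpa using h⟩

/-- Two holomorphic functions that agree where the metric is defined are equal. -/
lemma eqOn_contRegion {τ : ℂ} (hτ : 0 < τ.im) {M N : ℕ} {F G : ℂ → ℂ}
    (hF : DifferentiableOn ℂ F (contRegion τ N)) (hG : DifferentiableOn ℂ G (contRegion τ N))
    (h : Set.EqOn F G (integralRange τ M)) : Set.EqOn F G (contRegion τ N) :=
  (hF.analyticOnNhd (isOpen_contRegion τ N)).eqOn_of_preconnected_of_frequently_eq
    (hG.analyticOnNhd (isOpen_contRegion τ N)) (isConnected_contRegion hτ N).isPreconnected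
    (zero_mem_contRegion hτ N) ((frequently_mem_integralRange τ M).mono fun _ hη => h hη)

/-- The region is exactly where `2(N+1)η` has real part in `(-1, 1)` and imaginary part in `(-Im τ,
Im τ)`; the only lattice point there is `0`. -/
lemma theta_ne_zero_of_mem {τ : ℂ} (hre : τ.re = 0) (hτ : 0 < τ.im) {N : ℕ} {η : ℂ}
    (h : η ∈ contRegion τ (N + 1)) (h0 : η ≠ 0) : theta τ (2 * ((N : ℂ) + 1) * η) ≠ 0 := by
  intro hz
  obtain ⟨m, n, hmn⟩ := exists_of_theta_eq_zero hτ hz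
  obtain ⟨h1, h2⟩ := h
  push_cast at h1 h2
  have r1 := congrArg Complex.re hmn
  have r2 := congrArg Complex.im hmn
  simp [hre] at r1 r2
  have hN : (0 : ℝ) < 2 * (N + 1) := by positivity
  have key : ∀ k : ℤ, |(k : ℝ)| < 1 → k = 0 := fun k hk => by
    rw [← Int.abs_lt_one_iff]; exact_mod_cast hk
  have hm : m = 0 := key m (by rw [← r1, abs_mul, abs_of_pos hN]; exact h1)
  have hn : n = 0 := key n (by
    have : |(n : ℝ)| * τ.im < 1 * τ.im := by
      rw [← abs_of_pos hτ, ← abs_mul, abs_of_pos hτ, ← r2, abs_mul, abs_of_pos hN, one_mul]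
      exact h2
    exact lt_of_mul_lt_mul_right this hτ.le)
  rw [hm, Int.cast_zero] at r1
  rw [hn, Int.cast_zero, zero_mul] at r2
  exact h0 (Complex.ext ((mul_eq_zero.mp r1).resolve_left hN.ne')
    ((mul_eq_zero.mp r2).resolve_left hN.ne'))

/-! ### The normalizing constant. -/

/-- For imaginary `τ` the number `2πiτ` is real, so the principal logarithm returns it. -/
lemma nome_cpow {τ : ℂ} (hre : τ.re = 0) (r : ℂ) :
    nome τ ^ r = exp (2 * Real.pi * I * τ * r) := by
  have him : (2 * Real.pi * I * τ).im = 0 := by simp [hre]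
  rw [nome, cpow_def_of_ne_zero (exp_ne_zero _), log_exp] <;> rw [him]
  · linarith [Real.pi_pos]
  · exact Real.pi_pos.le

lemma inv_normConst {τ : ℂ} (hre : τ.re = 0) (N : ℕ) {η : ℂ} (h : η ≠ 0) :
    (normConst τ N η)⁻¹ = nomeProd τ ^ 3 / (2 * exp (3 * Real.pi * I * τ / 4)) *
      (theta τ (2 * ((N : ℂ) + 1) * η) / η) := by
  rw [normConst, if_neg h, nome_cpow hre, inv_div]
  rw [show 2 * Real.pi * I * τ * (3 / 8) = 3 * Real.pi * I * τ / 4 by ring]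
  rw [div_mul_div_comm]
  ring

lemma inv_normConst_zero {τ : ℂ} (hre : τ.re = 0) (N : ℕ) :
    (normConst τ N 0)⁻¹ = nomeProd τ ^ 3 / (2 * exp (3 * Real.pi * I * τ / 4)) *
      (2 * Real.pi * exp (Real.pi * I * τ / 4) * nomeProd τ ^ 3 * (2 * ((N : ℂ) + 1))) := by
  rw [normConst, if_pos rfl, nome_cpow hre, inv_div]
  rw [show 2 * Real.pi * I * τ * (1 / 4) = Real.pi * I * τ / 2 by ring,
    show 3 * Real.pi * I * τ / 4 = Real.pi * I * τ / 2 + Real.pi * I * τ / 4 by ring, exp_add]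
  have := exp_ne_zero (Real.pi * I * τ / 4)
  have := exp_ne_zero (Real.pi * I * τ / 2)
  field_simp

/-- Away from `0` the reciprocal is a constant times the slope at `0` of `η ↦ θ(2(N+1)η)`; its value
at `0` is the same constant times the derivative. -/
lemma continuousAt_inv_normConst {τ : ℂ} (hre : τ.re = 0) (hτ : 0 < τ.im) (N : ℕ) :
    ContinuousAt (fun η => (normConst τ N η)⁻¹) 0 := by
  rw [continuousAt_iff_punctured_nhds, inv_normConst_zero hre]
  have h : HasDerivAt (fun η => theta τ (2 * ((N : ℂ) + 1) * η))
      (2 * Real.pi * exp (Real.pi * I * τ / 4) * nomeProd τ ^ 3 * (2 * ((N : ℂ) + 1))) 0 := by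
    have h1 : HasDerivAt (fun η : ℂ => 2 * ((N : ℂ) + 1) * η) (2 * ((N : ℂ) + 1)) 0 := by
      simpa using (hasDerivAt_id (0 : ℂ)).const_mul (2 * ((N : ℂ) + 1))
    have h2 := hasDerivAt_theta_zero hτ
    rw [← mul_zero (2 * ((N : ℂ) + 1))] at h2
    exact h2.comp 0 h1
  refine ((hasDerivAt_iff_tendsto_slope.mp h).const_mul _).congr' ?_
  filter_upwards [self_mem_nhdsWithin] with η hη
  rw [inv_normConst hre N hη, slope_def_field, mul_zero, theta_zero, sub_zero, sub_zero]

/-! ### The metric as a sesquilinear form continuous in `η`. -/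

/-- The integrand of the metric in real coordinates. -/
def metricIntegrand (τ : ℂ) (N : ℕ) (η : ℂ) (f g : ℂ → ℂ) (x y : ℝ) : ℂ :=
  f (x + y * I) * conjFun g (x - y * I) * (theta τ (2 * (x + y * I)) *
    theta τ (2 * (x - y * I))) / (thetaDen τ N η (2 * x) * thetaDen τ N η (2 * (y * I)))

lemma continuous_conjFun {g : ℂ → ℂ} (hg : Continuous g) : Continuous (conjFun g) :=
  continuous_conj.comp (hg.comp continuous_conj)

/-- The parameter space `X` allows both joint continuity in `(x, y)` at fixed `η` and joint
continuity in `(η, x, y)`. -/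
lemma continuous_metricIntegrand {X : Type*} [TopologicalSpace X] {τ : ℂ} (hre : τ.re = 0)
    (hτ : 0 < τ.im) {N : ℕ} {f g : ℂ → ℂ} (hf : Continuous f) (hg : Continuous g) {η : X → ℂ}
    {x y : X → ℝ} (hη : Continuous η) (hx : Continuous x) (hy : Continuous y)
    (hmem : ∀ q, η q ∈ integralRange τ N) :
    Continuous (fun q => metricIntegrand τ N (η q) f g (x q) (y q)) := by
  have hth := continuous_theta hτ
  have h3 := continuous_theta3 hτ
  have hg' := continuous_conjFun hg
  have hD : ∀ z : X → ℂ, Continuous z → Continuous fun q => thetaDen τ N (η q) (z q) := by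
    intro z hz
    unfold thetaDen
    exact continuous_finsetProd _ fun k _ => h3.comp (hz.add (continuous_const.mul hη))
  have hx' : Continuous fun q => (x q : ℂ) := continuous_ofReal.comp hx
  have hy' : Continuous fun q => (y q : ℂ) * I := (continuous_ofReal.comp hy).mul continuous_const
  refine Continuous.div ?_ ?_ fun q => mul_ne_zero
    (thetaDen_ne_zero hre hτ (hmem q) _).1 (thetaDen_ne_zero hre hτ (hmem q) _).2
  · exact ((hf.comp (hx'.add hy')).mul (hg'.comp (hx'.sub hy'))).mul
      ((hth.comp (continuous_const.mul (hx'.add hy'))).mul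
        (hth.comp (continuous_const.mul (hx'.sub hy'))))
  · exact (hD _ (continuous_const.mul hx')).mul (hD _ (continuous_const.mul hy'))

lemma continuous_metricIntegrand_apply {τ : ℂ} (hre : τ.re = 0) (hτ : 0 < τ.im) {N : ℕ} {η : ℂ}
    (hη : η ∈ integralRange τ N) {f g : ℂ → ℂ} (hf : Continuous f) (hg : Continuous g) :
    Continuous (metricIntegrand τ N η f g).uncurry :=
  continuous_metricIntegrand hre hτ hf hg (X := ℝ × ℝ) (η := fun _ => η) (x := Prod.fst)
    (y := Prod.snd) continuous_const continuous_fst continuous_snd fun _ => hη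

lemma continuousOn_metric {τ : ℂ} (hre : τ.re = 0) (hτ : 0 < τ.im) (N : ℕ) {f g : ℂ → ℂ}
    (hf : Continuous f) (hg : Continuous g) :
    ContinuousOn (fun η => metric τ N η f g) (integralRange τ N) := by
  rw [continuousOn_iff_continuous_domRestrict]
  have e : (integralRange τ N).domRestrict (fun η => metric τ N η f g) =
      fun η : integralRange τ N => exp (Real.pi * I * τ / 2 * (N + 2)) *
        rectIntegral τ.im (metricIntegrand τ N η f g) :=
    funext fun η => metric_eq hre hτ η.2 hf hg
  rw [e]
  unfold rectIntegral
  refine continuous_const.mul ?_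
  refine intervalIntegral.continuous_parametric_intervalIntegral_of_continuous' ?_ _ _
  refine intervalIntegral.continuous_parametric_intervalIntegral_of_continuous'
    (f := fun (q : integralRange τ N × ℝ) y => metricIntegrand τ N q.1 f g q.2 y) ?_ _ _
  exact continuous_metricIntegrand hre hτ hf hg (X := (integralRange τ N × ℝ) × ℝ)
    (η := fun q => (q.1.1 : ℂ)) (x := fun q => q.1.2) (y := fun q => q.2)
    (continuous_subtype_val.comp (continuous_fst.comp continuous_fst))
    (continuous_snd.comp continuous_fst) continuous_snd fun q => q.1.1.2

lemma metric_eq_rectIntegral {τ : ℂ} (hre : τ.re = 0) (hτ : 0 < τ.im) {N : ℕ} {η : ℂ}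
    (hη : η ∈ integralRange τ N) (f g : thetaSpace τ N) : metric τ N η f.1 g.1 =
      exp (Real.pi * I * τ / 2 * (N + 2)) * rectIntegral τ.im (metricIntegrand τ N η f.1 g.1) :=
  metric_eq hre hτ hη f.2.1.continuous g.2.1.continuous

lemma metric_add {τ : ℂ} (hre : τ.re = 0) (hτ : 0 < τ.im) {N : ℕ} {η : ℂ}
    (hη : η ∈ integralRange τ N) {f₁ f₂ f g₁ g₂ g : thetaSpace τ N}
    (h : ∀ x y, metricIntegrand τ N η f.1 g.1 x y =
      metricIntegrand τ N η f₁.1 g₁.1 x y + metricIntegrand τ N η f₂.1 g₂.1 x y) :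
    metric τ N η f.1 g.1 = metric τ N η f₁.1 g₁.1 + metric τ N η f₂.1 g₂.1 := by
  rw [metric_eq_rectIntegral hre hτ hη, metric_eq_rectIntegral hre hτ hη,
    metric_eq_rectIntegral hre hτ hη, ← mul_add, ← rectIntegral_add _
      (continuous_metricIntegrand_apply hre hτ hη f₁.2.1.continuous g₁.2.1.continuous)
      (continuous_metricIntegrand_apply hre hτ hη f₂.2.1.continuous g₂.2.1.continuous),
    rectIntegral_congr h]

lemma metric_const_mul {τ : ℂ} (hre : τ.re = 0) (hτ : 0 < τ.im) {N : ℕ} {η : ℂ}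
    (hη : η ∈ integralRange τ N) {c : ℂ} {f₁ f g₁ g : thetaSpace τ N}
    (h : ∀ x y, metricIntegrand τ N η f.1 g.1 x y = c * metricIntegrand τ N η f₁.1 g₁.1 x y) :
    metric τ N η f.1 g.1 = c * metric τ N η f₁.1 g₁.1 := by
  rw [metric_eq_rectIntegral hre hτ hη, metric_eq_rectIntegral hre hτ hη, 
    rectIntegral_congr h, rectIntegral_const_mul]
  ring

/-- The metric as a sesquilinear form. -/
def metricForm {τ : ℂ} (hre : τ.re = 0) (hτ : 0 < τ.im) {N : ℕ} {η : ℂ}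
    (hη : η ∈ integralRange τ N) : thetaSpace τ N →ₗ[ℂ] thetaSpace τ N →ₗ⋆[ℂ] ℂ :=
  LinearMap.mk₂'ₛₗ (RingHom.id ℂ) (starRingEnd ℂ) (fun f g => metric τ N η f.1 g.1)
    (fun f f' g => metric_add hre hτ hη fun x y => by
      simp only [Submodule.coe_add, Pi.add_apply, metricIntegrand]
      ring)
    (fun c f g => metric_const_mul hre hτ hη fun x y => by
      simp only [Submodule.coe_smul, Pi.smul_apply, smul_eq_mul, metricIntegrand,
        RingHom.id_apply]
      ring)
    (fun f g g' => metric_add hre hτ hη fun x y => by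
      simp only [Submodule.coe_add, Pi.add_apply, metricIntegrand, conjFun, map_add]
      ring)
    (fun c f g => metric_const_mul hre hτ hη fun x y => by
      simp only [Submodule.coe_smul, Pi.smul_apply, smul_eq_mul, metricIntegrand, conjFun,
        map_mul]
      ring)

/-- The normalized metric `C⁻¹ ⟨f, g⟩`. -/
def normForm {τ : ℂ} (hre : τ.re = 0) (hτ : 0 < τ.im) {N : ℕ} {η : ℂ}
    (hη : η ∈ integralRange τ N) : thetaSpace τ N →ₗ[ℂ] thetaSpace τ N →ₗ⋆[ℂ] ℂ :=
  (normConst τ N η)⁻¹ • metricForm hre hτ hη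

lemma normForm_apply {τ : ℂ} (hre : τ.re = 0) (hτ : 0 < τ.im) {N : ℕ} {η : ℂ}
    (hη : η ∈ integralRange τ N) (f g : thetaSpace τ N) :
    normForm hre hτ hη f g = (normConst τ N η)⁻¹ * metric τ N η f.1 g.1 := rfl

/-- A function that is holomorphic near `0` and agrees with the normalized metric away from `0`
also agrees with it at `0`. -/
lemma eqOn_integralRange_of_ne_zero {τ : ℂ} (hre : τ.re = 0) (hτ : 0 < τ.im) {M N : ℕ}
    {F : ℂ → ℂ} (hF : DifferentiableOn ℂ F (contRegion τ M)) (f g : thetaSpace τ N)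
    (h : ∀ η ∈ integralRange τ N, η ≠ 0 → F η = (normConst τ N η)⁻¹ * metric τ N η f.1 g.1) :
    ∀ η ∈ integralRange τ N, F η = (normConst τ N η)⁻¹ * metric τ N η f.1 g.1 := by
  intro η hη
  rcases ne_or_eq η 0 with h0 | rfl
  · exact h η hη h0
  have hF0 : ContinuousAt F 0 := (hF.differentiableAt
    ((isOpen_contRegion τ M).mem_nhds (zero_mem_contRegion hτ M))).continuousAt
  have hm := (continuousAt_inv_normConst hre hτ N).continuousWithinAt.mul
    (continuousOn_metric hre hτ N f.2.1.continuous g.2.1.continuous 0 hη)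
  have hsub : integralRange τ N \ {0} ⊆ integralRange τ N := Set.sdiff_subset
  have hne : (𝓝[integralRange τ N \ {0}] (0 : ℂ)).NeBot := by
    rw [Set.sdiff_eq, Set.inter_comm, nhdsWithin_inter', ← frequently_mem_iff_neBot]
    exact frequently_mem_integralRange τ N
  refine tendsto_nhds_unique_of_eventuallyEq (l := 𝓝[integralRange τ N \ {0}] (0 : ℂ))
    (hF0.tendsto.mono_left nhdsWithin_le_nhds) (hm.mono hsub) ?_
  filter_upwards [self_mem_nhdsWithin] with η hη
  exact h η hη.1 hη.2

/-! ### Analytic continuation by induction on `N`. -/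

/-- Continuations of the individual matrix elements assemble to a continuation of the form. -/
lemma exists_isContinuation_of_forall {τ : ℂ} (hre : τ.re = 0) (hτ : 0 < τ.im) {N : ℕ}
    (h : ∀ f g : thetaSpace τ N, ∃ F : ℂ → ℂ, DifferentiableOn ℂ F (contRegion τ N) ∧
      ∀ η ∈ integralRange τ N, F η = (normConst τ N η)⁻¹ * metric τ N η f.1 g.1) :
    ∃ B, IsContinuation τ N (contRegion τ N) B := by
  choose F hF hFm using h
  have hF' : ∀ f g η (hη : η ∈ integralRange τ N), F f g η = normForm hre hτ hη f g := hFm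
  classical
  let B : ℂ → thetaSpace τ N →ₗ[ℂ] thetaSpace τ N →ₗ⋆[ℂ] ℂ := fun η =>
    if hη : η ∈ contRegion τ N then
      LinearMap.mk₂'ₛₗ (RingHom.id ℂ) (starRingEnd ℂ) (fun f g => F f g η)
        (fun f f' g => eqOn_contRegion hτ (M := N) (hF _ _) ((hF f g).add (hF f' g)) (fun η hη => by
          simp only [Pi.add_apply, hF' _ _ η hη, map_add, LinearMap.add_apply]) hη)
        (fun c f g => eqOn_contRegion hτ (M := N) (hF _ _) ((hF f g).const_smul c) (fun η hη => by
          simp only [Pi.smul_apply, hF' _ _ η hη, map_smul, LinearMap.smul_apply]) hη)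
        (fun f g g' => eqOn_contRegion hτ (M := N) (hF _ _) ((hF f g).add (hF f g')) (fun η hη => by
          simp only [Pi.add_apply, hF' _ _ η hη, map_add]) hη)
        (fun c f g => eqOn_contRegion hτ (M := N) (hF _ _) ((hF f g).const_smul ((starRingEnd ℂ) c))
          (fun η hη => by
            simp only [Pi.smul_apply, hF' _ _ η hη, LinearMap.map_smulₛₗ]) hη)
    else 0
  have hB : ∀ η ∈ contRegion τ N, ∀ f g, B η f g = F f g η := fun η hη f g => by
    simp only [B, dif_pos hη, LinearMap.mk₂'ₛₗ_apply]
  exact ⟨B, isOpen_contRegion τ N, isConnected_contRegion hτ N,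
    integralRange_subset_contRegion hτ N, fun f g => (hF f g).congr fun η hη => hB η hη f g,
    fun η hη f g => (hB η (integralRange_subset_contRegion hτ N hη) f g).trans (hFm f g η hη)⟩

/-- This zero compensates that of `θ(2(N+1)η)` at `η = 0`. -/
lemma lowering_zero {τ : ℂ} (hτ : 0 < τ.im) (N : ℕ) (b : ℂ) (f : thetaSpace τ (N + 1)) :
    lowering hτ N b 0 f = 0 := by
  have h : loweringNum τ N b 0 f.1 = fun _ => 0 := by
    funext u
    simp [loweringNum]
  ext u
  simp [lowering, entireQuot, h]

/-- Both the form and its argument vary with `η`. Interpolation expands the lowered function in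
fixed vectors, with coefficients holomorphic in `η`. -/
lemma differentiableOn_lowering {τ : ℂ} (hτ : 0 < τ.im) {N : ℕ} {U : Set ℂ}
    {B : ℂ → thetaSpace τ N →ₗ[ℂ] thetaSpace τ N →ₗ⋆[ℂ] ℂ} (hB : IsContinuation τ N U B) (b : ℂ)
    (f : thetaSpace τ (N + 1)) (g : thetaSpace τ N) :
    DifferentiableOn ℂ (fun η => B η (lowering hτ N b η f) g) U := by
  obtain ⟨T, e, he⟩ := exists_interpolation hτ N
  have h : (fun η => B η (lowering hτ N b η f) g) = fun η =>
      ∑ t : T, loweringNum τ N b η f.1 t.1.1 / theta τ (2 * t.1.1) * B η (e t) g := by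
    funext η
    conv_lhs => rw [he (lowering hτ N b η f)]
    rw [map_sum, LinearMap.sum_apply]
    refine Finset.sum_congr rfl fun t _ => ?_
    rw [map_smul, LinearMap.smul_apply, smul_eq_mul, ← lowering_mul hτ,
      mul_div_cancel_right₀ _ t.1.2]
  have hth := differentiable_theta hτ
  have hf := f.2.1
  rw [h]
  refine DifferentiableOn.fun_sum fun t _ => DifferentiableOn.mul ?_ (hB.holomorphic _ _)
  refine (Differentiable.div_const ?_ _).differentiableOn
  unfold loweringNum
  fun_prop

/-- The reciprocal of `C` at level `N + 1` contains the factor `θ(2(N+2)η)` that adjointness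
produces. What is left, `θ(2(N+1)η)`, comes from `C` at level `N` and has only the zero `η = 0` in
the larger region. -/
lemma inv_normConst_mul_metric_raising {τ : ℂ} (hre : τ.re = 0) (hτ : 0 < τ.im) {N : ℕ} {η : ℂ}
    (hη : η ∈ integralRange τ (N + 1)) (h0 : η ≠ 0) (b : ℂ) (f : thetaSpace τ (N + 1))
    (g : thetaSpace τ N) : theta τ (2 * ((N : ℂ) + 1) * η) * ((normConst τ (N + 1) η)⁻¹ *
      metric τ (N + 1) η f.1 (raising hτ N ((starRingEnd ℂ) b) g).1) =
    -exp (Real.pi * I * τ / 2) *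
      ((normConst τ N η)⁻¹ * metric τ N η (lowering hτ N b η f).1 g.1) := by
  rw [metric_lowering hre hτ hη, inv_normConst hre _ h0, inv_normConst hre _ h0, exp_neg]
  have := exp_ne_zero (Real.pi * I * τ / 2)
  rw [show 2 * (((N + 1 : ℕ) : ℂ) + 1) * η = 2 * ((N + 2) * η) by push_cast; ring]
  field_simp

/-- The adjointness relation, solved for the form at level `N + 1`, defines its continuation; the
only singularity is at `η = 0` and is removable. -/
lemma exists_differentiableOn_raising {τ : ℂ} (hre : τ.re = 0) (hτ : 0 < τ.im) {N : ℕ}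
    {B : ℂ → thetaSpace τ N →ₗ[ℂ] thetaSpace τ N →ₗ⋆[ℂ] ℂ}
    (hB : IsContinuation τ N (contRegion τ N) B) (b : ℂ) (f : thetaSpace τ (N + 1))
    (g : thetaSpace τ N) : ∃ F : ℂ → ℂ, DifferentiableOn ℂ F (contRegion τ (N + 1)) ∧
      ∀ η ∈ integralRange τ (N + 1), F η = (normConst τ (N + 1) η)⁻¹ *
        metric τ (N + 1) η f.1 (raising hτ N ((starRingEnd ℂ) b) g).1 := by
  have ha : 2 * ((N : ℂ) + 1) ≠ 0 := mul_ne_zero two_ne_zero (Nat.cast_add_one_ne_zero N)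
  have hF : DifferentiableOn ℂ (entireQuot
      (fun η => -exp (Real.pi * I * τ / 2) * B η (lowering hτ N b η f) g)
      (fun η => theta τ (2 * ((N : ℂ) + 1) * η))) (contRegion τ (N + 1)) := by
    refine differentiableOn_entireQuot (isOpen_contRegion τ _)
      (((differentiableOn_lowering hτ hB b f g).const_mul _).mono (contRegion_succ_subset τ N))
      ?_ fun η hη hz => ⟨?_, deriv_theta_comp_mul hτ ha hz⟩
    · exact ((differentiable_theta hτ).comp (differentiable_id.const_mul _)).differentiableOn
    · have h0 : η = 0 := by
        by_contra h0
        exact theta_ne_zero_of_mem hre hτ hη h0 hz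
      rw [h0, lowering_zero]
      simp
  refine ⟨_, hF, eqOn_integralRange_of_ne_zero hre hτ hF _ _ fun η hη h0 => ?_⟩
  have hne := theta_ne_zero_of_mem hre hτ (integralRange_subset_contRegion hτ _ hη) h0
  rw [entireQuot_of_ne_zero (g := fun η => theta τ (2 * ((N : ℂ) + 1) * η)) hne, div_eq_iff hne,
    hB.eq_metric η (integralRange_succ_subset τ N hη), mul_comm _ (theta τ _),
    inv_normConst_mul_metric_raising hre hτ hη h0]

/-- The normalized form on `Θ_0` does not depend on `η`, which makes its continuation trivial. The
point `η = 0` is reached by continuity, since `metric_zero` is void there. -/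
lemma inv_normConst_mul_metric_zero {τ : ℂ} (hre : τ.re = 0) (hτ : 0 < τ.im) {η : ℂ}
    (hη : η ∈ integralRange τ 0) (f g : thetaSpace τ 0) :
    f.1 0 * (starRingEnd ℂ) (g.1 0) = (normConst τ 0 η)⁻¹ * metric τ 0 η f.1 g.1 := by
  refine eqOn_integralRange_of_ne_zero hre hτ (M := 0) (F := fun _ => _)
    (differentiableOn_const _) f g (fun η hη h0 => ?_) η hη
  have h := metric_zero hre hτ hη f g
  have hE : exp (Real.pi * I * τ) =
      exp (Real.pi * I * τ / 4) * exp (3 * Real.pi * I * τ / 4) := by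
    rw [← exp_add]; congr 1; ring
  rw [(hasDerivAt_theta_zero hτ).deriv, hE] at h
  have e1 := exp_ne_zero (Real.pi * I * τ / 4)
  have e2 := exp_ne_zero (3 * Real.pi * I * τ / 4)
  rw [inv_normConst hre _ h0, Nat.cast_zero, zero_add, mul_one]
  have hpi : (Real.pi : ℂ) ≠ 0 := ofReal_ne_zero.mpr Real.pi_ne_zero
  have e3 : 2 * Real.pi * exp (Real.pi * I * τ / 4) ≠ 0 :=
    mul_ne_zero (mul_ne_zero two_ne_zero hpi) e1
  rw [div_mul_div_comm, div_mul_eq_mul_div,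
    eq_div_iff (mul_ne_zero (mul_ne_zero two_ne_zero e2) h0)]
  refine mul_left_cancel₀ e3 ?_
  linear_combination -h

theorem exists_isContinuation {τ : ℂ} (hre : τ.re = 0) (hτ : 0 < τ.im) (N : ℕ) :
    ∃ B, IsContinuation τ N (contRegion τ N) B := by
  induction N with
  | zero =>
    exact exists_isContinuation_of_forall hre hτ fun f g => ⟨fun _ => _,
      differentiableOn_const _, fun η hη => inv_normConst_mul_metric_zero hre hτ hη f g⟩
  | succ N ih =>
    obtain ⟨B, hB⟩ := ih
    refine exists_isContinuation_of_forall hre hτ fun f g => ?_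
    -- The adjointness relation treats only raised second arguments; two raising operators span the
    -- space.
    obtain ⟨g₁, g₂, rfl⟩ := exists_eq_raising hτ N g
    obtain ⟨F₁, hF₁, h₁⟩ := exists_differentiableOn_raising hre hτ hB ((starRingEnd ℂ) 0) f g₁
    obtain ⟨F₂, hF₂, h₂⟩ := exists_differentiableOn_raising hre hτ hB
      ((starRingEnd ℂ) (1 / 4 - (1 / 2 + τ / 2))) f g₂
    rw [conj_conj] at h₁ h₂
    refine ⟨_, hF₁.add hF₂, fun η hη => ?_⟩
    rw [Pi.add_apply, h₁ η hη, h₂ η hη, ← normForm_apply hre hτ hη, ← normForm_apply hre hτ hη,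
      ← normForm_apply hre hτ hη, map_add]

/-- The lowering operator is adjoint to the raising operator, for the continued forms. -/
lemma IsContinuation.raising_eq {τ : ℂ} (hre : τ.re = 0) (hτ : 0 < τ.im) {N : ℕ}
    {B : ℂ → thetaSpace τ N →ₗ[ℂ] thetaSpace τ N →ₗ⋆[ℂ] ℂ}
    (hB : IsContinuation τ N (contRegion τ N) B)
    {B' : ℂ → thetaSpace τ (N + 1) →ₗ[ℂ] thetaSpace τ (N + 1) →ₗ⋆[ℂ] ℂ}
    (hB' : IsContinuation τ (N + 1) (contRegion τ (N + 1)) B') (b : ℂ) (f : thetaSpace τ (N + 1))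
    (g : thetaSpace τ N) {η : ℂ} (hη : η ∈ contRegion τ (N + 1)) :
    theta τ (2 * ((N : ℂ) + 1) * η) * B' η f (raising hτ N ((starRingEnd ℂ) b) g) =
      -exp (Real.pi * I * τ / 2) * B η (lowering hτ N b η f) g := by
  refine eqOn_contRegion hτ (M := N + 1)
    (F := fun η => theta τ (2 * ((N : ℂ) + 1) * η) *
      B' η f (raising hτ N ((starRingEnd ℂ) b) g))
    (G := fun η => -exp (Real.pi * I * τ / 2) * B η (lowering hτ N b η f) g)
    ?_ ?_ (fun η hη => ?_) hη
  · refine DifferentiableOn.mul ?_ (hB'.holomorphic _ _)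
    exact ((differentiable_theta hτ).comp (differentiable_id.const_mul _)).differentiableOn
  · exact ((differentiableOn_lowering hτ hB b f g).const_mul _).mono (contRegion_succ_subset τ N)
  · simp only
    rcases eq_or_ne η 0 with rfl | h0
    · rw [lowering_zero, mul_zero, theta_zero]
      simp
    · rw [hB.eq_metric η (integralRange_succ_subset τ N hη), hB'.eq_metric η hη,
        inv_normConst_mul_metric_raising hre hτ hη h0]

/-! ### Hermitian symmetry. -/

lemma conj_eq_neg_of_re_eq_zero {z : ℂ} (h : z.re = 0) : (starRingEnd ℂ) z = -z := by
  apply Complex.ext <;> simp [h]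

lemma conj_theta {τ : ℂ} (hre : τ.re = 0) (z : ℂ) :
    (starRingEnd ℂ) (theta τ z) = theta τ ((starRingEnd ℂ) z) := by
  rw [← neg_neg (theta τ ((starRingEnd ℂ) z)), ← theta_neg, theta, theta, map_mul, conj_tsum,
    conj_I, neg_mul]
  refine congrArg (fun s => -(I * s)) (tsum_congr fun n => ?_)
  simp only [map_mul, map_zpow₀, map_neg, map_one, ← exp_conj, map_add, map_sub, map_pow, conj_I,
    conj_ofReal, conj_eq_neg_of_re_eq_zero hre, map_intCast, map_div₀, map_ofNat]
  congr 2
  ring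

lemma conj_nome {τ : ℂ} (hre : τ.re = 0) : (starRingEnd ℂ) (nome τ) = nome τ := by
  simp only [nome, ← exp_conj, map_mul, conj_I, conj_ofReal, conj_eq_neg_of_re_eq_zero hre,
    map_ofNat]
  congr 1
  ring

lemma conj_nomeProd {τ : ℂ} (hre : τ.re = 0) : (starRingEnd ℂ) (nomeProd τ) = nomeProd τ := by
  rw [nomeProd, Function.LeftInverse.map_tprod _ continuous_conj continuous_conj conj_conj]
  simp [conj_nome hre]

lemma conj_exp_of_re_eq_zero {τ : ℂ} (hre : τ.re = 0) (r : ℝ) :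
    (starRingEnd ℂ) (exp (Real.pi * I * τ * r)) = exp (Real.pi * I * τ * r) := by
  simp only [← exp_conj, map_mul, conj_I, conj_ofReal, conj_eq_neg_of_re_eq_zero hre]
  congr 1
  ring

lemma conj_inv_normConst {τ : ℂ} (hre : τ.re = 0) (N : ℕ) (η : ℂ) :
    (starRingEnd ℂ) (normConst τ N ((starRingEnd ℂ) η))⁻¹ = (normConst τ N η)⁻¹ := by
  have e1 := conj_exp_of_re_eq_zero hre (3 / 4)
  have e2 := conj_exp_of_re_eq_zero hre (1 / 4)
  have a1 : Real.pi * I * τ * (3 / 4 : ℝ) = 3 * Real.pi * I * τ / 4 := by push_cast; ring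
  have a2 : Real.pi * I * τ * (1 / 4 : ℝ) = Real.pi * I * τ / 4 := by push_cast; ring
  rw [a1] at e1
  rw [a2] at e2
  rcases eq_or_ne η 0 with rfl | h
  · rw [map_zero, inv_normConst_zero hre]
    simp only [map_mul, map_div₀, map_pow, conj_nomeProd hre, e1, e2, map_ofNat, conj_ofReal,
      map_add, map_natCast, map_one]
  · have h' : (starRingEnd ℂ) η ≠ 0 := (map_ne_zero _).mpr h
    rw [inv_normConst hre _ h, inv_normConst hre _ h']
    simp only [map_mul, map_div₀, map_pow, conj_nomeProd hre, e1, conj_theta hre, map_ofNat,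
      conj_conj, map_add, map_natCast, map_one]

lemma inv_normConst_neg {τ : ℂ} (hre : τ.re = 0) (N : ℕ) (η : ℂ) :
    (normConst τ N (-η))⁻¹ = (normConst τ N η)⁻¹ := by
  rcases eq_or_ne η 0 with rfl | h
  · rw [neg_zero]
  · rw [inv_normConst hre _ h, inv_normConst hre _ (neg_ne_zero.mpr h), mul_neg, theta_neg,
      neg_div_neg_eq]

lemma conj_thetaDen {τ : ℂ} (hre : τ.re = 0) (N : ℕ) (η z : ℂ) :
    (starRingEnd ℂ) (thetaDen τ N ((starRingEnd ℂ) η) z) =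
      thetaDen τ N η ((starRingEnd ℂ) z) := by
  simp only [thetaDen, map_prod, conj_theta3 hre, map_add, map_mul, map_sub, map_natCast, map_one,
    conj_conj, map_ofNat]

lemma conj_weight {τ : ℂ} (hre : τ.re = 0) (N : ℕ) (η u : ℂ) :
    (starRingEnd ℂ) (weight τ N ((starRingEnd ℂ) η) u ((starRingEnd ℂ) u)) =
      weight τ N η u ((starRingEnd ℂ) u) := by
  have e := conj_exp_of_re_eq_zero hre ((N + 2) / 2)
  rw [show Real.pi * I * τ * (((N + 2) / 2 : ℝ) : ℂ) = Real.pi * I * τ / 2 * (N + 2) by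
    push_cast; ring] at e
  rw [weight_eq, weight_eq]
  simp only [map_mul, map_div₀, conj_theta hre, conj_thetaDen hre, map_sub, map_add, map_ofNat,
    conj_conj, e]
  rw [show (starRingEnd ℂ) u - u = -(u - (starRingEnd ℂ) u) by ring, thetaDen_neg,
    add_comm ((starRingEnd ℂ) u) u, mul_comm (theta τ (2 * (starRingEnd ℂ) u))]

lemma conj_metric {τ : ℂ} (hre : τ.re = 0) (N : ℕ) (η : ℂ) (f g : ℂ → ℂ) :
    (starRingEnd ℂ) (metric τ N ((starRingEnd ℂ) η) f g) = metric τ N η g f := by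
  rw [metric, metric, ← integral_conj]
  refine integral_congr_ae (Eventually.of_forall fun u => ?_)
  simp only [map_mul, conj_weight hre, conj_conj]
  ring

lemma metric_neg (τ : ℂ) (N : ℕ) (η : ℂ) (f g : ℂ → ℂ) :
    metric τ N (-η) f g = metric τ N η f g := by
  simp only [metric, weight_eq, thetaDen_neg_eta]

lemma conj_mem_contRegion {τ η : ℂ} {N : ℕ} (h : η ∈ contRegion τ N) :
    (starRingEnd ℂ) η ∈ contRegion τ N := by
  simpa [contRegion] using h

lemma neg_mem_contRegion {τ η : ℂ} {N : ℕ} (h : η ∈ contRegion τ N) : -η ∈ contRegion τ N := by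
  simpa [contRegion] using h

lemma conj_mem_integralRange {τ η : ℂ} {N : ℕ} (h : η ∈ integralRange τ N) :
    (starRingEnd ℂ) η ∈ integralRange τ N := by
  simpa [integralRange, realRange, imagRange] using h

lemma neg_mem_integralRange {τ η : ℂ} {N : ℕ} (h : η ∈ integralRange τ N) :
    -η ∈ integralRange τ N := by
  simpa [integralRange, realRange, imagRange] using h

lemma IsContinuation.neg {τ : ℂ} (hre : τ.re = 0) (hτ : 0 < τ.im) {N : ℕ}
    {B : ℂ → thetaSpace τ N →ₗ[ℂ] thetaSpace τ N →ₗ⋆[ℂ] ℂ}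
    (hB : IsContinuation τ N (contRegion τ N) B) (f g : thetaSpace τ N) {η : ℂ}
    (hη : η ∈ contRegion τ N) : B (-η) f g = B η f g := by
  refine eqOn_contRegion hτ (M := N) (F := fun η => B (-η) f g) ?_ (hB.holomorphic f g)
    (fun η hη => ?_) hη
  · exact (hB.holomorphic f g).comp (differentiableOn_neg _) fun η hη => neg_mem_contRegion hη
  · simp only
    rw [hB.eq_metric η hη, hB.eq_metric _ (neg_mem_integralRange hη), metric_neg,
      inv_normConst_neg hre]

/-- Conjugating both the variable and the value preserves holomorphy, so the symmetry of the
integral extends by the identity theorem. -/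
lemma IsContinuation.conj {τ : ℂ} (hre : τ.re = 0) (hτ : 0 < τ.im) {N : ℕ}
    {B : ℂ → thetaSpace τ N →ₗ[ℂ] thetaSpace τ N →ₗ⋆[ℂ] ℂ}
    (hB : IsContinuation τ N (contRegion τ N) B) (f g : thetaSpace τ N) {η : ℂ}
    (hη : η ∈ contRegion τ N) : (starRingEnd ℂ) (B ((starRingEnd ℂ) η) f g) = B η g f := by
  refine eqOn_contRegion hτ (M := N)
    (F := fun η => (starRingEnd ℂ) (B ((starRingEnd ℂ) η) f g)) ?_ (hB.holomorphic g f)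
    (fun η hη => ?_) hη
  · intro η hη
    refine (differentiableAt_conj_conj_iff (f := fun η => B η f g)).mpr ?_
      |>.differentiableWithinAt
    exact (hB.holomorphic f g).differentiableAt
      ((isOpen_contRegion τ N).mem_nhds (conj_mem_contRegion hη))
  · simp only
    rw [hB.eq_metric η hη, hB.eq_metric _ (conj_mem_integralRange hη), map_mul, conj_metric hre,
      conj_inv_normConst hre]

/-- The continued form is Hermitian on the real and on the imaginary axis. -/
lemma IsContinuation.hermitian {τ : ℂ} (hre : τ.re = 0) (hτ : 0 < τ.im) {N : ℕ}
    {B : ℂ → thetaSpace τ N →ₗ[ℂ] thetaSpace τ N →ₗ⋆[ℂ] ℂ}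
    (hB : IsContinuation τ N (contRegion τ N) B) (f g : thetaSpace τ N) {η : ℂ}
    (hη : η ∈ contRange τ N) : B η g f = (starRingEnd ℂ) (B η f g) := by
  have hU := contRange_subset_contRegion hτ N hη
  rw [← hB.conj hre hτ f g hU]
  -- On the real axis `conj η = η`; on the imaginary axis `conj η = -η`, and the form is even in
  -- `η`.
  rcases mem_contRange.mp hη with ⟨h, -⟩ | ⟨h, -⟩
  · rw [conj_eq_iff_im.mpr h]
  · rw [conj_eq_neg_of_re_eq_zero h, hB.neg hre hτ f g hU]

/-! ### Positivity at `η = 0`. -/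

lemma theta3_zero_re_pos {τ : ℂ} (hre : τ.re = 0) (hτ : 0 < τ.im) : 0 < (theta3 τ 0).re := by
  have hs := (summable_jacobiTheta₂_term_iff 0 τ).mpr hτ
  have h : ∀ n : ℤ, 0 < (jacobiTheta₂_term n 0 τ).re := by
    intro n
    rw [jacobiTheta₂_term, show 2 * Real.pi * I * n * 0 + Real.pi * I * n ^ 2 * τ =
      ((-(Real.pi * n ^ 2 * τ.im) : ℝ) : ℂ) by
        apply Complex.ext <;> simp [hre, ← ofReal_intCast, ← ofReal_pow], exp_ofReal_re]
    exact Real.exp_pos _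
  rw [theta3, jacobiTheta₂, re_tsum hs]
  exact (hasSum_re hs.hasSum).summable.tsum_pos (fun n => (h n).le) 0 (h 0)

/-- A real-valued continuous function without zeros keeps its sign. -/
lemma exists_pos_of_path {γ : ℝ → ℂ} (hc : Continuous γ) (hne : ∀ s, γ s ≠ 0)
    (hre : ∀ s, (starRingEnd ℂ) (γ s) = γ s) (h0 : 0 < (γ 0).re) (s : ℝ) :
    ∃ r : ℝ, 0 < r ∧ γ s = r := by
  refine ⟨(γ s).re, ?_, (conj_eq_iff_re.mp (hre s)).symm⟩
  by_contra! hs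
  obtain ⟨t, ht⟩ := mem_range_of_exists_le_of_exists_ge (continuous_re.comp hc) ⟨s, hs⟩
    ⟨0, h0.le⟩
  refine hne t ?_
  rw [← conj_eq_iff_re.mp (hre t)]
  simpa using ht

lemma theta3_real_pos {τ : ℂ} (hre : τ.re = 0) (hτ : 0 < τ.im) (x : ℝ) :
    ∃ r : ℝ, 0 < r ∧ theta3 τ x = r := by
  have h3 := continuous_theta3 hτ
  refine exists_pos_of_path (γ := fun x : ℝ => theta3 τ x) (by fun_prop)
    (fun s => theta3_ne_zero hre hτ (Or.inr (by simpa using hτ))) (fun s => ?_)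
    (by simpa using theta3_zero_re_pos hre hτ) x
  rw [conj_theta3 hre, conj_ofReal]

lemma theta3_imag_pos {τ : ℂ} (hre : τ.re = 0) (hτ : 0 < τ.im) (y : ℝ) :
    ∃ r : ℝ, 0 < r ∧ theta3 τ (y * I) = r := by
  have h3 := continuous_theta3 hτ
  refine exists_pos_of_path (γ := fun y : ℝ => theta3 τ (y * I)) (by fun_prop)
    (fun s => theta3_ne_zero hre hτ (Or.inl (by simp))) (fun s => ?_)
    (by simpa using theta3_zero_re_pos hre hτ) y
  rw [conj_theta3 hre, map_mul, conj_ofReal, conj_I, mul_neg, theta3_neg]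

lemma thetaDen_zero (τ : ℂ) (N : ℕ) (z : ℂ) : thetaDen τ N 0 z = theta3 τ z ^ (N + 2) := by
  simp [thetaDen]

lemma exp_eq_ofReal {τ : ℂ} (hre : τ.re = 0) (r : ℝ) :
    exp (Real.pi * I * τ * r) = (Real.exp (-(Real.pi * τ.im * r)) : ℝ) := by
  rw [ofReal_exp]
  congr 1
  apply Complex.ext <;> simp [hre]

/-- At `η = 0` the weight is nonnegative. -/
lemma weight_zero_eq {τ : ℂ} (hre : τ.re = 0) (hτ : 0 < τ.im) (N : ℕ) (u : ℂ) :
    ∃ r : ℝ, 0 < r ∧ weight τ N 0 u ((starRingEnd ℂ) u) = (r * normSq (theta τ (2 * u)) : ℝ) := by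
  obtain ⟨r₁, h₁, e₁⟩ := theta3_real_pos hre hτ (2 * u.re)
  obtain ⟨r₂, h₂, e₂⟩ := theta3_imag_pos hre hτ (2 * u.im)
  refine ⟨Real.exp (-(Real.pi * τ.im * ((N + 2) / 2))) / (r₁ ^ (N + 2) * r₂ ^ (N + 2)),
    by positivity, ?_⟩
  rw [weight_eq, add_conj, sub_conj, thetaDen_zero, thetaDen_zero, e₁, e₂,
    show Real.pi * I * τ / 2 * (N + 2) = Real.pi * I * τ * (((N + 2) / 2 : ℝ) : ℂ) by
      push_cast; ring, exp_eq_ofReal hre,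
    show 2 * (starRingEnd ℂ) u = (starRingEnd ℂ) (2 * u) by
      rw [map_mul, map_ofNat], ← conj_theta hre, mul_conj]
  push_cast
  ring

/-- The integrand is a positive multiple of `|f(u) θ(2u)|²`. If it vanished throughout the open
rectangle, then `f` would vanish near a point with `θ(2u) ≠ 0`, hence identically. -/
lemma metric_zero_pos {τ : ℂ} (hre : τ.re = 0) (hτ : 0 < τ.im) {N : ℕ} {f : thetaSpace τ N}
    (hf : f ≠ 0) : ∃ r : ℝ, 0 < r ∧ metric τ N 0 f.1 f.1 = r := by
  choose w hw hw' using weight_zero_eq hre hτ N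
  have hth := continuous_theta hτ
  have hfc := f.2.1.continuous
  set F : ℂ → ℝ := fun u => normSq (f.1 u) * (w u * normSq (theta τ (2 * u))) with hF
  have e : ∀ u, f.1 u * (starRingEnd ℂ) (f.1 u) * weight τ N 0 u ((starRingEnd ℂ) u) = F u := by
    intro u
    rw [hw', mul_conj, hF]
    push_cast
    ring
  have hFc : Continuous F := by
    have h := (hfc.mul (continuous_conj.comp hfc)).mul
      (continuous_weight hre hτ (zero_mem_integralRange (τ := τ) N))
    have h2 := continuous_re.comp h
    refine h2.congr fun u => ?_
    change (f.1 u * (starRingEnd ℂ) (f.1 u) * weight τ N 0 u ((starRingEnd ℂ) u)).re = F u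
    rw [e, ofReal_re]
  have hF0 : ∀ u, 0 ≤ F u := fun u =>
    mul_nonneg (normSq_nonneg _) (mul_nonneg (hw u).le (normSq_nonneg _))
  refine ⟨∫ u in fundRect τ, F u, ?_, ?_⟩
  · have hbd : fundRect τ ⊆ Set.Icc (0 : ℝ) 1 ×ℂ Set.Icc (0 : ℝ) τ.im := fun u hu =>
      ⟨Set.Ico_subset_Icc_self hu.1, Set.Ico_subset_Icc_self hu.2⟩
    have hint : IntegrableOn F (fundRect τ) :=
      (hFc.continuousOn.integrableOn_compact (isCompact_Icc.reProdIm isCompact_Icc)).mono_set hbd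
    rw [setIntegral_pos_iff_support_of_nonneg_ae (Eventually.of_forall hF0) hint]
    set V : Set ℂ := Set.Ioo (0 : ℝ) 1 ×ℂ Set.Ioo (0 : ℝ) τ.im with hV
    have hVo : IsOpen V := isOpen_Ioo.reProdIm isOpen_Ioo
    have hVs : V ⊆ fundRect τ := fun u hu =>
      ⟨Set.Ioo_subset_Ico_self hu.1, Set.Ioo_subset_Ico_self hu.2⟩
    have hVn : V.Nonempty := ⟨⟨1 / 2, τ.im / 2⟩, by constructor <;> norm_num, by
      constructor <;> simp <;> linarith⟩
    refine lt_of_lt_of_le ?_ (measure_mono (Set.inter_subset_inter_right _ hVs))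
    refine (hFc.isOpen_support.inter hVo).measure_pos _ ?_
    by_contra hemp
    rw [Set.not_nonempty_iff_eq_empty] at hemp
    have hdense : Dense {z | theta τ (2 * z) ≠ 0} := by
      simpa using dense_theta_ne_zero hτ two_ne_zero 0
    obtain ⟨u₀, hu₀, hu₀'⟩ := hdense.inter_open_nonempty V hVo hVn
    have hev : f.1 =ᶠ[𝓝 u₀] 0 := by
      have hth' : ContinuousAt (fun z => theta τ (2 * z)) u₀ := by fun_prop
      filter_upwards [hVo.mem_nhds hu₀, hth'.eventually_ne hu₀'] with u h1 h2
      by_contra h3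
      have : u ∈ Function.support F ∩ V := ⟨mul_ne_zero (normSq_eq_zero.not.mpr h3)
        (mul_ne_zero (hw u).ne' (normSq_eq_zero.not.mpr h2)), h1⟩
      rw [hemp] at this
      exact this
    have hz : f.1 = 0 := AnalyticOnNhd.eq_of_eventuallyEq (𝕜 := ℂ)
      (fun u _ => f.2.1.analyticAt u) (fun u _ => analyticAt_const) hev
    exact hf (Subtype.ext hz)
  · exact (integral_congr_ae (Eventually.of_forall e)).trans (integral_ofReal (𝕜 := ℂ))

lemma inv_normConst_zero_pos {τ : ℂ} (hre : τ.re = 0) (hτ : 0 < τ.im) (N : ℕ) :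
    ∃ r : ℝ, 0 < r ∧ (normConst τ N 0)⁻¹ = r := by
  have hP := conj_eq_iff_re.mp (conj_nomeProd hre)
  have hP0 : (nomeProd τ).re ≠ 0 := fun h => nomeProd_ne_zero hτ (by rw [← hP, h, ofReal_zero])
  refine ⟨2 * Real.pi * (N + 1) * (nomeProd τ).re ^ 6 / Real.exp (-(Real.pi * τ.im * (1 / 2))),
    ?_, ?_⟩
  · have : 0 < (nomeProd τ).re ^ 6 := by positivity
    have := Real.pi_pos
    positivity
  · rw [normConst, if_pos rfl, nome_cpow hre, inv_div,
      show 2 * Real.pi * I * τ * (1 / 4) = Real.pi * I * τ * ((1 / 2 : ℝ) : ℂ) by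
        push_cast; ring, exp_eq_ofReal hre]
    push_cast
    rw [hP]

/-! ### Positive definiteness along a path of Hermitian forms. -/

section PosDef

variable {V : Type*} [AddCommGroup V] [Module ℂ V]

/-- For a positive semidefinite form, an isotropic vector lies in the radical. -/
lemma eq_zero_of_apply_self_eq_zero {B : V →ₗ[ℂ] V →ₗ⋆[ℂ] ℂ}
    (hB : ∀ f g, B g f = (starRingEnd ℂ) (B f g)) (hnn : ∀ f, 0 ≤ (B f f).re) {f : V}
    (hf : (B f f).re = 0) (g : V) : B f g = 0 := by
  by_contra hc
  set c := B f g with hcdef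
  have hn : 0 < normSq c := normSq_pos.mpr hc
  set q := (B g g).re with hq
  have hq0 : 0 ≤ q := hnn g
  -- On the test vector `f - ε c g` the form is `|c|² ε (ε q - 2)`, which is negative because `ε q <
  -- 1`.
  set ε : ℝ := 1 / (q + 1) with hε
  have hε0 : 0 < ε := by positivity
  have hεq : ε * q < 1 := by
    rw [hε, one_div_mul_eq_div, div_lt_one (by positivity)]; linarith
  have h := hnn (f + (-ε * c) • g)
  have e : (B (f + (-ε * c) • g) (f + (-ε * c) • g)).re =
      (B f f).re + (-2 * ε * normSq c + ε ^ 2 * normSq c * q) := by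
    have e1 : B (f + (-ε * c) • g) (f + (-ε * c) • g) =
        B f f + ((-2 * ε * normSq c : ℝ) + (ε ^ 2 * normSq c : ℝ) * B g g) := by
      simp only [map_add, LinearMap.add_apply, LinearMap.map_smulₛₗ, LinearMap.smul_apply,
        smul_eq_mul, RingHom.id_apply, map_mul, map_neg, conj_ofReal]
      rw [hB f g, ← hcdef]
      have := mul_conj c
      push_cast
      linear_combination (-2 * ε + ε ^ 2 * B g g) * this
    rw [e1, add_re, add_re, ofReal_re, re_ofReal_mul]
  rw [e, hf] at h
  nlinarith [mul_pos hε0 hn]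

lemma re_apply_smul_self (B : V →ₗ[ℂ] V →ₗ⋆[ℂ] ℂ) (r : ℝ) (f : V) :
    (B ((r : ℂ) • f) ((r : ℂ) • f)).re = r ^ 2 * (B f f).re := by
  simp only [map_smul, LinearMap.map_smulₛₗ, LinearMap.smul_apply, smul_eq_mul, conj_ofReal]
  rw [re_ofReal_mul, re_ofReal_mul]
  ring

/-- A continuous path of nondegenerate Hermitian forms that is positive definite at one point is
positive definite everywhere. -/
lemma isPosDefForm_of_path [Module.Finite ℂ V] {B : ℝ → V →ₗ[ℂ] V →ₗ⋆[ℂ] ℂ}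
    (hc : ∀ f g, Continuous fun t => B t f g)
    (hB : ∀ t f g, B t g f = (starRingEnd ℂ) (B t f g))
    (hnd : ∀ t f, (∀ g, B t f g = 0) → f = 0) {t₀ : ℝ} (h0 : ∀ f, f ≠ 0 → 0 < (B t₀ f f).re)
    (t₁ : ℝ) : IsPosDefForm (B t₁) := by
  refine ⟨hB t₁, fun f hf => ⟨conj_eq_iff_im.mp (hB t₁ f f).symm, ?_⟩⟩
  by_contra! hneg
  let b := Module.finBasis ℂ V
  let φ := b.equivFun.symm
  let Q : ℝ → (Fin (Module.finrank ℂ V) → ℂ) → ℝ := fun t v => (B t (φ v) (φ v)).re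
  let S := Metric.sphere (0 : Fin (Module.finrank ℂ V) → ℂ) 1
  have hS : IsCompact S := isCompact_sphere 0 1
  have hQc : Continuous ↿Q := by
    have e : ∀ t v, B t (φ v) (φ v) =
        ∑ i, v i * ∑ j, (starRingEnd ℂ) (v j) * B t (b i) (b j) := by
      intro t v
      simp only [φ, b.equivFun_symm_apply]
      rw [map_sum (B t), LinearMap.sum_apply]
      refine Finset.sum_congr rfl fun i _ => ?_
      rw [map_smul (B t), LinearMap.smul_apply, smul_eq_mul, map_sum]
      congr 1
      refine Finset.sum_congr rfl fun j _ => ?_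
      rw [LinearMap.map_smulₛₗ, smul_eq_mul]
    have hcc := continuous_conj
    change Continuous fun p : ℝ × (Fin (Module.finrank ℂ V) → ℂ) =>
      (B p.1 (φ p.2) (φ p.2)).re
    simp only [e]
    fun_prop
  -- The minimum over the compact unit sphere is continuous in `t`. If it became nonpositive it
  -- would vanish at some `t`; there the form is semidefinite with an isotropic minimizer, which
  -- then lies in the radical.
  have hm := hS.continuous_sInf hQc
  have hattain : ∀ t, S.Nonempty → ∃ x ∈ S, sInf (Q t '' S) = Q t x := fun t hne =>
    hS.exists_sInf_image_eq hne (hQc.comp (by fun_prop : Continuous fun v => (t, v))).continuousOn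
  have hle : ∀ t, ∀ y ∈ S, sInf (Q t '' S) ≤ Q t y := fun t y hy =>
    csInf_le (hS.image (hQc.comp (by fun_prop : Continuous fun v => (t, v)))).bddBelow ⟨y, hy, rfl⟩
  have hhom : ∀ t (r : ℝ) v, Q t ((r : ℂ) • v) = r ^ 2 * Q t v := fun t r v => by
    simp only [Q, map_smul φ, re_apply_smul_self]
  have hnorm : ∀ v : Fin (Module.finrank ℂ V) → ℂ, v ≠ 0 → ((‖v‖⁻¹ : ℝ) : ℂ) • v ∈ S := by
    intro v hv
    have : ‖v‖ ≠ 0 := norm_ne_zero_iff.mpr hv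
    simp [S, norm_smul, this]
  obtain ⟨v, rfl⟩ := φ.surjective f
  have hv : v ≠ 0 := fun h => hf (by rw [h, map_zero])
  have hw := hnorm v hv
  have hw1 : Q t₁ (((‖v‖⁻¹ : ℝ) : ℂ) • v) ≤ 0 := by
    rw [hhom]
    exact mul_nonpos_of_nonneg_of_nonpos (sq_nonneg _) hneg
  obtain ⟨x₀, hx₀, e₀⟩ := hattain t₀ ⟨_, hw⟩
  have hne : ∀ x ∈ S, φ x ≠ 0 := fun x hx h => by
    rw [LinearEquiv.map_eq_zero_iff] at h
    rw [h] at hx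
    simp [S] at hx
  obtain ⟨t, ht⟩ := mem_range_of_exists_le_of_exists_ge hm
    ⟨t₁, (hle t₁ _ hw).trans hw1⟩ ⟨t₀, e₀ ▸ (h0 _ (hne x₀ hx₀)).le⟩
  obtain ⟨x, hx, e⟩ := hattain t ⟨_, hw⟩
  have hnn : ∀ f, 0 ≤ (B t f f).re := by
    intro f
    obtain ⟨y, rfl⟩ := φ.surjective f
    rcases eq_or_ne y 0 with rfl | hy
    · simp
    · have h1 := hle t _ (hnorm y hy)
      simp only at ht
      rw [ht, hhom] at h1
      have : 0 < (‖y‖⁻¹) ^ 2 := by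
        have := norm_pos_iff.mpr hy
        positivity
      exact nonneg_of_mul_nonneg_right h1 this
  exact hne x hx (hnd t _ (eq_zero_of_apply_self_eq_zero (hB t) hnn (e.symm.trans ht)))

end PosDef

/-! ### Nondegeneracy and conclusion. -/

lemma apply_zero_ne_zero {τ : ℂ} (hτ : 0 < τ.im) {f : thetaSpace τ 0} (hf : f ≠ 0) :
    f.1 0 ≠ 0 := fun h => hf (by
  ext z
  rw [thetaSpace_zero_const hτ f.2 z 0, h]
  rfl)

/-- An element annihilated by all lowering operators vanishes. -/
lemma eq_zero_of_lowering_eq_zero {τ : ℂ} (hre : τ.re = 0) (hτ : 0 < τ.im) {N : ℕ} {η : ℂ}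
    (hη : η ∈ contRegion τ (N + 1)) (h0 : η ≠ 0) {f : thetaSpace τ (N + 1)}
    (h : ∀ b, lowering hτ N b η f = 0) : f = 0 := by
  have hne := theta_ne_zero_of_mem hre hτ hη h0
  have key : ∀ u, theta τ (2 * u) ≠ 0 → f.1 (u + η) = 0 := by
    intro u hu
    -- The parameter `b = u + (N+1)η` depends on the point: it kills the second term of the
    -- numerator and leaves `f (u + η)` times `-θ(2u) θ(2(N+1)η)`.
    have h1 := lowering_mul hτ N (u + (N + 1) * η) η f u
    rw [h, loweringNum, show u - (N + 1) * η + (u + (N + 1) * η) = 2 * u by ring,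
      show u - (N + 1) * η - (u + (N + 1) * η) = -(2 * ((N : ℂ) + 1) * η) by ring, sub_self,
      theta_zero, theta_neg] at h1
    simpa [hu, hne] using h1
  have hdense : Dense {z | theta τ (2 * z) ≠ 0} := by
    simpa using dense_theta_ne_zero hτ two_ne_zero 0
  have hfc := f.2.1.continuous
  have hz : (fun u => f.1 (u + η)) = fun _ => 0 :=
    Continuous.ext_on hdense (by fun_prop) continuous_const key
  ext z
  have := congrFun hz (z - η)
  simpa using this

/-- A vector in the radical is paired with the raising of its own lowering. By adjointness the
lowered vector has norm zero in the definite form at level `N`, so it vanishes, for every `b`. -/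
lemma IsContinuation.nondegenerate {τ : ℂ} (hre : τ.re = 0) (hτ : 0 < τ.im) {N : ℕ}
    {B : ℂ → thetaSpace τ N →ₗ[ℂ] thetaSpace τ N →ₗ⋆[ℂ] ℂ}
    (hB : IsContinuation τ N (contRegion τ N) B)
    {B' : ℂ → thetaSpace τ (N + 1) →ₗ[ℂ] thetaSpace τ (N + 1) →ₗ⋆[ℂ] ℂ}
    (hB' : IsContinuation τ (N + 1) (contRegion τ (N + 1)) B') {η : ℂ}
    (hη : η ∈ contRegion τ (N + 1)) (h0 : η ≠ 0) (hpos : IsPosDefForm (B η))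
    {f : thetaSpace τ (N + 1)} (hf : ∀ g, B' η f g = 0) : f = 0 := by
  refine eq_zero_of_lowering_eq_zero hre hτ hη h0 fun b => ?_
  by_contra hne
  have h := hB.raising_eq hre hτ hB' b f (lowering hτ N b η f) hη
  rw [hf, mul_zero, eq_comm, mul_eq_zero, neg_eq_zero] at h
  have hz := h.resolve_left (exp_ne_zero _)
  have := (hpos.2 _ hne).2
  rw [hz, zero_re] at this
  exact lt_irrefl _ this

lemma IsContinuation.zero_pos {τ : ℂ} (hre : τ.re = 0) (hτ : 0 < τ.im) {N : ℕ} {U : Set ℂ}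
    {B : ℂ → thetaSpace τ N →ₗ[ℂ] thetaSpace τ N →ₗ⋆[ℂ] ℂ}
    (hB : IsContinuation τ N U B) {f : thetaSpace τ N} (hf : f ≠ 0) : 0 < (B 0 f f).re := by
  obtain ⟨r, hr, e⟩ := metric_zero_pos hre hτ hf
  obtain ⟨c, hc, e'⟩ := inv_normConst_zero_pos hre hτ N
  rw [hB.eq_metric 0 (zero_mem_integralRange N), e, e', ← ofReal_mul, ofReal_re]
  exact mul_pos hc hr

lemma mul_mem_contRange {τ η : ℂ} {N : ℕ} (h : η ∈ contRange τ N) {r : ℝ} (h0 : 0 ≤ r)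
    (h1 : r ≤ 1) : (r : ℂ) * η ∈ contRange τ N := by
  have hle : 2 * (N : ℝ) * ‖(r : ℂ) * η‖ ≤ 2 * (N : ℝ) * ‖η‖ := by
    refine mul_le_mul_of_nonneg_left ?_ (by positivity)
    rw [norm_mul, norm_real, Real.norm_of_nonneg h0]
    exact mul_le_of_le_one_left (norm_nonneg _) h1
  rw [mem_contRange] at h ⊢
  rcases h with ⟨h2, h3⟩ | ⟨h2, h3⟩
  · exact Or.inl ⟨by simp [h2], hle.trans_lt h3⟩
  · exact Or.inr ⟨by simp [h2], hle.trans_lt h3⟩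

/-- Induction on `N`, following the segment from `0`, where the integral is positive, to `η`. The
segment stays in the range of the smaller level, so the induction hypothesis supplies nondegeneracy.
-/
theorem IsContinuation.isPosDefForm {τ : ℂ} (hre : τ.re = 0) (hτ : 0 < τ.im) {N : ℕ}
    {B : ℂ → thetaSpace τ N →ₗ[ℂ] thetaSpace τ N →ₗ⋆[ℂ] ℂ}
    (hB : IsContinuation τ N (contRegion τ N) B) {η : ℂ} (hη : η ∈ contRange τ N) :
    IsPosDefForm (B η) := by
  have hU := fun N => contRange_subset_contRegion hτ N
  induction N generalizing η with
  | zero =>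
    refine ⟨fun f g => hB.hermitian hre hτ f g hη, fun f hf => ?_⟩
    have h : B η f f = f.1 0 * (starRingEnd ℂ) (f.1 0) :=
      eqOn_contRegion hτ (M := 0) (hB.holomorphic f f) (differentiableOn_const _)
        (fun η hη => (hB.eq_metric η hη f f).trans
          (inv_normConst_mul_metric_zero hre hτ hη f f).symm) (hU 0 hη)
    rw [h, mul_conj, ofReal_im, ofReal_re]
    exact ⟨rfl, normSq_pos.mpr (apply_zero_ne_zero hτ hf)⟩
  | succ N ih =>
    obtain ⟨B₀, hB₀⟩ := exists_isContinuation hre hτ N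
    have : Fact (0 < τ.im) := ⟨hτ⟩
    -- The parameter is clamped to `[0, 1]` so that the path is defined on all of `ℝ`.
    let γ : ℝ → ℂ := fun t => (max 0 (min 1 t) : ℝ) * η
    have hγ : ∀ t, γ t ∈ contRange τ (N + 1) := fun t =>
      mul_mem_contRange hη (le_max_left _ _) (max_le zero_le_one (min_le_left _ _))
    have hγc : Continuous γ := by
      refine (continuous_ofReal.comp ?_).mul continuous_const
      fun_prop
    have h1 : γ 1 = η := by simp [γ]
    have h0 : γ 0 = 0 := by simp [γ]
    rw [← h1]
    refine isPosDefForm_of_path (B := fun t => B (γ t)) (t₀ := 0)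
      (fun f g => (hB.holomorphic f g).continuousOn.comp_continuous hγc fun t => hU _ (hγ t))
      (fun t f g => hB.hermitian hre hτ f g (hγ t)) (fun t f hf => ?_)
      (fun f hf => by simp only [h0]; exact hB.zero_pos hre hτ hf) 1
    -- At `η = 0` the adjointness relation degenerates to `0 = 0`; there nondegeneracy comes from
    -- the positive integral.
    rcases eq_or_ne (γ t) 0 with hz | hz
    · by_contra hne
      have := hB.zero_pos hre hτ hne
      rw [← hz, hf f, zero_re] at this
      exact lt_irrefl _ this
    · exact hB₀.nondegenerate hre hτ hB (hU _ (hγ t)) hz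
        (ih hB₀ (contRange_succ_subset τ N (hγ t))) hf

end Sklyanin

end

theorem proposition3p4 (τ : ℂ) (hτre : τ.re = 0) (hτim : 0 < τ.im) (N : ℕ) :
    ∃ (U : Set ℂ)
      (B : ℂ → Sklyanin.thetaSpace τ N →ₗ[ℂ] Sklyanin.thetaSpace τ N →ₗ⋆[ℂ] ℂ),
      Sklyanin.realRange ((N : ℤ) - 1) ∪ Sklyanin.imagRange τ ((N : ℤ) - 1) ⊆ U ∧
      Sklyanin.IsContinuation τ N U B ∧
      ∀ η ∈ Sklyanin.realRange ((N : ℤ) - 1) ∪ Sklyanin.imagRange τ ((N : ℤ) - 1),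
        Sklyanin.IsPosDefForm (B η) := by
  obtain ⟨B, hB⟩ := Sklyanin.exists_isContinuation hτre hτim N
  exact ⟨Sklyanin.contRegion τ N, B, Sklyanin.contRange_subset_contRegion hτim N, hB,
    fun η hη => hB.isPosDefForm hτre hτim hη⟩
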